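/- \textbf{Setting.} Let $d\in\mathbb N$, and let $\mathcal M(\mathbb R^d)$ and $\mathcal P(\mathbb R^d)$ be the finite positive Borel measures and the probability measures on $\mathbb R^d$; $\|\mu\|=\mu(\mathbb R^d)$ for $\mu\in\mathcal M(\mathbb R^d)$. Let $C^1_\infty(\mathbb R^d)$ be the space of $C^1$ functions $f$ such that $f$ and $\nabla f$ vanish at infinity, with norm $\sup|f|+\sup|\nabla f|$, and put $$\|\mu-\eta\|_{(C^1_\infty)^\star}=\sup\{|(f,\mu)-(f,\eta)|:\ f\in C^1_\infty(\mathbb R^d),\ \|f\|_{C^1}\le 1\},\qquad (f,\mu)=\int f\,d\mu .$$ Let $S$ be either $\mathcal P(\mathbb R^d)$ or $\mathcal M(\mathbb R^d)$. For every $\mu\in S$ and $x\in\mathbb R^d$ let $b(x,\mu)\in\mathbb R^d$ be a vector and $\nu(x,\mu,\cdot)$ a positive Borel measure on $\mathbb R^d$ with $\nu(x,\mu,\{0\})=0$, and let $$A_\mu f(x)=(b(x,\mu),\nabla f(x))+\int_{\mathbb R^d}(f(x+y)-f(x))\,\nu(x,\mu,dy).$$ \textbf{Assumptions.} For every $\mu\in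 S$ the function $b(\cdot,\mu)$ is continuously differentiable, and the gradient $\nabla\nu(x,\mu,dy)$ in $x$ exists in the weak sense as an $\mathbb R^d$-valued signed measure on $\mathbb R^d\setminus\{0\}$ and is weakly continuous in $x$: for every continuous $\varphi$ with compact support in $\mathbb R^d\setminus\{0\}$, the function $x\mapsto\int\varphi(y)\,\nu(x,\mu,dy)$ is differentiable with gradient $\int\varphi(y)\,\nabla\nu(x,\mu,dy)$, which is continuous in $x$. For every $R\geq 0$ the following hold, where all suprema are over $x\in\mathbb R^d$ and over $\mu\in S$ with $\|\mu\|\le R$ (for $S=\mathcal P(\mathbb R^d)$: over all probability measures), and $B_K$ is the ball of radius $K$ around $0$. (i) Boundedness: $\sup|b(x,\mu)|<\infty$, $\sup|\nabla b(x,\mu)|<\infty$, $\sup\int\min(1,|y|)\,\nu(x,\mu,dy)<\infty$, $\sup\int\min(1,|y|)\,|\nabla\nu(x,\mu,dy)|<\infty$. (ii) Tightness: for every $\epsilon>0$ there is $K>0$ such that $$\sup\int_{\mathbb R^d\setminus B_K}\nu(x,\mu,dy)\le\epsilon,\qquad \sup\int_{\mathbb R^d\setminus B_K}|\nabla\nu(x,\mu,dy)|\le\epsilon,\qquad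 \sup\int_{B_{1/K}}|y|\,\nu(x,\mu,dy)\le\epsilon.$$ (iii) Lipschitz continuity: there is a constant $c$ such that, for all $\mu_1,\mu_2\in S$ with $\|\mu_1\|,\|\mu_2\|\le R$, $$\sup_x\int\min(1,|y|)\,|\nu(x,\mu_1,dy)-\nu(x,\mu_2,dy)|\le c\|\mu_1-\mu_2\|_{(C^1_\infty)^\star},\qquad \sup_x|b(x,\mu_1)-b(x,\mu_2)|\le c\|\mu_1-\mu_2\|_{(C^1_\infty)^\star}.$$ \textbf{Theorem.} Under these assumptions (in each of the two cases $S=\mathcal P(\mathbb R^d)$ and $S=\mathcal M(\mathbb R^d)$) the weak nonlinear Cauchy problem $$\frac{d}{dt}(f,\mu_t)=(A_{\mu_t}f,\mu_t)\quad\text{for all } f\in C^1_\infty(\mathbb R^d),\qquad \mu_0=\mu,$$ is well posed in $S$. That is, for every $\mu\in S$ it has a solution $T_t(\mu)\in S$, $t\ge0$; for every $r\ge0$ this is the only solution with values in $S$ on $[0,r]$; and $\|T_t(\mu)\|=\|\mu\|$ for all $t\geq 0$. The transformations $T_t$ of $S$ form a semigroup: $T_0(\mu)=\mu$ and $T_{s+t}(\mu)=T_s(T_t(\mu))$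 for $s,t\ge0$. They are Lipschitz continuous in the initial data and in time: for all $R,r\ge0$ there are constants $C=C(R,r)$ and $C'=C'(R)$ such that, for all $\mu,\eta\in S$ with $\|\mu\|,\|\eta\|\le R$, $$\|T_t(\mu)-T_t(\eta)\|_{(C^1_\infty)^\star}\le C\|\mu-\eta\|_{(C^1_\infty)^\star}\ \ (0\le t\le r),\qquad \|T_s(\mu)-T_t(\mu)\|_{(C^1_\infty)^\star}\le C'|s-t|\ \ (s,t\ge0).$$ In particular this holds on $\mathcal P(\mathbb R^d)$. -/

import Mathlib

open MeasureTheory Set Filter Topology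
open scoped NNReal ENNReal

noncomputable section

namespace OrderOne

/-- The Euclidean space `ℝ^d`. -/
abbrev Space (d : ℕ) : Type := EuclideanSpace ℝ (Fin d)

variable {d : ℕ}

/-- `C^1_∞(ℝ^d)`: continuously differentiable functions that vanish at infinity together with
their first derivative. -/
structure IsC1Infty (f : Space d → ℝ) : Prop where
  contDiff : ContDiff ℝ 1 f
  vanish : Tendsto f (cocompact (Space d)) (𝓝 0)
  vanish_deriv : Tendsto (fderiv ℝ f) (cocompact (Space d)) (𝓝 0)

/-- The norm of `C^1(ℝ^d)`: `sup |f| + sup |∇f|` (both suprema are finite on `C^1_∞`). -/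
def c1Norm (f : Space d → ℝ) : ℝ := (⨆ x, |f x|) + ⨆ x, ‖fderiv ℝ f x‖

/-- The distance `‖μ - η‖` in the norm of the dual of `C^1_∞(ℝ^d)`, for finite measures:
the supremum of `|(f, μ) - (f, η)|` over the unit ball of `C^1_∞(ℝ^d)`. -/
def dualDist (μ η : FiniteMeasure (Space d)) : ℝ :=
  sSup {a : ℝ | ∃ f : Space d → ℝ, IsC1Infty f ∧ c1Norm f ≤ 1 ∧
    a = |∫ x, f x ∂(μ : Measure (Space d)) - ∫ x, f x ∂(η : Measure (Space d))|}

/-- The variation `|ν₁ - ν₂|` of the difference of two positive measures: the sum of the positive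
part of `ν₁ - ν₂` and the positive part of `ν₂ - ν₁` (Mathlib's subtraction of measures gives
exactly the positive part). -/
def absDiff (ν₁ ν₂ : Measure (Space d)) : Measure (Space d) := (ν₁ - ν₂) + (ν₂ - ν₁)

/-- The weight `min(1, |y|)`, as an extended nonnegative number. -/
def weight (y : Space d) : ℝ≥0∞ := ENNReal.ofReal (min 1 ‖y‖)

/-- An `ℝ^d`-valued signed measure, possibly of infinite total variation, given by its polar
decomposition `dir(y) var(dy)`: `var` is its variation, `dir` is its density of norm one. -/
structure SignedVectorMeasure (d : ℕ) where
  var : Measure (Space d)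
  dir : Space d → Space d
  measurable_dir : Measurable dir
  norm_dir : ∀ᵐ y ∂var, ‖dir y‖ = 1

/-- The vector `∫ φ(y) m(dy)`. -/
def SignedVectorMeasure.integral (m : SignedVectorMeasure d) (φ : Space d → ℝ) : Space d :=
  ∫ y, φ y • m.dir y ∂m.var

/-- Test functions on `ℝ^d \ {0}`: continuous functions whose support is compact and does not
contain the origin. -/
structure IsTestAwayFromZero (φ : Space d → ℝ) : Prop where
  continuous : Continuous φ
  compact : HasCompactSupport φ
  zero_notMem : (0 : Space d) ∉ tsupport φ

/-- The family `g(x, dy)` of signed vector measures on `ℝ^d \ {0}` is the gradient in `x`, in the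
weak sense, of the family `n(x, dy)` of measures, and it depends weakly continuously on `x`. -/
structure IsWeakGradient (n : Space d → Measure (Space d))
    (g : Space d → SignedVectorMeasure d) : Prop where
  var_zero : ∀ x, (g x).var {0} = 0
  hasGradientAt : ∀ φ : Space d → ℝ, IsTestAwayFromZero φ → ∀ x,
    HasGradientAt (fun z => ∫ y, φ y ∂(n z)) ((g x).integral φ) x
  continuous : ∀ φ : Space d → ℝ, IsTestAwayFromZero φ → Continuous fun x => (g x).integral φ

/-- The operator `A_μ f(x) = (b(x,μ), ∇f(x)) + ∫ (f(x+y) - f(x)) ν(x,μ,dy)`. -/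
def generator (b : Space d → FiniteMeasure (Space d) → Space d)
    (ν : Space d → FiniteMeasure (Space d) → Measure (Space d))
    (μ : FiniteMeasure (Space d)) (f : Space d → ℝ) (x : Space d) : ℝ :=
  fderiv ℝ f x (b x μ) + ∫ y, (f (x + y) - f x) ∂(ν x μ)

/-- The probability measures, as a set of finite measures. -/
def probabilities (d : ℕ) : Set (FiniteMeasure (Space d)) := {μ | μ.mass = 1}

/-- The standing assumptions on the drift `b`, the Lévy kernel `ν` and its weak `x`-gradient `gν`,
for measures `μ` ranging over the class `S`, uniformly over the bounded parts of `S`. -/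
structure Assumptions (S : Set (FiniteMeasure (Space d)))
    (b : Space d → FiniteMeasure (Space d) → Space d)
    (ν : Space d → FiniteMeasure (Space d) → Measure (Space d))
    (gν : Space d → FiniteMeasure (Space d) → SignedVectorMeasure d) : Prop where
  /-- Lévy measures do not charge the origin. -/
  levy : ∀ μ ∈ S, ∀ x, ν x μ {0} = 0
  /-- `b(·, μ)` is continuously differentiable. -/
  contDiff_drift : ∀ μ ∈ S, ContDiff ℝ 1 fun x => b x μ
  /-- The weak gradient of `ν` exists and is weakly continuous. -/
  weakGradient : ∀ μ ∈ S, IsWeakGradient (fun x => ν x μ) fun x => gν x μ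
  /-- Boundedness of `b(·, μ)` in `C^1(ℝ^d)`. -/
  bounded_drift : ∀ R : ℝ≥0, ∃ C : ℝ, ∀ μ ∈ S, μ.mass ≤ R → ∀ x,
    ‖b x μ‖ ≤ C ∧ ‖fderiv ℝ (fun z => b z μ) x‖ ≤ C
  /-- Boundedness of `ν` and of its gradient. -/
  bounded_kernel : ∀ R : ℝ≥0, ∃ C : ℝ≥0, ∀ μ ∈ S, μ.mass ≤ R → ∀ x,
    ∫⁻ y, weight y ∂(ν x μ) ≤ C ∧ ∫⁻ y, weight y ∂(gν x μ).var ≤ C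
  /-- Tightness at infinity, and at the origin. -/
  tight : ∀ R : ℝ≥0, ∀ ε : ℝ≥0, 0 < ε → ∃ K : ℝ, 0 < K ∧ ∀ μ ∈ S, μ.mass ≤ R → ∀ x,
    ν x μ (Metric.ball 0 K)ᶜ ≤ ε ∧ (gν x μ).var (Metric.ball 0 K)ᶜ ≤ ε ∧
      ∫⁻ y in Metric.ball 0 (1 / K), ‖y‖ₑ ∂(ν x μ) ≤ ε
  /-- Lipschitz continuity in `μ`. -/
  lipschitz : ∀ R : ℝ≥0, ∃ c : ℝ, ∀ μ₁ ∈ S, ∀ μ₂ ∈ S, μ₁.mass ≤ R → μ₂.mass ≤ R → ∀ x,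
    ∫⁻ y, weight y ∂(absDiff (ν x μ₁) (ν x μ₂)) ≤ ENNReal.ofReal (c * dualDist μ₁ μ₂) ∧
      ‖b x μ₁ - b x μ₂‖ ≤ c * dualDist μ₁ μ₂

/-- The curve `m` with values in `S` solves, on the time set `J`, the weak nonlinear Cauchy problem
`d/dt (f, m_t) = (A_{m_t} f, m_t)` for all `f ∈ C^1_∞(ℝ^d)`, `m_0 = μ`
(with one-sided derivatives at the end points of `J`). -/
structure IsWeakSolution (S : Set (FiniteMeasure (Space d)))
    (b : Space d → FiniteMeasure (Space d) → Space d)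
    (ν : Space d → FiniteMeasure (Space d) → Measure (Space d))
    (J : Set ℝ) (μ : FiniteMeasure (Space d)) (m : ℝ → FiniteMeasure (Space d)) : Prop where
  mem : ∀ t ∈ J, m t ∈ S
  init : m 0 = μ
  hasDeriv : ∀ f : Space d → ℝ, IsC1Infty f → ∀ t ∈ J,
    HasDerivWithinAt (fun s => ∫ x, f x ∂(m s : Measure (Space d)))
      (∫ x, generator b ν (m t) f x ∂(m t : Measure (Space d))) J t

/-- The weak nonlinear Cauchy problem is well posed in `S`: there are transformations `T t` of `S`,
`t ≥ 0`, such that `T t μ` is the unique solution started at `μ`; they preserve the norm (the total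
mass), form a semigroup, and are Lipschitz continuous in the initial data (locally uniformly in
time) and in time, in the norm of the dual of `C^1_∞(ℝ^d)`. -/
def WellPosed (S : Set (FiniteMeasure (Space d)))
    (b : Space d → FiniteMeasure (Space d) → Space d)
    (ν : Space d → FiniteMeasure (Space d) → Measure (Space d)) : Prop :=
  ∃ T : ℝ → FiniteMeasure (Space d) → FiniteMeasure (Space d),
    (∀ μ ∈ S, IsWeakSolution S b ν (Ici 0) μ fun t => T t μ) ∧
    (∀ μ ∈ S, ∀ r : ℝ, 0 ≤ r → ∀ m : ℝ → FiniteMeasure (Space d),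
      IsWeakSolution S b ν (Icc 0 r) μ m → ∀ t ∈ Icc 0 r, m t = T t μ) ∧
    (∀ μ ∈ S, ∀ t, 0 ≤ t → (T t μ).mass = μ.mass) ∧
    (∀ μ ∈ S, T 0 μ = μ) ∧
    (∀ μ ∈ S, ∀ s t, 0 ≤ s → 0 ≤ t → T (s + t) μ = T s (T t μ)) ∧
    (∀ R : ℝ≥0, ∀ r : ℝ, ∃ C : ℝ, ∀ μ ∈ S, ∀ η ∈ S, μ.mass ≤ R → η.mass ≤ R →
      ∀ t ∈ Icc 0 r, dualDist (T t μ) (T t η) ≤ C * dualDist μ η) ∧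
    (∀ R : ℝ≥0, ∃ C : ℝ, ∀ μ ∈ S, μ.mass ≤ R →
      ∀ s t, 0 ≤ s → 0 ≤ t → dualDist (T s μ) (T t μ) ≤ C * |s - t|)

end OrderOne

end

/-!
The weak equation is a nonlinear transport equation for measures. It is solved by an explicit Euler
scheme, and everything else is a consequence of a single stability estimate.

In a time step `h`, with coefficients frozen at a measure `μ` and a point `x`, the particle is
shifted by `2 h b(x, μ)` with probability one half and makes a jump with intensity `h ν(x, μ, ·)`,
where the jumps smaller than a multiple of `h` are damped so that the probability to jump is at most
one half (`frozenStep`). This step is a positive operator that preserves constants, and it agrees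
with `1 + h A_μ` up to `o(h)` on functions with bounded second differences
(`UniformBounds.exists_consistency`). It does not increase the supremum of a function, and it
multiplies the Lipschitz constant by at most `1 + O(h)` (`UniformBounds.eulerStep_isBL`), because
the coefficients are Lipschitz continuous in `x`.

Stability (`UniformBounds.stability`) is proved by duality. If two curves `m`, `p` satisfy the weak
equation up to an error, then a test function `f` in `∫ f dm_t - ∫ f dp_t` is pulled back in time
along the Euler steps with the measure argument `m`. The difficulty is that consistency needs second
differences, which such steps do not control if the coefficients are merely Lipschitz in `x`. The
coefficients are therefore averaged over balls of radius `ε` in `x` (`mollStep`). The second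
differences then stay bounded by a constant that depends on `ε` but not on the number of steps, and,
since the operator is of order at most one, the averaging costs an error `O(ε)` that involves only
the Lipschitz constant of the test function. One chooses first `ε`, then the step, then the
admissible defect of the curves. The dependence of the coefficients on the measure is Lipschitz for
the dual distance and is absorbed by a discrete Gronwall argument.

Existence follows: Euler schemes are approximate solutions, so by stability they are Cauchy in the
dual distance at each time, and the limit of their integrals is given by a measure, by the
Riesz–Markov–Kakutani theorem (`exists_cauchy_limit`). The limit curve has an exact first-order
expansion in time against smooth test functions, and an approximation in `C¹` yields the weak
equation for all test functions in `C¹_∞`. Conversely every solution has such an expansion, so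
uniqueness and the Lipschitz dependence on the data are stability without defect. All these
estimates hold on sets of measures of bounded mass. That an arbitrary solution has bounded mass on
compact time intervals follows from the continuity in time of its integrals, by a gliding hump
argument (`exists_mass_le`).
-/

namespace OrderOne

variable {d : ℕ}

/-! ### Bounded Lipschitz functions and second differences -/

/-- Bounded Lipschitz functions; one constant serves as a bound for both the values and the
Lipschitz constant. -/
structure IsBL (A : ℝ) (f : Space d → ℝ) : Prop where
  bound : ∀ x, |f x| ≤ A
  lip : ∀ x y, |f x - f y| ≤ A * ‖x - y‖

/-- The mixed second differences of `f` are bounded by `Λ ‖v‖ ‖w‖`. For a continuously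
differentiable function this says that the derivative is `Λ`-Lipschitz; the formulation by
differences is stable under averaging and needs no differentiation. -/
def HasD2 (Λ : ℝ) (f : Space d → ℝ) : Prop :=
  ∀ x v w, |f (x + v + w) - f (x + v) - f (x + w) + f x| ≤ Λ * ‖v‖ * ‖w‖

lemma IsBL.nonneg {A : ℝ} {f : Space d → ℝ} (hf : IsBL A f) : 0 ≤ A :=
  (abs_nonneg _).trans (hf.bound 0)

lemma IsBL.continuous {A : ℝ} {f : Space d → ℝ} (hf : IsBL A f) : Continuous f := by
  refine (LipschitzWith.of_dist_le_mul (K := ⟨A, hf.nonneg⟩) fun x y => ?_).continuous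
  rw [Real.dist_eq, dist_eq_norm]
  exact hf.lip x y

lemma IsBL.mono {A B : ℝ} {f : Space d → ℝ} (hf : IsBL A f) (h : A ≤ B) : IsBL B f :=
  ⟨fun x => (hf.bound x).trans h, fun x y => (hf.lip x y).trans (by gcongr)⟩

lemma HasD2.mono {A B : ℝ} {f : Space d → ℝ} (hf : HasD2 A f) (h : A ≤ B) : HasD2 B f :=
  fun x v w => (hf x v w).trans (by gcongr)

lemma integrable_of_abs_le (μ : Measure (Space d)) [IsFiniteMeasure μ] {M : ℝ}
    {f : Space d → ℝ} (hf : Continuous f) (hM : ∀ x, |f x| ≤ M) : Integrable f μ :=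
  Integrable.of_bound hf.aestronglyMeasurable M (Eventually.of_forall fun x => by
    simpa using hM x)

lemma IsBL.integrable {A : ℝ} {f : Space d → ℝ} (hf : IsBL A f) (μ : Measure (Space d))
    [IsFiniteMeasure μ] : Integrable f μ :=
  integrable_of_abs_le μ hf.continuous hf.bound

lemma abs_integral_le_mul_mass {A : ℝ} {f : Space d → ℝ} (hf : ∀ x, |f x| ≤ A)
    (μ : FiniteMeasure (Space d)) : |∫ x, f x ∂(μ : Measure (Space d))| ≤ A * μ.mass := by
  have := norm_integral_le_of_norm_le_const (μ := (μ : Measure (Space d))) (f := f) (C := A)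
    (Eventually.of_forall fun x => by simpa using hf x)
  rwa [Real.norm_eq_abs] at this

lemma IsBL.add {A B : ℝ} {f g : Space d → ℝ} (hf : IsBL A f) (hg : IsBL B g) :
    IsBL (A + B) fun x => f x + g x := by
  refine ⟨fun x => (abs_add_le _ _).trans (add_le_add (hf.bound x) (hg.bound x)), fun x y => ?_⟩
  have h1 := hf.lip x y
  have h2 := hg.lip x y
  rw [abs_le] at *
  constructor <;> linarith [h1.1, h1.2, h2.1, h2.2]

lemma IsBL.const_mul {A : ℝ} {f : Space d → ℝ} (hf : IsBL A f) (c : ℝ) :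
    IsBL (|c| * A) fun x => c * f x := by
  refine ⟨fun x => ?_, fun x y => ?_⟩
  · rw [abs_mul]; exact mul_le_mul_of_nonneg_left (hf.bound x) (abs_nonneg c)
  · rw [← mul_sub, abs_mul, mul_assoc]
    exact mul_le_mul_of_nonneg_left (hf.lip x y) (abs_nonneg c)

lemma IsBL.sub {A B : ℝ} {f g : Space d → ℝ} (hf : IsBL A f) (hg : IsBL B g) :
    IsBL (A + B) fun x => f x - g x := by
  have := hf.add (hg.const_mul (-1))
  simpa [sub_eq_add_neg] using this

lemma IsBL.mul {A B : ℝ} {f g : Space d → ℝ} (hf : IsBL A f) (hg : IsBL B g) :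
    IsBL (2 * (A * B)) fun x => f x * g x := by
  have hA := hf.nonneg
  have hB := hg.nonneg
  refine ⟨fun x => ?_, fun x y => ?_⟩
  · rw [abs_mul]
    have := mul_le_mul (hf.bound x) (hg.bound x) (abs_nonneg _) hA
    nlinarith [mul_nonneg hA hB]
  · have e : f x * g x - f y * g y = f x * (g x - g y) + (f x - f y) * g y := by ring
    rw [e]
    refine (abs_add_le _ _).trans ?_
    rw [abs_mul, abs_mul]
    have h1 := mul_le_mul (hf.bound x) (hg.lip x y) (abs_nonneg _) hA
    have h2 := mul_le_mul (hf.lip x y) (hg.bound y) (abs_nonneg _) (by positivity)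
    nlinarith

lemma isBL_const (c : ℝ) : IsBL |c| fun _ : Space d => c :=
  ⟨fun _ => le_rfl, fun x y => by simp; positivity⟩

/-- The Leibniz rule for second differences. -/
lemma HasD2.mul {A B Λ Γ : ℝ} {f g : Space d → ℝ} (hf : IsBL A f) (hg : IsBL B g)
    (hf' : HasD2 Λ f) (hg' : HasD2 Γ g) :
    HasD2 (A * Γ + Λ * B + 2 * (A * B)) fun x => f x * g x := by
  intro x v w
  have hA := hf.nonneg
  have hB := hg.nonneg
  have e : f (x + v + w) * g (x + v + w) - f (x + v) * g (x + v) - f (x + w) * g (x + w)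
      + f x * g x = f (x + v + w) * (g (x + v + w) - g (x + v) - g (x + w) + g x)
      + (f (x + v + w) - f (x + v)) * (g (x + v) - g x)
      + (f (x + v + w) - f (x + w)) * (g (x + w) - g x)
      + (f (x + v + w) - f (x + v) - f (x + w) + f x) * g x := by ring
  simp only [e]
  have l1 : |f (x + v + w) - f (x + v)| ≤ A * ‖w‖ := by
    simpa using hf.lip (x + v + w) (x + v)
  have l2 : |f (x + v + w) - f (x + w)| ≤ A * ‖v‖ := by
    simpa [add_right_comm x v w] using hf.lip (x + v + w) (x + w)
  have l3 : |g (x + v) - g x| ≤ B * ‖v‖ := by simpa using hg.lip (x + v) x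
  have l4 : |g (x + w) - g x| ≤ B * ‖w‖ := by simpa using hg.lip (x + w) x
  have t1 := mul_le_mul (hf.bound (x + v + w)) (hg' x v w) (abs_nonneg _) hA
  have t2 := mul_le_mul l1 l3 (abs_nonneg _) (by positivity)
  have t3 := mul_le_mul l2 l4 (abs_nonneg _) (by positivity)
  have t4 := mul_le_mul (hf' x v w) (hg.bound x) (abs_nonneg _)
    ((abs_nonneg _).trans (hf' x v w))
  rw [← abs_mul] at t1 t2 t3 t4
  refine (abs_add_le _ _).trans ?_
  refine (add_le_add_left ((abs_add_le _ _).trans (add_le_add_left (abs_add_le _ _) _)) _).trans ?_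
  linarith

/-- Bounded second differences make the increments of a function small in the bounded Lipschitz
sense. -/
lemma IsBL.diff {A Λ : ℝ} {f : Space d → ℝ} (hf : IsBL A f) (hf' : HasD2 Λ f) (hΛ : 0 ≤ Λ)
    (v : Space d) : IsBL ((A + Λ) * ‖v‖) fun x => f (x + v) - f x := by
  refine ⟨fun x => ?_, fun x y => ?_⟩
  · refine (hf.lip (x + v) x).trans ?_
    simp only [add_sub_cancel_left]
    gcongr
    linarith
  · have h := hf' y v (x - y)
    have e : f (x + v) - f x - (f (y + v) - f y)
        = f (y + v + (x - y)) - f (y + v) - f (y + (x - y)) + f y := by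
      rw [show y + v + (x - y) = x + v by abel, show y + (x - y) = x by abel]; ring
    rw [e]
    refine h.trans ?_
    have := hf.nonneg
    gcongr
    linarith

/-! ### Differentiable functions with bounded second differences -/

lemma HasD2.norm_fderiv_sub_le {Λ : ℝ} {f : Space d → ℝ} (hf' : HasD2 Λ f) (hΛ : 0 ≤ Λ)
    (hf : Differentiable ℝ f) (x y : Space d) :
    ‖fderiv ℝ f x - fderiv ℝ f y‖ ≤ Λ * ‖x - y‖ := by
  refine ContinuousLinearMap.opNorm_le_bound _ (by positivity) fun w => ?_
  have hx := ((hf x).hasFDerivAt.hasLineDerivAt w).tendsto_slope_zero_right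
  have hy := ((hf y).hasFDerivAt.hasLineDerivAt w).tendsto_slope_zero_right
  have hxy := (hx.sub hy).norm
  refine le_of_tendsto hxy ?_
  filter_upwards [self_mem_nhdsWithin] with t ht
  have ht : 0 < t := ht
  have h := hf' y (x - y) (t • w)
  rw [show y + (x - y) = x by abel] at h
  rw [norm_smul, Real.norm_of_nonneg ht.le] at h
  rw [← smul_sub, norm_smul, norm_inv, Real.norm_of_nonneg ht.le]
  rw [inv_mul_le_iff₀ ht, Real.norm_eq_abs]
  calc |f (x + t • w) - f x - (f (y + t • w) - f y)|
      = |f (x + t • w) - f x - f (y + t • w) + f y| := by congr 1; ring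
    _ ≤ _ := h
    _ = _ := by ring

lemma hasD2_of_norm_fderiv_sub_le {Λ : ℝ} {f : Space d → ℝ} (hf : Differentiable ℝ f)
    (h : ∀ x y, ‖fderiv ℝ f x - fderiv ℝ f y‖ ≤ Λ * ‖x - y‖) : HasD2 Λ f := by
  intro x v w
  have hd : ∀ z, HasFDerivAt (fun z => f (z + v) - f z) (fderiv ℝ f (z + v) - fderiv ℝ f z) z :=
    fun z => ((hasFDerivAt_comp_add_right v).2 (hf (z + v)).hasFDerivAt).sub (hf z).hasFDerivAt
  have := (convex_univ (E := Space d)).norm_image_sub_le_of_norm_hasFDerivWithin_le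
    (f := fun z => f (z + v) - f z) (C := Λ * ‖v‖) (x := x) (y := x + w)
    (fun z _ => (hd z).hasFDerivWithinAt) (fun z _ => by simpa using h (z + v) z)
    (mem_univ _) (mem_univ _)
  rw [Real.norm_eq_abs] at this
  refine le_trans (le_of_eq ?_) (this.trans (by simp))
  rw [add_right_comm x v w]
  congr 1; ring

lemma HasD2.taylor {Λ : ℝ} {f : Space d → ℝ} (hf' : HasD2 Λ f) (hΛ : 0 ≤ Λ)
    (hf : Differentiable ℝ f) (x v : Space d) :
    |f (x + v) - f x - fderiv ℝ f x v| ≤ Λ * ‖v‖ * ‖v‖ := by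
  have h := (convex_segment (𝕜 := ℝ) x (x + v)).norm_image_sub_le_of_norm_fderiv_le' (f := f)
    (φ := fderiv ℝ f x) (C := Λ * ‖v‖) (fun z _ => hf z) (fun z hz => ?_)
    (left_mem_segment ℝ x (x + v)) (right_mem_segment ℝ x (x + v))
  · simpa using h
  · refine (hf'.norm_fderiv_sub_le hΛ hf z x).trans ?_
    gcongr
    have := norm_sub_le_of_mem_segment hz
    simpa using this

lemma IsBL.norm_fderiv_le {A : ℝ} {f : Space d → ℝ} (hf : IsBL A f) (x : Space d) :
    ‖fderiv ℝ f x‖ ≤ A := by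
  have : LipschitzWith ⟨A, hf.nonneg⟩ f := LipschitzWith.of_dist_le_mul fun x y => by
    rw [Real.dist_eq, dist_eq_norm]
    exact hf.lip x y
  exact norm_fderiv_le_of_lipschitz ℝ this

lemma isBL_of_norm_fderiv_le {A : ℝ} {f : Space d → ℝ} (hf : Differentiable ℝ f)
    (h0 : ∀ x, |f x| ≤ A) (h1 : ∀ x, ‖fderiv ℝ f x‖ ≤ A) : IsBL A f := by
  refine ⟨h0, fun x y => ?_⟩
  simpa using (convex_univ (E := Space d)).norm_image_sub_le_of_norm_fderiv_le (f := f)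
    (fun z _ => hf z) (fun z _ => h1 z) (mem_univ y) (mem_univ x)

/-! ### Mollification -/

/-- A smooth probability density on the ball of radius `ε` around the origin whose first and second
differences are bounded in `L¹` with constant `K`. -/
structure IsMollifier (ε K : ℝ) (ρ : Space d → ℝ) : Prop where
  contDiff : ContDiff ℝ 1 ρ
  compact : HasCompactSupport ρ
  nonneg : ∀ z, 0 ≤ ρ z
  integral_eq_one : ∫ z, ρ z = 1
  norm_le : ∀ z, ρ z ≠ 0 → ‖z‖ ≤ ε
  integral_diff_le : ∀ v, ∫ z, |ρ (z + v) - ρ z| ≤ K * ‖v‖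
  integral_diff₂_le : ∀ v w, ∫ z, |ρ (z + v + w) - ρ (z + v) - ρ (z + w) + ρ z| ≤ K * ‖v‖ * ‖w‖

lemma exists_isMollifier (d : ℕ) {ε : ℝ} (hε : 0 < ε) :
    ∃ K : ℝ, 0 ≤ K ∧ ∃ ρ : Space d → ℝ, IsMollifier ε K ρ := by
  let φ : ContDiffBump (0 : Space d) := ⟨ε / 2, ε, by positivity, by linarith⟩
  set ρ : Space d → ℝ := φ.normed volume with hρ
  have hsm : ContDiff ℝ 2 ρ := by exact_mod_cast φ.contDiff_normed (n := 2)
  have hc : HasCompactSupport ρ := φ.hasCompactSupport_normed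
  have hd : Differentiable ℝ ρ := hsm.differentiable (by norm_num)
  obtain ⟨C₁, h₁⟩ := hsm.lipschitzWith_of_hasCompactSupport hc (by norm_num)
  obtain ⟨C₂, h₂⟩ := (hsm.fderiv_right (m := 1) (by norm_num)).lipschitzWith_of_hasCompactSupport
    (hc.fderiv (𝕜 := ℝ)) (by norm_num)
  have hD2 : HasD2 C₂ ρ := hasD2_of_norm_fderiv_sub_le hd fun x y => by
    simpa [dist_eq_norm] using h₂.dist_le_mul x y
  have hsupp : ∀ z, ρ z ≠ 0 → z ∈ Metric.ball (0 : Space d) ε := fun z hz => by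
    have : z ∈ Function.support ρ := hz
    rwa [hρ, φ.support_normed_eq] at this
  set B : Space d → ℝ := (Metric.ball (0 : Space d) ε).indicator fun _ => 1 with hB
  have hB1 : ∀ z, ρ z ≠ 0 → B z = 1 := fun z hz => by simp [hB, hsupp z hz]
  have hB0 : ∀ z, 0 ≤ B z := fun z => indicator_nonneg (by simp) z
  have hBi : Integrable B := by
    refine (integrable_indicator_iff Metric.isOpen_ball.measurableSet).2 ?_
    exact integrableOn_const measure_ball_lt_top.ne
  have hBv : ∀ v, Integrable fun z => B (z + v) := fun v => hBi.comp_add_right v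
  set V := ∫ z, B z
  have hV : 0 ≤ V := integral_nonneg hB0
  have hVv : ∀ v, ∫ z, B (z + v) = V := fun v => integral_add_right_eq_self B v
  refine ⟨(2 * C₁ + 4 * C₂) * V, by positivity, ρ, hsm.of_le (by norm_num), hc, φ.nonneg_normed,
    φ.integral_normed, fun z hz => ?_, fun v => ?_, fun v w => ?_⟩
  · exact (mem_ball_zero_iff.1 (hsupp z hz)).le
  · have hle : ∀ z, |ρ (z + v) - ρ z| ≤ C₁ * ‖v‖ * (B (z + v) + B z) := fun z => by
      by_cases hz : ρ (z + v) = 0 ∧ ρ z = 0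
      · rw [hz.1, hz.2]; simp; have := hB0 z; have := hB0 (z + v); positivity
      · have h := h₁.dist_le_mul (z + v) z
        rw [Real.dist_eq, dist_eq_norm, add_sub_cancel_left] at h
        refine h.trans (le_mul_of_one_le_right (by positivity) ?_)
        by_cases h0 : ρ z = 0
        · rw [hB1 (z + v) fun h' => hz ⟨h', h0⟩]; linarith [hB0 z]
        · rw [hB1 z h0]; linarith [hB0 (z + v)]
    have hi : Integrable fun z => C₁ * ‖v‖ * (B (z + v) + B z) := ((hBv v).add hBi).const_mul _
    refine (integral_mono_of_nonneg (Eventually.of_forall fun z => abs_nonneg _) hi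
      (Eventually.of_forall hle)).trans ?_
    rw [integral_const_mul, integral_add (hBv v) hBi, hVv]
    have : (0 : ℝ) ≤ C₂ * V * ‖v‖ := by positivity
    linarith
  · have hle : ∀ z, |ρ (z + v + w) - ρ (z + v) - ρ (z + w) + ρ z|
        ≤ C₂ * ‖v‖ * ‖w‖ * (B (z + (v + w)) + B (z + v) + (B (z + w) + B z)) := fun z => by
      have b1 := hB0 z
      have b2 := hB0 (z + v)
      have b3 := hB0 (z + w)
      have b4 := hB0 (z + (v + w))
      by_cases hz : ρ (z + (v + w)) = 0 ∧ ρ (z + v) = 0 ∧ ρ (z + w) = 0 ∧ ρ z = 0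
      · rw [add_assoc z v w, hz.1, hz.2.1, hz.2.2.1, hz.2.2.2]; simp; positivity
      · refine (hD2 z v w).trans (le_mul_of_one_le_right (by positivity) ?_)
        by_cases h0 : ρ z = 0
        · by_cases h1 : ρ (z + v) = 0
          · by_cases h2 : ρ (z + w) = 0
            · rw [hB1 (z + (v + w)) fun h' => hz ⟨h', h1, h2, h0⟩]; linarith
            · rw [hB1 _ h2]; linarith
          · rw [hB1 _ h1]; linarith
        · rw [hB1 z h0]; linarith
    have i1 : Integrable fun z => B (z + (v + w)) + B (z + v) := (hBv (v + w)).add (hBv v)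
    have i2 : Integrable fun z => B (z + w) + B z := (hBv w).add hBi
    have hi : Integrable fun z =>
        C₂ * ‖v‖ * ‖w‖ * (B (z + (v + w)) + B (z + v) + (B (z + w) + B z)) :=
      (i1.add i2).const_mul _
    refine (integral_mono_of_nonneg (Eventually.of_forall fun z => abs_nonneg _) hi
      (Eventually.of_forall hle)).trans ?_
    have e1 : ∫ z, (B (z + (v + w)) + B (z + v)) = 2 * V := by
      rw [integral_add (hBv _) (hBv _), hVv, hVv]; ring
    have e2 : ∫ z, (B (z + w) + B z) = 2 * V := by
      rw [integral_add (hBv _) hBi, hVv]; ring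
    have e3 : ∫ z, (B (z + (v + w)) + B (z + v) + (B (z + w) + B z)) = 4 * V := by
      rw [integral_add i1 i2, e1, e2]; ring
    rw [integral_const_mul, e3]
    have : (0 : ℝ) ≤ C₁ * V * ‖v‖ * ‖w‖ := by positivity
    linarith

lemma integral_four {α : Type*} [MeasurableSpace α] {μ : Measure α} {F₁ F₂ F₃ F₄ : α → ℝ}
    (h₁ : Integrable F₁ μ) (h₂ : Integrable F₂ μ) (h₃ : Integrable F₃ μ) (h₄ : Integrable F₄ μ) :
    ∫ z, F₁ z ∂μ - ∫ z, F₂ z ∂μ - ∫ z, F₃ z ∂μ + ∫ z, F₄ z ∂μ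
      = ∫ z, (F₁ z - F₂ z - F₃ z + F₄ z) ∂μ := by
  have h₁₂ : Integrable (fun z => F₁ z - F₂ z) μ := h₁.sub h₂
  have h₁₂₃ : Integrable (fun z => F₁ z - F₂ z - F₃ z) μ := h₁₂.sub h₃
  rw [← integral_sub h₁ h₂, ← integral_sub h₁₂ h₃, ← integral_add h₁₂₃ h₄]

/-- The convolution `ρ * f`. -/
noncomputable def smoothing (ρ f : Space d → ℝ) (x : Space d) : ℝ := ∫ u, ρ (x - u) * f u

section Mollifier

variable {ε K : ℝ} {ρ : Space d → ℝ} (h : IsMollifier ε K ρ)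
include h

lemma IsMollifier.continuous : Continuous ρ := h.contDiff.continuous

lemma IsMollifier.integrable : Integrable ρ :=
  h.continuous.integrable_of_hasCompactSupport h.compact

lemma IsMollifier.integrable_mul {F : Space d → ℝ} (hF : Continuous F) :
    Integrable fun z => ρ z * F z :=
  (h.continuous.mul hF).integrable_of_hasCompactSupport h.compact.mul_right

lemma IsMollifier.integrable_sub_mul {F : Space d → ℝ} (hF : Continuous F) (x : Space d) :
    Integrable fun u => ρ (x - u) * F u := by
  have := h.integrable_mul (F := fun z => F (x - z)) (by fun_prop)
  simpa using this.comp_sub_left x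

/-- An average with respect to a mollifier is bounded by the supremum over the `ε`-ball. -/
lemma IsMollifier.abs_integral_le {B : ℝ} {F : Space d → ℝ} (hF : ∀ z, ‖z‖ ≤ ε → |F z| ≤ B) :
    |∫ z, ρ z * F z| ≤ B := by
  have := norm_integral_le_of_norm_le (f := fun z => ρ z * F z) (h.integrable.mul_const B)
    (Eventually.of_forall fun z => by
      rw [Real.norm_eq_abs, abs_mul, abs_of_nonneg (h.nonneg z)]
      by_cases hz : ρ z = 0
      · simp [hz]
      · exact mul_le_mul_of_nonneg_left (hF z (h.norm_le z hz)) (h.nonneg z))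
  rwa [integral_mul_const, h.integral_eq_one, one_mul, Real.norm_eq_abs] at this

omit h in
lemma integral_sub_mul_eq (ρ F : Space d → ℝ) (x : Space d) :
    ∫ u, ρ (x - u) * F u = ∫ z, ρ z * F (x - z) := by
  have := integral_sub_left_eq_self (fun z => ρ z * F (x - z)) volume x
  simpa using this

omit h in
lemma smoothing_eq (ρ f : Space d → ℝ) (x : Space d) :
    smoothing ρ f x = ∫ z, ρ z * f (x - z) := integral_sub_mul_eq ρ f x

/-- If all the differences `f (x - z) - f x` with `‖z‖ ≤ ε` are small in `C¹`-norm, then so is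
the error of the mollification. -/
lemma IsMollifier.smoothing_sub {η : ℝ} {f : Space d → ℝ} (hf : Continuous f)
    (hη : ∀ z, ‖z‖ ≤ ε → IsBL η fun x => f (x - z) - f x) :
    IsBL η fun x => smoothing ρ f x - f x := by
  have hi : ∀ x, Integrable fun z => ρ z * (f (x - z) - f x) := fun x =>
    h.integrable_mul (by fun_prop)
  have e : ∀ x, smoothing ρ f x - f x = ∫ z, ρ z * (f (x - z) - f x) := fun x => by
    simp_rw [mul_sub]
    rw [integral_sub (h.integrable_mul (by fun_prop)) (h.integrable.mul_const _),
      integral_mul_const, h.integral_eq_one, one_mul, smoothing_eq]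
  refine ⟨fun x => ?_, fun x y => ?_⟩
  · rw [e]
    exact h.abs_integral_le fun z hz => (hη z hz).bound x
  · rw [e, e, ← integral_sub (hi x) (hi y)]
    simp_rw [← mul_sub]
    exact h.abs_integral_le fun z hz => (hη z hz).lip x y

lemma IsMollifier.abs_smoothing_sub_le {η : ℝ} {f : Space d → ℝ} (hf : Continuous f) (x : Space d)
    (hη : ∀ z, ‖z‖ ≤ ε → |f (x - z) - f x| ≤ η) : |smoothing ρ f x - f x| ≤ η := by
  have e : smoothing ρ f x - f x = ∫ z, ρ z * (f (x - z) - f x) := by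
    simp_rw [mul_sub]
    rw [integral_sub (h.integrable_mul (by fun_prop)) (h.integrable.mul_const _),
      integral_mul_const, h.integral_eq_one, one_mul, smoothing_eq]
  rw [e]
  exact h.abs_integral_le hη

lemma IsMollifier.smoothing_isBL {A : ℝ} {f : Space d → ℝ} (hf : IsBL A f) :
    IsBL A (smoothing ρ f) := by
  have hfc := hf.continuous
  refine ⟨fun x => ?_, fun x y => ?_⟩
  · rw [smoothing_eq]
    exact h.abs_integral_le fun z _ => hf.bound _
  · rw [smoothing_eq, smoothing_eq, ← integral_sub (h.integrable_mul (by fun_prop))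
      (h.integrable_mul (by fun_prop))]
    simp_rw [← mul_sub]
    exact h.abs_integral_le fun z _ => by simpa using hf.lip (x - z) (y - z)

lemma IsMollifier.smoothing_hasD2 {Λ : ℝ} {f : Space d → ℝ} (hfc : Continuous f)
    (hf : HasD2 Λ f) : HasD2 Λ (smoothing ρ f) := by
  intro x v w
  have i : ∀ y, Integrable fun z => ρ z * f (y - z) := fun y => h.integrable_mul (by fun_prop)
  have e : smoothing ρ f (x + v + w) - smoothing ρ f (x + v) - smoothing ρ f (x + w)
      + smoothing ρ f x = ∫ z, ρ z * (f (x - z + v + w) - f (x - z + v) - f (x - z + w)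
        + f (x - z)) := by
    simp only [smoothing_eq]
    rw [integral_four (i _) (i _) (i _) (i _)]
    congr 1
    ext z
    rw [show x + v + w - z = x - z + v + w by abel, show x + v - z = x - z + v by abel,
      show x + w - z = x - z + w by abel]
    ring
  rw [e]
  exact h.abs_integral_le fun z _ => hf (x - z) v w

/-- Mollification turns a Lipschitz bound into a bound for second differences. -/
lemma IsMollifier.smoothing_hasD2_of_isBL {A : ℝ} {f : Space d → ℝ} (hf : IsBL A f) :
    HasD2 (K * A) (smoothing ρ f) := by
  intro x v w
  have hfc := hf.continuous
  have hρ := h.continuous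
  have i : ∀ y, Integrable fun u => ρ (y - u) * f u := fun y => h.integrable_sub_mul hfc y
  have i' : ∀ y, Integrable fun u => ρ (y - u) * f (u + w) :=
    fun y => h.integrable_sub_mul (by fun_prop) y
  have s : ∀ y, smoothing ρ f (y + w) = ∫ u, ρ (y - u) * f (u + w) := fun y => by
    have := integral_add_right_eq_self (fun u => ρ (y + w - u) * f u) w (μ := volume)
    simp only [add_sub_add_right_eq_sub] at this
    exact this.symm
  have e : smoothing ρ f (x + v + w) - smoothing ρ f (x + v) - smoothing ρ f (x + w)
      + smoothing ρ f x = ∫ u, (ρ (x - u + v) - ρ (x - u)) * (f (u + w) - f u) := by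
    rw [s, s]
    simp only [smoothing]
    rw [integral_four (i' _) (i _) (i' _) (i _)]
    congr 1
    ext u
    rw [show x - u + v = x + v - u by abel]
    ring
  have hA := hf.nonneg
  have hi : Integrable fun z => |ρ (z + v) - ρ z| :=
    ((h.integrable.comp_add_right v).sub h.integrable).abs
  have := norm_integral_le_of_norm_le
    (f := fun u => (ρ (x - u + v) - ρ (x - u)) * (f (u + w) - f u))
    ((hi.comp_sub_left x).mul_const (A * ‖w‖))
    (Eventually.of_forall fun u => by
      rw [Real.norm_eq_abs, abs_mul]
      exact mul_le_mul_of_nonneg_left (by simpa using hf.lip (u + w) u) (abs_nonneg _))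
  rw [integral_mul_const, integral_sub_left_eq_self (fun z => |ρ (z + v) - ρ z|) volume x,
    Real.norm_eq_abs] at this
  rw [e]
  refine this.trans ((mul_le_mul_of_nonneg_right (h.integral_diff_le v) (by positivity)).trans ?_)
  exact le_of_eq (by ring)

omit h in
lemma smoothing_eq_convolution (ρ f : Space d → ℝ) :
    smoothing ρ f = convolution f ρ (ContinuousLinearMap.lsmul ℝ ℝ) volume := by
  funext x
  simp [smoothing, convolution, mul_comm]

lemma IsMollifier.smoothing_contDiff {f : Space d → ℝ} (hf : Continuous f) :
    ContDiff ℝ 1 (smoothing ρ f) := by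
  rw [smoothing_eq_convolution]
  exact_mod_cast h.compact.contDiff_convolution_right (ContinuousLinearMap.lsmul ℝ ℝ)
    hf.locallyIntegrable (μ := volume) h.contDiff

lemma IsMollifier.smoothing_hasCompactSupport {f : Space d → ℝ} (hf : HasCompactSupport f) :
    HasCompactSupport (smoothing ρ f) := by
  rw [smoothing_eq_convolution]
  exact HasCompactSupport.convolution (ContinuousLinearMap.lsmul ℝ ℝ) (μ := volume) hf h.compact

end Mollifier

/-! ### Cutoff functions and approximation by compactly supported functions -/

lemma isC1Infty_of_hasCompactSupport {f : Space d → ℝ} (hf : ContDiff ℝ 1 f)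
    (hc : HasCompactSupport f) : IsC1Infty f :=
  ⟨hf, hc.is_zero_at_infty, (hc.fderiv (𝕜 := ℝ)).is_zero_at_infty⟩

/-- A fixed smooth function that is `1` on the unit ball and `0` outside the ball of radius `2`. -/
noncomputable def unitBump (d : ℕ) : ContDiffBump (0 : Space d) := ⟨1, 2, one_pos, one_lt_two⟩

/-- A smooth function that is `1` on the ball of radius `n + 1` and `0` outside the ball of radius
`2 (n + 1)`. -/
noncomputable def cutoff (n : ℕ) (x : Space d) : ℝ := unitBump d ((n + 1 : ℝ)⁻¹ • x)

lemma cutoff_nonneg (n : ℕ) (x : Space d) : 0 ≤ cutoff n x := (unitBump d).nonneg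

lemma cutoff_le_one (n : ℕ) (x : Space d) : cutoff n x ≤ 1 := (unitBump d).le_one

lemma cutoff_eq_one {n : ℕ} {x : Space d} (hx : ‖x‖ ≤ n + 1) : cutoff n x = 1 := by
  refine (unitBump d).one_of_mem_closedBall ?_
  have hn : (0 : ℝ) < n + 1 := by positivity
  have : (unitBump d).rIn = 1 := rfl
  rw [mem_closedBall_zero_iff, norm_smul, norm_inv, Real.norm_of_nonneg hn.le, this,
    inv_mul_le_iff₀ hn]
  simpa using hx

lemma tendsto_cutoff (x : Space d) : Tendsto (fun n => cutoff n x) atTop (𝓝 1) := by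
  refine tendsto_const_nhds.congr' ?_
  filter_upwards [eventually_ge_atTop ⌈‖x‖⌉₊] with n hn
  rw [cutoff_eq_one ((Nat.ceil_le.1 hn).trans (by simp))]

lemma cutoff_contDiff (n : ℕ) : ContDiff ℝ 2 (cutoff n : Space d → ℝ) :=
  (unitBump d).contDiff.comp (contDiff_const_smul _)

lemma cutoff_hasCompactSupport (n : ℕ) : HasCompactSupport (cutoff n : Space d → ℝ) :=
  (unitBump d).hasCompactSupport.comp_homeomorph
    (Homeomorph.smulOfNeZero ((n + 1 : ℝ)⁻¹) (by positivity))

lemma cutoff_isC1Infty (n : ℕ) : IsC1Infty (cutoff n : Space d → ℝ) :=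
  isC1Infty_of_hasCompactSupport ((cutoff_contDiff n).of_le (by norm_num))
    (cutoff_hasCompactSupport n)

lemma tendsto_integral_cutoff (μ : FiniteMeasure (Space d)) :
    Tendsto (fun n => ∫ x, cutoff n x ∂(μ : Measure (Space d))) atTop
      (𝓝 (∫ _, (1 : ℝ) ∂(μ : Measure (Space d)))) := by
  refine tendsto_integral_of_dominated_convergence (fun _ => 1)
    (fun n => (cutoff_contDiff n).continuous.aestronglyMeasurable) (integrable_const _)
    (fun n => Eventually.of_forall fun x => ?_) (Eventually.of_forall tendsto_cutoff)
  rw [Real.norm_eq_abs, abs_of_nonneg (cutoff_nonneg n x)]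
  exact cutoff_le_one n x

lemma exists_cutoff_bounds (d : ℕ) : ∃ K : ℝ, 1 ≤ K ∧ ∀ n : ℕ,
    IsBL K (cutoff n : Space d → ℝ) ∧ HasD2 K (cutoff n : Space d → ℝ) := by
  have hsm : ContDiff ℝ 2 (unitBump d) := (unitBump d).contDiff
  have hc := (unitBump d).hasCompactSupport
  obtain ⟨C₁, h₁⟩ := hsm.lipschitzWith_of_hasCompactSupport hc (by norm_num)
  obtain ⟨C₂, h₂⟩ := (hsm.fderiv_right (m := 1) (by norm_num)).lipschitzWith_of_hasCompactSupport
    (hc.fderiv (𝕜 := ℝ)) (by norm_num)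
  have hD2 : HasD2 C₂ (unitBump d) :=
    hasD2_of_norm_fderiv_sub_le (hsm.differentiable (by norm_num)) fun x y => by
      simpa [dist_eq_norm] using h₂.dist_le_mul x y
  have p₁ : (0 : ℝ) ≤ C₁ := C₁.2
  have p₂ : (0 : ℝ) ≤ C₂ := C₂.2
  have hs : ∀ (n : ℕ) (v : Space d), ‖(n + 1 : ℝ)⁻¹ • v‖ ≤ ‖v‖ := fun n v => by
    rw [norm_smul, norm_inv, Real.norm_of_nonneg (by positivity)]
    exact mul_le_of_le_one_left (norm_nonneg _) (inv_le_one_of_one_le₀ (by simp))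
  refine ⟨1 + C₁ + C₂, by linarith, fun n => ⟨⟨fun x => ?_, fun x y => ?_⟩, fun x v w => ?_⟩⟩
  · rw [abs_of_nonneg (cutoff_nonneg n x)]
    exact (cutoff_le_one n x).trans (by linarith)
  · have h := h₁.dist_le_mul ((n + 1 : ℝ)⁻¹ • x) ((n + 1 : ℝ)⁻¹ • y)
    rw [Real.dist_eq, dist_eq_norm, ← smul_sub] at h
    exact h.trans (mul_le_mul (by linarith) (hs n _) (norm_nonneg _) (by linarith))
  · have h := hD2 ((n + 1 : ℝ)⁻¹ • x) ((n + 1 : ℝ)⁻¹ • v) ((n + 1 : ℝ)⁻¹ • w)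
    simp only [← smul_add] at h
    refine h.trans ?_
    have h1 := hs n v
    have h2 := hs n w
    have h3 : (C₂ : ℝ) ≤ 1 + C₁ + C₂ := by linarith
    gcongr

/-- Every bounded Lipschitz function is a pointwise limit of compactly supported smooth functions,
with control of the bounds. -/
lemma exists_approx (d : ℕ) : ∃ K : ℝ, 1 ≤ K ∧ ∀ (A : ℝ) (f : Space d → ℝ), IsBL A f →
    ∃ g : ℕ → Space d → ℝ, (∀ n, IsC1Infty (g n)) ∧ (∀ n, IsBL (K * A) (g n)) ∧
      (∀ Λ, 0 ≤ Λ → HasD2 Λ f → ∀ n, HasD2 (K * (A + Λ)) (g n)) ∧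
      ∀ x, Tendsto (fun n => g n x) atTop (𝓝 (f x)) := by
  obtain ⟨K, hK, hcut⟩ := exists_cutoff_bounds d
  have hcBL := fun n => (hcut n).1
  choose k hk ρ hρ using fun n : ℕ => exists_isMollifier d (ε := 1 / ((n : ℝ) + 1)) (by positivity)
  refine ⟨3 * K, by linarith, fun A f hf =>
    ⟨fun n => smoothing (ρ n) fun x => cutoff n x * f x, fun n => ?_, fun n => ?_,
      fun Λ hΛ hD n => ?_, fun x => ?_⟩⟩
  · exact isC1Infty_of_hasCompactSupport
      ((hρ n).smoothing_contDiff ((hcBL n).mul hf).continuous)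
      ((hρ n).smoothing_hasCompactSupport (cutoff_hasCompactSupport n).mul_right)
  · refine (hρ n).smoothing_isBL (((hcBL n).mul hf).mono ?_)
    have := mul_nonneg (by linarith : 0 ≤ K) hf.nonneg
    linarith
  · refine (hρ n).smoothing_hasD2 ((hcBL n).mul hf).continuous
      ((HasD2.mul (hcBL n) hf (hcut n).2 hD).mono ?_)
    have := mul_nonneg (by linarith : 0 ≤ K) hΛ
    linarith
  · have hlim : Tendsto (fun n : ℕ => 2 * (K * A) * (1 / ((n : ℝ) + 1))) atTop (𝓝 0) := by
      simpa using tendsto_one_div_add_atTop_nhds_zero_nat.const_mul (2 * (K * A))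
    refine tendsto_iff_norm_sub_tendsto_zero.2 (squeeze_zero' (Eventually.of_forall fun n =>
      norm_nonneg _) ?_ hlim)
    filter_upwards [eventually_ge_atTop ⌈‖x‖⌉₊] with n hn
    have hx : ‖x‖ ≤ n + 1 := (Nat.ceil_le.1 hn).trans (by simp)
    have h := (hρ n).abs_smoothing_sub_le ((hcBL n).mul hf).continuous x
      (η := 2 * (K * A) * (1 / ((n : ℝ) + 1))) fun z hz => by
        refine (((hcBL n).mul hf).lip _ _).trans ?_
        have := ((hcBL n).mul hf).nonneg
        gcongr
        simpa using hz
    simpa only [cutoff_eq_one hx, one_mul, Real.norm_eq_abs] using h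

/-! ### The norm of `C¹_∞` and the dual distance -/

lemma IsC1Infty.isBL {f : Space d → ℝ} (hf : IsC1Infty f) : IsBL (c1Norm f) f := by
  have hd := hf.contDiff.differentiable (by norm_num)
  let F : ZeroAtInftyContinuousMap (Space d) ℝ := ⟨⟨f, hf.contDiff.continuous⟩, hf.vanish⟩
  let G : ZeroAtInftyContinuousMap (Space d) (Space d →L[ℝ] ℝ) :=
    ⟨⟨fderiv ℝ f, hf.contDiff.continuous_fderiv (by norm_num)⟩, hf.vanish_deriv⟩
  have b0 : BddAbove (range fun x => |f x|) := by
    obtain ⟨C, hC⟩ := F.isBounded_range.exists_norm_le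
    exact ⟨C, by rintro _ ⟨x, rfl⟩; exact hC _ ⟨x, rfl⟩⟩
  have b1 : BddAbove (range fun x => ‖fderiv ℝ f x‖) := by
    obtain ⟨C, hC⟩ := G.isBounded_range.exists_norm_le
    exact ⟨C, by rintro _ ⟨x, rfl⟩; exact hC _ ⟨x, rfl⟩⟩
  refine isBL_of_norm_fderiv_le hd (fun x => ?_) fun x => ?_
  · exact (le_ciSup b0 x).trans (le_add_of_nonneg_right (Real.iSup_nonneg fun _ => norm_nonneg _))
  · exact (le_ciSup b1 x).trans (le_add_of_nonneg_left (Real.iSup_nonneg fun _ => abs_nonneg _))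

lemma c1Norm_le {A : ℝ} {f : Space d → ℝ} (hf : IsBL A f) : c1Norm f ≤ 2 * A := by
  rw [c1Norm, two_mul]
  exact add_le_add (ciSup_le hf.bound) (ciSup_le hf.norm_fderiv_le)

lemma IsC1Infty.const_mul {f : Space d → ℝ} (hf : IsC1Infty f) (c : ℝ) :
    IsC1Infty fun x => c * f x := by
  refine ⟨contDiff_const.mul hf.contDiff, by simpa using hf.vanish.const_mul c, ?_⟩
  have : fderiv ℝ (fun x => c * f x) = fun x => c • fderiv ℝ f x := by
    funext x
    exact fderiv_const_mul (hf.contDiff.differentiable (by norm_num) x) c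
  rw [this]
  simpa using hf.vanish_deriv.const_smul c

lemma dualDist_nonneg (μ η : FiniteMeasure (Space d)) : 0 ≤ dualDist μ η :=
  Real.sSup_nonneg (by rintro _ ⟨f, -, -, rfl⟩; exact abs_nonneg _)

lemma dualDist_le {μ η : FiniteMeasure (Space d)} {B : ℝ} (hB : 0 ≤ B)
    (h : ∀ f : Space d → ℝ, IsC1Infty f → IsBL 1 f →
      |∫ x, f x ∂(μ : Measure (Space d)) - ∫ x, f x ∂(η : Measure (Space d))| ≤ B) :
    dualDist μ η ≤ B :=
  Real.sSup_le (by rintro _ ⟨f, hf, hf1, rfl⟩; exact h f hf (hf.isBL.mono hf1)) hB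

lemma dualDist_self (μ : FiniteMeasure (Space d)) : dualDist μ μ = 0 :=
  le_antisymm (dualDist_le le_rfl fun f _ _ => by simp) (dualDist_nonneg _ _)

lemma abs_integral_sub_le_dualDist {μ η : FiniteMeasure (Space d)} {f : Space d → ℝ}
    (hf : IsC1Infty f) (h1 : c1Norm f ≤ 1) :
    |∫ x, f x ∂(μ : Measure (Space d)) - ∫ x, f x ∂(η : Measure (Space d))| ≤ dualDist μ η := by
  refine le_csSup ⟨1 * μ.mass + 1 * η.mass, ?_⟩ ⟨f, hf, h1, rfl⟩
  rintro _ ⟨g, hg, hg1, rfl⟩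
  have hb := (hg.isBL.mono hg1).bound
  exact (abs_sub _ _).trans (add_le_add (abs_integral_le_mul_mass hb μ)
    (abs_integral_le_mul_mass hb η))

/-- The dual distance, defined by test functions that vanish at infinity, controls all bounded
Lipschitz functions. -/
lemma exists_dualDist_bound (d : ℕ) : ∃ K : ℝ, 1 ≤ K ∧ ∀ (A : ℝ) (f : Space d → ℝ), IsBL A f →
    ∀ μ η : FiniteMeasure (Space d),
      |∫ x, f x ∂(μ : Measure (Space d)) - ∫ x, f x ∂(η : Measure (Space d))|
        ≤ K * A * dualDist μ η := by
  obtain ⟨K, hK, happ⟩ := exists_approx d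
  refine ⟨2 * K, by linarith, fun A f hf μ η => ?_⟩
  obtain ⟨g, hg, hgA, -, hlim⟩ := happ A f hf
  have hA := hf.nonneg
  have hl : ∀ μ : FiniteMeasure (Space d), Tendsto (fun n => ∫ x, g n x ∂(μ : Measure (Space d)))
      atTop (𝓝 (∫ x, f x ∂(μ : Measure (Space d)))) := fun μ =>
    tendsto_integral_of_dominated_convergence (fun _ => K * A)
      (fun n => (hgA n).continuous.aestronglyMeasurable) (integrable_const _)
      (fun n => Eventually.of_forall fun x => by simpa using (hgA n).bound x)
      (Eventually.of_forall hlim)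
  refine le_of_tendsto ((hl μ).sub (hl η)).abs (Eventually.of_forall fun n => ?_)
  have hn := c1Norm_le (hgA n)
  refine le_of_forall_pos_le_add fun δ hδ => ?_
  set D := dualDist μ η
  have hD : 0 ≤ D := dualDist_nonneg μ η
  -- rescaling by a positive constant also covers the case `A = 0`
  set s : ℝ := 2 * (K * A) + δ / (D + 1)
  have hs : 0 < s := by positivity
  have hsc : c1Norm (fun x => s⁻¹ * g n x) ≤ 1 := by
    have e : c1Norm (fun x => s⁻¹ * g n x) = s⁻¹ * c1Norm (g n) := by
      have hd := (hg n).contDiff.differentiable (by norm_num)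
      have : ∀ x, fderiv ℝ (fun x => s⁻¹ * g n x) x = s⁻¹ • fderiv ℝ (g n) x :=
        fun x => fderiv_const_mul (hd x) _
      simp only [c1Norm, this, abs_mul, norm_smul, Real.norm_eq_abs, abs_of_pos (inv_pos.2 hs)]
      rw [← Real.mul_iSup_of_nonneg (by positivity), ← Real.mul_iSup_of_nonneg (by positivity),
        mul_add]
    rw [e, inv_mul_le_iff₀ hs, mul_one]
    exact hn.trans (le_add_of_nonneg_right (by positivity))
  have h := abs_integral_sub_le_dualDist (μ := μ) (η := η) ((hg n).const_mul s⁻¹) hsc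
  simp only [integral_const_mul] at h
  rw [← mul_sub, abs_mul, abs_of_pos (inv_pos.2 hs), inv_mul_le_iff₀ hs] at h
  refine h.trans ?_
  have : δ / (D + 1) * D ≤ δ := by
    rw [div_mul_eq_mul_div, div_le_iff₀ (by positivity)]
    nlinarith
  simp only [s]
  nlinarith

lemma eq_of_dualDist_eq_zero {μ η : FiniteMeasure (Space d)} (h : dualDist μ η = 0) : μ = η := by
  obtain ⟨K, -, hK⟩ := exists_dualDist_bound d
  have key : ∀ A (f : Space d → ℝ), IsBL A f →
      ∫ x, f x ∂(μ : Measure (Space d)) = ∫ x, f x ∂(η : Measure (Space d)) := fun A f hf => by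
    have := hK A f hf μ η
    rw [h, mul_zero] at this
    exact sub_eq_zero.1 (abs_nonpos_iff.1 this)
  have hcl : ∀ F : Set (Space d), IsClosed F →
      (μ : Measure (Space d)) F = (η : Measure (Space d)) F := fun F hF => by
    have hpos : ∀ n : ℕ, (0 : ℝ) < 1 / ((n : ℝ) + 1) := fun n => by positivity
    have hl := fun ξ : FiniteMeasure (Space d) => tendsto_integral_thickenedIndicator_of_isClosed
      (ξ : Measure (Space d)) hF hpos tendsto_one_div_add_atTop_nhds_zero_nat
    have he : ∀ n : ℕ, ∫ x, (thickenedIndicator (hpos n) F x : ℝ) ∂(μ : Measure (Space d))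
        = ∫ x, (thickenedIndicator (hpos n) F x : ℝ) ∂(η : Measure (Space d)) := fun n => by
      refine key (max 1 ((1 / ((n : ℝ) + 1)).toNNReal⁻¹ : ℝ≥0)) _ ⟨fun x => ?_, fun x y => ?_⟩
      · rw [NNReal.abs_eq]
        exact le_max_of_le_left (by exact_mod_cast thickenedIndicator_le_one (hpos n) F x)
      · have h := (lipschitzWith_thickenedIndicator (hpos n) F).dist_le_mul x y
        rw [NNReal.dist_eq, dist_eq_norm] at h
        exact h.trans (mul_le_mul_of_nonneg_right (le_max_right _ _) (norm_nonneg _))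
    have h2 := tendsto_nhds_unique ((hl μ).congr he) (hl η)
    rwa [Measure.real, Measure.real,
      ENNReal.toReal_eq_toReal_iff' (measure_ne_top _ _) (measure_ne_top _ _)] at h2
  have hm : (μ : Measure (Space d)) = (η : Measure (Space d)) := by
    refine ext_of_generate_finite _ ?_ isPiSystem_isClosed hcl (hcl univ isClosed_univ)
    rw [BorelSpace.measurable_eq (α := Space d), borel_eq_generateFrom_isClosed]
  exact Subtype.ext hm

/-- Functions of class `C¹_∞` are approximated in `C¹`-norm by compactly supported functions with
bounded second differences. -/
lemma IsC1Infty.exists_smooth_approx {f : Space d → ℝ} (hf : IsC1Infty f) {η : ℝ} (hη : 0 < η) :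
    ∃ g : Space d → ℝ, IsC1Infty g ∧ (∃ A Λ : ℝ, 0 ≤ Λ ∧ IsBL A g ∧ HasD2 Λ g) ∧
      IsBL η fun x => f x - g x := by
  have hfd := hf.contDiff.differentiable (by norm_num)
  obtain ⟨K, hK, hcut⟩ := exists_cutoff_bounds d
  have hcd : ∀ n, Differentiable ℝ (cutoff n : Space d → ℝ) := fun n =>
    (cutoff_contDiff n).differentiable (by norm_num)
  -- the cutoff at a radius outside of which `f` and its derivative are small
  obtain ⟨n, hn⟩ : ∃ n : ℕ, ∀ x : Space d, (n : ℝ) + 1 ≤ ‖x‖ →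
      |f x| ≤ η / (4 * K) ∧ ‖fderiv ℝ f x‖ ≤ η / (4 * K) := by
    have e1 : ∀ᶠ x in cocompact (Space d), |f x| ≤ η / (4 * K) := by
      have := hf.vanish.abs
      simp only [abs_zero] at this
      exact this.eventually_le_const (by positivity)
    have e2 : ∀ᶠ x in cocompact (Space d), ‖fderiv ℝ f x‖ ≤ η / (4 * K) := by
      have := hf.vanish_deriv.norm
      simp only [norm_zero] at this
      exact this.eventually_le_const (by positivity)
    have e := e1.and e2
    rw [← Metric.cobounded_eq_cocompact, ← comap_norm_atTop, eventually_comap] at e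
    obtain ⟨r, hr⟩ := eventually_atTop.1 e
    refine ⟨⌈r⌉₊, fun x hx => hr ‖x‖ ?_ x rfl⟩
    have := Nat.le_ceil r
    linarith
  set F : Space d → ℝ := fun x => cutoff n x * f x with hF
  have hFsm : ContDiff ℝ 1 F := ((cutoff_contDiff n).of_le (by norm_num)).mul hf.contDiff
  have hFc : HasCompactSupport F := (cutoff_hasCompactSupport n).mul_right
  have hFd := hFsm.differentiable (by norm_num)
  have step1 : IsBL (η / 2) fun x => f x - F x := by
    have hd : ∀ x, HasFDerivAt (fun x => f x - F x)
        (fderiv ℝ f x - (cutoff n x • fderiv ℝ f x + f x • fderiv ℝ (cutoff n) x)) x := fun x =>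
      (hfd x).hasFDerivAt.sub ((hcd n x).hasFDerivAt.mul (hfd x).hasFDerivAt)
    refine isBL_of_norm_fderiv_le (fun x => (hd x).differentiableAt) (fun x => ?_) fun x => ?_
    · by_cases hx : ‖x‖ ≤ n + 1
      · simpa [hF, cutoff_eq_one hx] using (half_pos hη).le
      · have e : f x - F x = (1 - cutoff n x) * f x := by simp only [hF]; ring
        have h0 := cutoff_nonneg n x
        have h1 := cutoff_le_one n x
        rw [e, abs_mul, abs_of_nonneg (by linarith)]
        calc (1 - cutoff n x) * |f x| ≤ 1 * (η / (4 * K)) :=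
              mul_le_mul (by linarith) (hn x (not_le.1 hx).le).1 (abs_nonneg _) zero_le_one
          _ ≤ η / 2 := by
              rw [one_mul]
              exact div_le_div_of_nonneg_left hη.le (by norm_num) (by linarith)
    · by_cases hx : ‖x‖ < n + 1
      · have : (fun x => f x - F x) =ᶠ[𝓝 x] fun _ => 0 := by
          filter_upwards [(isOpen_lt continuous_norm continuous_const).mem_nhds hx] with y hy
          simp [hF, cutoff_eq_one (le_of_lt hy)]
        rw [this.fderiv_eq]
        simpa using (half_pos hη).le
      · obtain ⟨b1, b2⟩ := hn x (not_lt.1 hx)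
        have h0 := cutoff_nonneg n x
        have h1 := cutoff_le_one n x
        have hcK : ‖fderiv ℝ (cutoff n) x‖ ≤ K := (hcut n).1.norm_fderiv_le x
        rw [(hd x).fderiv]
        have e : fderiv ℝ f x - (cutoff n x • fderiv ℝ f x + f x • fderiv ℝ (cutoff n) x)
            = (1 - cutoff n x) • fderiv ℝ f x - f x • fderiv ℝ (cutoff n) x := by
          rw [sub_smul, one_smul]; abel
        rw [e]
        refine (norm_sub_le _ _).trans ?_
        rw [norm_smul, norm_smul, Real.norm_eq_abs, Real.norm_eq_abs,
          abs_of_nonneg (by linarith : 0 ≤ 1 - cutoff n x)]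
        have m1 : (1 - cutoff n x) * ‖fderiv ℝ f x‖ ≤ 1 * (η / (4 * K)) :=
          mul_le_mul (by linarith) b2 (norm_nonneg _) zero_le_one
        have m2 : |f x| * ‖fderiv ℝ (cutoff n) x‖ ≤ η / (4 * K) * K :=
          mul_le_mul b1 hcK (norm_nonneg _) (by positivity)
        have m3 : η / (4 * K) ≤ η / 4 :=
          div_le_div_of_nonneg_left hη.le (by norm_num) (by linarith)
        have m4 : η / (4 * K) * K = η / 4 := by field_simp
        linarith
  -- mollification at a scale given by uniform continuity
  have u0 := hFc.uniformContinuous_of_continuous hFsm.continuous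
  have u1 := (hFc.fderiv (𝕜 := ℝ)).uniformContinuous_of_continuous
    (hFsm.continuous_fderiv (by norm_num))
  obtain ⟨δ₀, hδ₀, h₀⟩ := Metric.uniformContinuous_iff.1 u0 (η / 2) (by positivity)
  obtain ⟨δ₁, hδ₁, h₁⟩ := Metric.uniformContinuous_iff.1 u1 (η / 2) (by positivity)
  obtain ⟨k, hk, ρ, hρ⟩ := exists_isMollifier d (ε := min δ₀ δ₁ / 2) (by positivity)
  have hFBL : IsBL (c1Norm F) F := (isC1Infty_of_hasCompactSupport hFsm hFc).isBL
  have step2 : IsBL (η / 2) fun x => smoothing ρ F x - F x := by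
    refine hρ.smoothing_sub hFsm.continuous fun z hz => ?_
    have hz' : ‖z‖ < min δ₀ δ₁ := lt_of_le_of_lt hz (half_lt_self (by positivity))
    have hd : ∀ x, HasFDerivAt (fun x => F (x - z) - F x)
        (fderiv ℝ F (x - z) - fderiv ℝ F x) x := fun x =>
      ((hasFDerivAt_comp_sub z).2 (hFd (x - z)).hasFDerivAt).sub (hFd x).hasFDerivAt
    refine isBL_of_norm_fderiv_le (fun x => (hd x).differentiableAt) (fun x => ?_) fun x => ?_
    · have := h₀ (a := x - z) (b := x) (by
        simpa [dist_eq_norm] using hz'.trans_le (min_le_left _ _))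
      rw [Real.dist_eq] at this
      exact this.le
    · rw [(hd x).fderiv]
      have := h₁ (a := x - z) (b := x) (by
        simpa [dist_eq_norm] using hz'.trans_le (min_le_right _ _))
      rw [dist_eq_norm] at this
      exact this.le
  refine ⟨smoothing ρ F, isC1Infty_of_hasCompactSupport (hρ.smoothing_contDiff hFsm.continuous)
    (hρ.smoothing_hasCompactSupport hFc), ⟨c1Norm F, k * c1Norm F, mul_nonneg hk hFBL.nonneg,
      hρ.smoothing_isBL hFBL, hρ.smoothing_hasD2_of_isBL hFBL⟩, ?_⟩
  have := step1.sub step2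
  simpa using this

/-! ### Integrals against Lévy kernels -/

section Weight

variable {E : Type*} [NormedAddCommGroup E] {n : Measure (Space d)} {C B : ℝ}

lemma lintegral_enorm_le_of_weight (hn : ∫⁻ y, weight y ∂n ≤ ENNReal.ofReal C) (hB : 0 ≤ B)
    {F : Space d → E} (hF : ∀ᵐ y ∂n, ‖F y‖ ≤ B * min 1 ‖y‖) :
    ∫⁻ y, ‖F y‖ₑ ∂n ≤ ENNReal.ofReal (B * C) := by
  calc ∫⁻ y, ‖F y‖ₑ ∂n ≤ ∫⁻ y, ENNReal.ofReal B * weight y ∂n := by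
        refine lintegral_mono_ae (hF.mono fun y hy => ?_)
        rw [weight, ← ENNReal.ofReal_mul hB, ← ofReal_norm]
        exact ENNReal.ofReal_le_ofReal hy
    _ = ENNReal.ofReal B * ∫⁻ y, weight y ∂n := lintegral_const_mul' _ _ ENNReal.ofReal_ne_top
    _ ≤ ENNReal.ofReal (B * C) := by
        rw [ENNReal.ofReal_mul hB]
        gcongr

lemma integrable_of_weight (hn : ∫⁻ y, weight y ∂n ≤ ENNReal.ofReal C) (hB : 0 ≤ B)
    {F : Space d → E} (hFm : AEStronglyMeasurable F n) (hF : ∀ y, ‖F y‖ ≤ B * min 1 ‖y‖) :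
    Integrable F n :=
  ⟨hFm, (lintegral_enorm_le_of_weight hn hB (Eventually.of_forall hF)).trans_lt
    ENNReal.ofReal_lt_top⟩

lemma norm_integral_le_of_weight [NormedSpace ℝ E] (hn : ∫⁻ y, weight y ∂n ≤ ENNReal.ofReal C)
    (hB : 0 ≤ B) (hC : 0 ≤ C) {F : Space d → E} (hF : ∀ᵐ y ∂n, ‖F y‖ ≤ B * min 1 ‖y‖) :
    ‖∫ y, F y ∂n‖ ≤ B * C := by
  have := (enorm_integral_le_lintegral_enorm F).trans (lintegral_enorm_le_of_weight hn hB hF)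
  rw [← ofReal_norm] at this
  exact (ENNReal.ofReal_le_ofReal_iff (by positivity)).1 this

lemma measurable_weight : Measurable (weight : Space d → ℝ≥0∞) := by
  unfold weight
  fun_prop

lemma measure_lt_top_of_weight (hn : ∫⁻ y, weight y ∂n ≤ ENNReal.ofReal C) {r : ℝ} (hr : 0 < r) :
    n {y | r ≤ ‖y‖} < ∞ := by
  have h0 : ENNReal.ofReal (min 1 r) ≠ 0 := by
    rw [ne_eq, ENNReal.ofReal_eq_zero, not_le]; positivity
  have h1 := meas_ge_le_lintegral_div (μ := n) measurable_weight.aemeasurable h0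
    ENNReal.ofReal_ne_top
  refine ((measure_mono fun y (hy : r ≤ ‖y‖) => ?_).trans h1).trans_lt
    (ENNReal.div_lt_top (hn.trans_lt ENNReal.ofReal_lt_top).ne h0)
  exact ENNReal.ofReal_le_ofReal (min_le_min le_rfl hy)

end Weight

/-! ### The variation of the difference of two measures -/

/-- Both sides are the maximum of `μ₁` and `μ₂`, by the Hahn decomposition. -/
lemma add_sub_eq_add_sub {α : Type*} [MeasurableSpace α] (μ₁ μ₂ : Measure α) [IsFiniteMeasure μ₁]
    [IsFiniteMeasure μ₂] : μ₁ + (μ₂ - μ₁) = μ₂ + (μ₁ - μ₂) := by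
  obtain ⟨s, hs, h1, h2⟩ := hahn_decomposition μ₁ μ₂
  have r1 : μ₂.restrict s ≤ μ₁.restrict s := Measure.le_iff.2 fun t ht => by
    rw [Measure.restrict_apply ht, Measure.restrict_apply ht]
    exact h1 _ (ht.inter hs) inter_subset_right
  have r2 : μ₁.restrict sᶜ ≤ μ₂.restrict sᶜ := Measure.le_iff.2 fun t ht => by
    rw [Measure.restrict_apply ht, Measure.restrict_apply ht]
    exact h2 _ (ht.inter hs.compl) inter_subset_right
  rw [← Measure.restrict_add_restrict_compl (μ := μ₁ + (μ₂ - μ₁)) hs,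
    ← Measure.restrict_add_restrict_compl (μ := μ₂ + (μ₁ - μ₂)) hs]
  simp only [Measure.restrict_add, Measure.restrict_sub_eq_restrict_sub_restrict hs,
    Measure.restrict_sub_eq_restrict_sub_restrict hs.compl, Measure.sub_eq_zero_of_le r1,
    Measure.sub_eq_zero_of_le r2, add_zero]
  rw [add_comm (μ₂.restrict s), Measure.sub_add_cancel_of_le r1, add_comm (μ₁.restrict sᶜ),
    Measure.sub_add_cancel_of_le r2]

/-- The function `y ↦ (|y| (n + 1) - 1)⁺ ∧ 1`, times a cutoff at infinity. -/
noncomputable def awayCutoff (n : ℕ) (y : Space d) : ℝ :=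
  max 0 (min 1 ((n + 1) * ‖y‖ - 1)) * cutoff n y

lemma awayCutoff_continuous (n : ℕ) : Continuous (awayCutoff n : Space d → ℝ) := by
  have := (cutoff_contDiff (d := d) n).continuous
  unfold awayCutoff
  fun_prop

lemma abs_awayCutoff_le (n : ℕ) (y : Space d) : |awayCutoff n y| ≤ 1 := by
  have h0 := cutoff_nonneg n y
  have h2 : (0 : ℝ) ≤ max 0 (min 1 ((n + 1) * ‖y‖ - 1)) := le_max_left _ _
  rw [awayCutoff, abs_of_nonneg (mul_nonneg h2 h0)]
  exact mul_le_one₀ (max_le zero_le_one (min_le_left _ _)) h0 (cutoff_le_one n y)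

lemma awayCutoff_eq_zero {n : ℕ} {y : Space d} (hy : ¬ 1 / ((n : ℝ) + 1) ≤ ‖y‖) :
    awayCutoff n y = 0 := by
  have hn : (0 : ℝ) < n + 1 := by positivity
  rw [not_le, lt_div_iff₀ hn] at hy
  rw [awayCutoff, max_eq_left, zero_mul]
  exact (min_le_right _ _).trans (by linarith)

lemma IsTestAwayFromZero.mul_awayCutoff {g : Space d → ℝ} (hg : Continuous g) (n : ℕ) :
    IsTestAwayFromZero fun y => awayCutoff n y * g y := by
  refine ⟨(awayCutoff_continuous n).mul hg, ?_, ?_⟩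
  · exact HasCompactSupport.mul_right (cutoff_hasCompactSupport n).mul_left
  · have hsub : tsupport (fun y : Space d => awayCutoff n y * g y)
        ⊆ {y : Space d | 1 / ((n : ℝ) + 1) ≤ ‖y‖} := by
      refine closure_minimal (fun y hy => ?_) (isClosed_le continuous_const continuous_norm)
      by_contra h
      exact hy (by simp [awayCutoff_eq_zero h])
    intro h0
    have : 1 / ((n : ℝ) + 1) ≤ ‖(0 : Space d)‖ := hsub h0
    rw [norm_zero] at this
    have : (0 : ℝ) < 1 / ((n : ℝ) + 1) := by positivity
    linarith

/-- Functions dominated by `min(1, |y|)` can be approximated by functions supported away from the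
origin, so that no mass of the Lévy measure is needed there. -/
lemma tendsto_integral_awayCutoff {n : Measure (Space d)} {C B : ℝ}
    (hn : ∫⁻ y, weight y ∂n ≤ ENNReal.ofReal C) (hB : 0 ≤ B) {g : Space d → ℝ}
    (hg : Continuous g) (hgB : ∀ y, |g y| ≤ B * min 1 ‖y‖) :
    Tendsto (fun k : ℕ => ∫ y, awayCutoff k y * g y ∂n) atTop (𝓝 (∫ y, g y ∂n)) := by
  refine tendsto_integral_of_dominated_convergence (fun y => B * min 1 ‖y‖)
    (fun k => ((awayCutoff_continuous k).mul hg).aestronglyMeasurable) ?_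
    (fun k => Eventually.of_forall fun y => ?_) (Eventually.of_forall fun y => ?_)
  · refine integrable_of_weight hn hB (by fun_prop) fun y => ?_
    rw [Real.norm_of_nonneg (by positivity)]
  · rw [Real.norm_eq_abs, abs_mul]
    exact (mul_le_of_le_one_left (abs_nonneg _) (abs_awayCutoff_le k y)).trans (hgB y)
  · by_cases hy : y = 0
    · have : g y = 0 := by
        have := hgB y
        rw [hy, norm_zero, min_eq_right zero_le_one, mul_zero] at this
        rw [hy]
        exact abs_nonpos_iff.1 this
      simp [this]
    · have hy' : 0 < ‖y‖ := norm_pos_iff.2 hy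
      refine tendsto_const_nhds.congr' ?_
      filter_upwards [eventually_ge_atTop ⌈2 / ‖y‖⌉₊, eventually_ge_atTop ⌈‖y‖⌉₊] with k h1 h2
      have h1' : 2 / ‖y‖ ≤ k := Nat.ceil_le.1 h1
      have h2' : ‖y‖ ≤ k := Nat.ceil_le.1 h2
      rw [div_le_iff₀ hy'] at h1'
      rw [awayCutoff, cutoff_eq_one (by linarith), min_eq_left (by linarith),
        max_eq_right zero_le_one, one_mul, one_mul]

lemma abs_integral_sub_le_of_absDiff {n₁ n₂ : Measure (Space d)} {C B D : ℝ}
    (h₁ : ∫⁻ y, weight y ∂n₁ ≤ ENNReal.ofReal C) (h₂ : ∫⁻ y, weight y ∂n₂ ≤ ENNReal.ofReal C)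
    (hD : ∫⁻ y, weight y ∂(absDiff n₁ n₂) ≤ ENNReal.ofReal D) (hD0 : 0 ≤ D) (hB : 0 ≤ B)
    {g : Space d → ℝ} (hg : Continuous g) (hgB : ∀ y, |g y| ≤ B * min 1 ‖y‖) :
    |∫ y, g y ∂n₁ - ∫ y, g y ∂n₂| ≤ B * D := by
  refine le_of_tendsto ((tendsto_integral_awayCutoff h₁ hB hg hgB).sub
    (tendsto_integral_awayCutoff h₂ hB hg hgB)).abs (Eventually.of_forall fun k => ?_)
  -- away from the origin the two measures are finite
  set G : Space d → ℝ := fun y => awayCutoff k y * g y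
  have hGc : Continuous G := (awayCutoff_continuous k).mul hg
  have hGB : ∀ y, ‖G y‖ ≤ B * min 1 ‖y‖ := fun y => by
    rw [Real.norm_eq_abs, abs_mul]
    exact (mul_le_of_le_one_left (abs_nonneg _) (abs_awayCutoff_le k y)).trans (hgB y)
  set s : Set (Space d) := {y | 1 / ((k : ℝ) + 1) ≤ ‖y‖}
  have hs : MeasurableSet s := (isClosed_le continuous_const continuous_norm).measurableSet
  have hfin : ∀ n : Measure (Space d), ∫⁻ y, weight y ∂n ≤ ENNReal.ofReal C →
      IsFiniteMeasure (n.restrict s) := fun n hn =>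
    ⟨by rw [Measure.restrict_apply_univ]; exact measure_lt_top_of_weight hn (by positivity)⟩
  have f₁ := hfin n₁ h₁
  have f₂ := hfin n₂ h₂
  have hr : ∀ n : Measure (Space d), ∫ y, G y ∂n = ∫ y, G y ∂(n.restrict s) := fun n =>
    (setIntegral_eq_integral_of_forall_compl_eq_zero fun y hy => by
      simp only [G, awayCutoff_eq_zero hy, zero_mul]).symm
  set m₁ := n₁.restrict s
  set m₂ := n₂.restrict s
  have hi : ∀ m : Measure (Space d), IsFiniteMeasure m → Integrable G m := fun m hm =>
    integrable_of_abs_le m hGc (M := B) fun y => (hGB y).trans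
      (mul_le_of_le_one_right hB (min_le_left _ _))
  have f₁₂ : IsFiniteMeasure (m₁ - m₂) := isFiniteMeasure_of_le m₁ Measure.sub_le
  have f₂₁ : IsFiniteMeasure (m₂ - m₁) := isFiniteMeasure_of_le m₂ Measure.sub_le
  have e : ∫ y, G y ∂m₁ + ∫ y, G y ∂(m₂ - m₁) = ∫ y, G y ∂m₂ + ∫ y, G y ∂(m₁ - m₂) := by
    rw [← integral_add_measure (hi _ f₁) (hi _ f₂₁), add_sub_eq_add_sub,
      integral_add_measure (hi _ f₂) (hi _ f₁₂)]
  have e' : ∫ y, G y ∂n₁ - ∫ y, G y ∂n₂ = ∫ y, G y ∂(m₁ - m₂) - ∫ y, G y ∂(m₂ - m₁) := by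
    rw [hr n₁, hr n₂]
    linarith
  have hle : (m₁ - m₂) + (m₂ - m₁) ≤ absDiff n₁ n₂ := by
    rw [absDiff, ← Measure.restrict_sub_eq_restrict_sub_restrict hs,
      ← Measure.restrict_sub_eq_restrict_sub_restrict hs]
    exact add_le_add Measure.restrict_le_self Measure.restrict_le_self
  have hw : ∫⁻ y, weight y ∂((m₁ - m₂) + (m₂ - m₁)) ≤ ENNReal.ofReal D :=
    (lintegral_mono' hle le_rfl).trans hD
  rw [e']
  calc |∫ y, G y ∂(m₁ - m₂) - ∫ y, G y ∂(m₂ - m₁)|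
      ≤ ∫ y, |G y| ∂(m₁ - m₂) + ∫ y, |G y| ∂(m₂ - m₁) :=
        (abs_sub _ _).trans (add_le_add abs_integral_le_integral_abs
          abs_integral_le_integral_abs)
    _ = ∫ y, |G y| ∂((m₁ - m₂) + (m₂ - m₁)) :=
        (integral_add_measure (hi _ f₁₂).abs (hi _ f₂₁).abs).symm
    _ ≤ ‖∫ y, |G y| ∂((m₁ - m₂) + (m₂ - m₁))‖ := Real.le_norm_self _
    _ ≤ B * D := norm_integral_le_of_weight hw hB hD0 (Eventually.of_forall fun y => by
        rw [Real.norm_eq_abs, abs_abs]; exact hGB y)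

/-- The weak gradient bounds the increments of the kernel in the weighted variation norm. -/
lemma IsWeakGradient.abs_integral_sub_le {n : Space d → Measure (Space d)}
    {g : Space d → SignedVectorMeasure d} (hg : IsWeakGradient n g) {C B : ℝ} (hC : 0 ≤ C)
    (hn : ∀ x, ∫⁻ y, weight y ∂(n x) ≤ ENNReal.ofReal C)
    (hv : ∀ x, ∫⁻ y, weight y ∂(g x).var ≤ ENNReal.ofReal C) (hB : 0 ≤ B) {φ : Space d → ℝ}
    (hφ : Continuous φ) (hφB : ∀ y, |φ y| ≤ B * min 1 ‖y‖) (x x' : Space d) :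
    |∫ y, φ y ∂(n x) - ∫ y, φ y ∂(n x')| ≤ C * B * ‖x - x'‖ := by
  refine le_of_tendsto ((tendsto_integral_awayCutoff (hn x) hB hφ hφB).sub
    (tendsto_integral_awayCutoff (hn x') hB hφ hφB)).abs (Eventually.of_forall fun k => ?_)
  have ht := IsTestAwayFromZero.mul_awayCutoff hφ k
  have hd := fun z => (hg.hasGradientAt _ ht z).hasFDerivAt.hasFDerivWithinAt (s := univ)
  have := convex_univ.norm_image_sub_le_of_norm_hasFDerivWithin_le (C := B * C)
    (fun z _ => hd z) (fun z _ => ?_) (mem_univ x') (mem_univ x)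
  · rw [Real.norm_eq_abs, mul_comm B] at this
    exact this
  · rw [LinearIsometryEquiv.norm_map]
    refine norm_integral_le_of_weight (hv z) hB hC ((g z).norm_dir.mono fun y hy => ?_)
    rw [norm_smul, hy, mul_one, Real.norm_eq_abs, abs_mul]
    exact (mul_le_of_le_one_left (abs_nonneg _) (abs_awayCutoff_le k y)).trans (hφB y)

/-! ### Uniform bounds on a bounded class of measures -/

/-- Bounds on the coefficients, with one constant `C`, that hold uniformly for measures of the
class `S`. In contrast to the original assumptions no derivatives in `x` are involved. -/
structure UniformBounds (S : Set (FiniteMeasure (Space d)))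
    (b : Space d → FiniteMeasure (Space d) → Space d)
    (ν : Space d → FiniteMeasure (Space d) → Measure (Space d)) (C : ℝ) : Prop where
  one_le : 1 ≤ C
  mass_le : ∀ μ ∈ S, (μ.mass : ℝ) ≤ C
  drift : ∀ μ ∈ S, ∀ x, ‖b x μ‖ ≤ C
  drift_lip : ∀ μ ∈ S, ∀ x x', ‖b x μ - b x' μ‖ ≤ C * ‖x - x'‖
  drift_dual : ∀ μ ∈ S, ∀ η ∈ S, ∀ x, ‖b x μ - b x η‖ ≤ C * dualDist μ η
  kernel : ∀ μ ∈ S, ∀ x, ∫⁻ y, weight y ∂(ν x μ) ≤ ENNReal.ofReal C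
  kernel_lip : ∀ μ ∈ S, ∀ x x' : Space d, ∀ (B : ℝ) (g : Space d → ℝ), 0 ≤ B → Continuous g →
    (∀ y, |g y| ≤ B * min 1 ‖y‖) → |∫ y, g y ∂(ν x μ) - ∫ y, g y ∂(ν x' μ)| ≤ C * B * ‖x - x'‖
  kernel_dual : ∀ μ ∈ S, ∀ η ∈ S, ∀ x : Space d, ∀ (B : ℝ) (g : Space d → ℝ), 0 ≤ B →
    Continuous g → (∀ y, |g y| ≤ B * min 1 ‖y‖) →
      |∫ y, g y ∂(ν x μ) - ∫ y, g y ∂(ν x η)| ≤ C * B * dualDist μ η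
  small_jumps : ∀ ε : ℝ, 0 < ε → ∃ δ : ℝ, 0 < δ ∧ ∀ μ ∈ S, ∀ x,
    ∫⁻ y in Metric.ball 0 δ, ‖y‖ₑ ∂(ν x μ) ≤ ENNReal.ofReal ε

/-- The part of `S` consisting of the measures of mass at most `R`. -/
def massLE (S : Set (FiniteMeasure (Space d))) (R : ℝ≥0) : Set (FiniteMeasure (Space d)) :=
  {μ | μ ∈ S ∧ μ.mass ≤ R}

lemma Assumptions.exists_uniformBounds {S : Set (FiniteMeasure (Space d))}
    {b : Space d → FiniteMeasure (Space d) → Space d}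
    {ν : Space d → FiniteMeasure (Space d) → Measure (Space d)}
    {gν : Space d → FiniteMeasure (Space d) → SignedVectorMeasure d}
    (h : Assumptions S b ν gν) (R : ℝ≥0) : ∃ C : ℝ, UniformBounds (massLE S R) b ν C := by
  obtain ⟨C₁, h₁⟩ := h.bounded_drift R
  obtain ⟨C₂, h₂⟩ := h.bounded_kernel R
  obtain ⟨c, hc⟩ := h.lipschitz R
  have p₂ : (0 : ℝ) ≤ C₂ := C₂.2
  have pR : (0 : ℝ) ≤ R := R.2
  set C : ℝ := 1 + |C₁| + C₂ + |c| + R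
  have a₁ : |C₁| ≤ C := by simp only [C]; linarith [abs_nonneg c]
  have a₁' : C₁ ≤ C := (le_abs_self _).trans a₁
  have a₂ : (C₂ : ℝ) ≤ C := by simp only [C]; linarith [abs_nonneg c, abs_nonneg C₁]
  have a₃ : c ≤ C := by simp only [C]; linarith [abs_nonneg C₁, le_abs_self c]
  have a₄ : (R : ℝ) ≤ C := by simp only [C]; linarith [abs_nonneg c, abs_nonneg C₁]
  have a₅ : 1 ≤ C := by simp only [C]; linarith [abs_nonneg c, abs_nonneg C₁]
  have hk : ∀ μ ∈ massLE S R, ∀ x, ∫⁻ y, weight y ∂(ν x μ) ≤ ENNReal.ofReal C ∧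
      ∫⁻ y, weight y ∂(gν x μ).var ≤ ENNReal.ofReal C := fun μ hμ x => by
    have : (C₂ : ℝ≥0∞) ≤ ENNReal.ofReal C := by
      rw [← ENNReal.ofReal_coe_nnreal]
      exact ENNReal.ofReal_le_ofReal a₂
    exact ⟨(h₂ μ hμ.1 hμ.2 x).1.trans this, (h₂ μ hμ.1 hμ.2 x).2.trans this⟩
  refine ⟨C, a₅, fun μ hμ => (NNReal.coe_le_coe.2 hμ.2).trans a₄,
    fun μ hμ x => (h₁ μ hμ.1 hμ.2 x).1.trans a₁', fun μ hμ x x' => ?_, fun μ hμ η hη x => ?_,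
    fun μ hμ x => (hk μ hμ x).1, fun μ hμ x x' B g hB hg hgB => ?_,
    fun μ hμ η hη x B g hB hg hgB => ?_, fun ε hε => ?_⟩
  · exact convex_univ.norm_image_sub_le_of_norm_fderiv_le (𝕜 := ℝ) (f := fun z => b z μ)
      (fun z _ => (h.contDiff_drift μ hμ.1).differentiable (by norm_num) z)
      (fun z _ => (h₁ μ hμ.1 hμ.2 z).2.trans a₁') (mem_univ x') (mem_univ x)
  · exact (hc μ hμ.1 η hη.1 hμ.2 hη.2 x).2.trans
      (mul_le_mul_of_nonneg_right a₃ (dualDist_nonneg _ _))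
  · exact (h.weakGradient μ hμ.1).abs_integral_sub_le (by linarith) (fun x => (hk μ hμ x).1)
      (fun x => (hk μ hμ x).2) hB hg hgB x x'
  · have hD := (hc μ hμ.1 η hη.1 hμ.2 hη.2 x).1.trans (ENNReal.ofReal_le_ofReal
      (mul_le_mul_of_nonneg_right a₃ (dualDist_nonneg μ η)))
    refine (abs_integral_sub_le_of_absDiff (hk μ hμ x).1 (hk η hη x).1 hD
      (mul_nonneg (by linarith) (dualDist_nonneg _ _)) hB hg hgB).trans (le_of_eq (by ring))
  · obtain ⟨K, hK, hKε⟩ := h.tight R ε.toNNReal (Real.toNNReal_pos.2 hε)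
    exact ⟨1 / K, by positivity, fun μ hμ x => (hKε μ hμ.1 hμ.2 x).2.2⟩

/-! ### Markov steps with frozen coefficients -/

/-- The continuous truncation `min(1, |y| / δ)` of the small jumps. -/
noncomputable def jumpCut (δ : ℝ) (y : Space d) : ℝ := min 1 (‖y‖ / δ)

/-- One Euler step of length `h` with constant coefficients, drift `v` and Lévy measure `n`: with
probability one half the particle moves by `2 h v`, and it jumps according to `n` with the jumps
smaller than `2 C h` damped. The truncation level is such that all the probabilities are
nonnegative as long as `∫ min(1, |y|) n(dy) ≤ C`. -/
noncomputable def frozenStep (C h : ℝ) (v : Space d) (n : Measure (Space d)) (f : Space d → ℝ)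
    (x : Space d) : ℝ :=
  f x + (f (x + (2 * h) • v) - f x) / 2 + h * ∫ y, jumpCut (2 * C * h) y * (f (x + y) - f x) ∂n

lemma jumpCut_nonneg {δ : ℝ} (hδ : 0 < δ) (y : Space d) : 0 ≤ jumpCut δ y :=
  le_min zero_le_one (by positivity)

lemma jumpCut_le_one (δ : ℝ) (y : Space d) : jumpCut δ y ≤ 1 := min_le_left _ _

lemma jumpCut_le {δ : ℝ} (hδ : 0 < δ) (hδ1 : δ ≤ 1) (y : Space d) :
    jumpCut δ y ≤ 1 / δ * min 1 ‖y‖ := by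
  rw [jumpCut, mul_min_of_nonneg _ _ (by positivity), mul_one]
  exact min_le_min ((one_le_div hδ).2 hδ1) (le_of_eq (by ring))

lemma jumpCut_continuous (δ : ℝ) : Continuous (jumpCut δ : Space d → ℝ) := by
  unfold jumpCut
  fun_prop

lemma IsBL.abs_jump_le {A : ℝ} {f : Space d → ℝ} (hf : IsBL A f) (x y : Space d) :
    |f (x + y) - f x| ≤ 2 * A * min 1 ‖y‖ := by
  have hA := hf.nonneg
  rw [mul_min_of_nonneg _ _ (by positivity), mul_one]
  refine le_min ?_ ?_
  · refine (abs_sub _ _).trans ?_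
    linarith [hf.bound (x + y), hf.bound x]
  · refine (hf.lip _ _).trans ?_
    rw [add_sub_cancel_left]
    nlinarith [norm_nonneg y]

lemma IsBL.abs_jumpCut_mul_le {A δ : ℝ} (hδ : 0 < δ) {f : Space d → ℝ} (hf : IsBL A f)
    (x y : Space d) : |jumpCut δ y * (f (x + y) - f x)| ≤ 2 * A * min 1 ‖y‖ := by
  rw [abs_mul, abs_of_nonneg (jumpCut_nonneg hδ y)]
  exact (mul_le_of_le_one_left (abs_nonneg _) (jumpCut_le_one δ y)).trans (hf.abs_jump_le x y)

section Frozen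

variable {C h : ℝ} {v : Space d} {n : Measure (Space d)}

lemma integrable_jumpCut_mul (hC : 0 < C) (hh : 0 < h) (hCh : 2 * C * h ≤ 1)
    (hn : ∫⁻ y, weight y ∂n ≤ ENNReal.ofReal C) {M : ℝ} {g : Space d → ℝ} (hg : Continuous g)
    (hM : ∀ x, |g x| ≤ M) : Integrable (fun y => jumpCut (2 * C * h) y * g y) n := by
  have hδ : 0 < 2 * C * h := by positivity
  have hM0 : 0 ≤ M := (abs_nonneg _).trans (hM 0)
  refine integrable_of_weight (B := 1 / (2 * C * h) * M) hn (by positivity)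
    ((jumpCut_continuous _).mul hg).aestronglyMeasurable fun y => ?_
  rw [Real.norm_eq_abs, abs_mul, abs_of_nonneg (jumpCut_nonneg hδ y)]
  refine (mul_le_mul (jumpCut_le hδ hCh y) (hM y) (abs_nonneg _) (by positivity)).trans ?_
  exact le_of_eq (by ring)

/-- The step is a convex combination. -/
lemma exists_frozenStep_eq (hC : 0 < C) (hh : 0 < h) (hCh : 2 * C * h ≤ 1)
    (hn : ∫⁻ y, weight y ∂n ≤ ENNReal.ofReal C) {M : ℝ} {f : Space d → ℝ} (hf : Continuous f)
    (hM : ∀ x, |f x| ≤ M) (x : Space d) : ∃ I J : ℝ, 0 ≤ I ∧ h * I ≤ 1 / 2 ∧ |J| ≤ M * I ∧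
      ((∀ z, 0 ≤ f z) → 0 ≤ J) ∧
      frozenStep C h v n f x = (1 / 2 - h * I) * f x + f (x + (2 * h) • v) / 2 + h * J := by
  have hδ : 0 < 2 * C * h := by positivity
  have i1 : Integrable (fun y => jumpCut (2 * C * h) y) n := by
    simpa using integrable_jumpCut_mul hC hh hCh hn (g := fun _ => 1) (M := 1)
      continuous_const (by simp)
  have i2 : Integrable (fun y => jumpCut (2 * C * h) y * f (x + y)) n :=
    integrable_jumpCut_mul hC hh hCh hn (by fun_prop) fun y => hM (x + y)
  refine ⟨∫ y, jumpCut (2 * C * h) y ∂n, ∫ y, jumpCut (2 * C * h) y * f (x + y) ∂n,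
    integral_nonneg (jumpCut_nonneg hδ), ?_, ?_, fun hpos =>
      integral_nonneg fun y => mul_nonneg (jumpCut_nonneg hδ y) (hpos _), ?_⟩
  · have := norm_integral_le_of_weight (F := fun y => jumpCut (2 * C * h) y) hn
      (B := 1 / (2 * C * h)) (by positivity) hC.le (Eventually.of_forall fun y => by
        rw [Real.norm_of_nonneg (jumpCut_nonneg hδ y)]; exact jumpCut_le hδ hCh y)
    have := mul_le_mul_of_nonneg_left ((Real.le_norm_self _).trans this) hh.le
    refine this.trans (le_of_eq ?_)
    field_simp
  · have := norm_integral_le_of_norm_le (f := fun y => jumpCut (2 * C * h) y * f (x + y))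
      (i1.const_mul M) (Eventually.of_forall fun y => by
        rw [Real.norm_eq_abs, abs_mul, abs_of_nonneg (jumpCut_nonneg hδ y), mul_comm]
        exact mul_le_mul_of_nonneg_right (hM _) (jumpCut_nonneg hδ y))
    rwa [integral_const_mul, Real.norm_eq_abs] at this
  · simp_rw [frozenStep, mul_sub]
    rw [integral_sub i2 (i1.mul_const _), integral_mul_const]
    ring

lemma abs_frozenStep_le (hC : 0 < C) (hh : 0 < h) (hCh : 2 * C * h ≤ 1)
    (hn : ∫⁻ y, weight y ∂n ≤ ENNReal.ofReal C) {M : ℝ} {f : Space d → ℝ} (hf : Continuous f)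
    (hM : ∀ x, |f x| ≤ M) (x : Space d) : |frozenStep C h v n f x| ≤ M := by
  obtain ⟨I, J, hI, hI2, hJ, -, e⟩ := exists_frozenStep_eq (v := v) hC hh hCh hn hf hM x
  rw [e]
  have b1 := abs_le.1 (hM x)
  have b2 := abs_le.1 (hM (x + (2 * h) • v))
  have b3 := abs_le.1 hJ
  have c1 : 0 ≤ 1 / 2 - h * I := by linarith
  have d1 := mul_le_mul_of_nonneg_left b1.1 c1
  have d2 := mul_le_mul_of_nonneg_left b1.2 c1
  have d3 := mul_le_mul_of_nonneg_left b3.1 hh.le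
  have d4 := mul_le_mul_of_nonneg_left b3.2 hh.le
  rw [abs_le]
  constructor <;> nlinarith

lemma frozenStep_nonneg (hC : 0 < C) (hh : 0 < h) (hCh : 2 * C * h ≤ 1)
    (hn : ∫⁻ y, weight y ∂n ≤ ENNReal.ofReal C) {M : ℝ} {f : Space d → ℝ} (hf : Continuous f)
    (hM : ∀ x, |f x| ≤ M) (hpos : ∀ z, 0 ≤ f z) (x : Space d) : 0 ≤ frozenStep C h v n f x := by
  obtain ⟨I, J, hI, hI2, -, hJ, e⟩ := exists_frozenStep_eq (v := v) hC hh hCh hn hf hM x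
  rw [e]
  have := mul_nonneg (by linarith : 0 ≤ 1 / 2 - h * I) (hpos x)
  have := mul_nonneg hh.le (hJ hpos)
  have := hpos (x + (2 * h) • v)
  positivity

lemma frozenStep_add (hC : 0 < C) (hh : 0 < h) (hCh : 2 * C * h ≤ 1)
    (hn : ∫⁻ y, weight y ∂n ≤ ENNReal.ofReal C) {M N : ℝ} {f g : Space d → ℝ} (hf : Continuous f)
    (hM : ∀ x, |f x| ≤ M) (hg : Continuous g) (hN : ∀ x, |g x| ≤ N) (x : Space d) :
    frozenStep C h v n (fun z => f z + g z) x
      = frozenStep C h v n f x + frozenStep C h v n g x := by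
  have i : ∀ (M : ℝ) (f : Space d → ℝ), Continuous f → (∀ x, |f x| ≤ M) →
      Integrable (fun y => jumpCut (2 * C * h) y * (f (x + y) - f x)) n := fun M f hf hM =>
    integrable_jumpCut_mul hC hh hCh hn (M := M + M) (by fun_prop) fun y =>
      (abs_sub _ _).trans (add_le_add (hM _) (hM _))
  have e : (fun y => jumpCut (2 * C * h) y * (f (x + y) + g (x + y) - (f x + g x)))
      = fun y => jumpCut (2 * C * h) y * (f (x + y) - f x)
        + jumpCut (2 * C * h) y * (g (x + y) - g x) := by
    funext y; ring
  simp only [frozenStep]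
  rw [e, integral_add (i M f hf hM) (i N g hg hN)]
  ring

lemma frozenStep_const_mul (c : ℝ) (f : Space d → ℝ) (x : Space d) :
    frozenStep C h v n (fun z => c * f z) x = c * frozenStep C h v n f x := by
  have e : (fun y => jumpCut (2 * C * h) y * (c * f (x + y) - c * f x))
      = fun y => c * (jumpCut (2 * C * h) y * (f (x + y) - f x)) := by
    funext y; ring
  simp only [frozenStep]
  rw [e, integral_const_mul]
  ring

lemma frozenStep_sub (hC : 0 < C) (hh : 0 < h) (hCh : 2 * C * h ≤ 1)
    (hn : ∫⁻ y, weight y ∂n ≤ ENNReal.ofReal C) {M N : ℝ} {f g : Space d → ℝ} (hf : Continuous f)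
    (hM : ∀ x, |f x| ≤ M) (hg : Continuous g) (hN : ∀ x, |g x| ≤ N) (x : Space d) :
    frozenStep C h v n (fun z => f z - g z) x
      = frozenStep C h v n f x - frozenStep C h v n g x := by
  have := frozenStep_add (v := v) hC hh hCh hn hf hM (g := fun z => (-1) * g z) (N := N)
    (by fun_prop) (fun x => by simpa using hN x) x
  rw [frozenStep_const_mul] at this
  simpa [sub_eq_add_neg] using this

lemma frozenStep_translate (f : Space d → ℝ) (x w : Space d) :
    frozenStep C h v n (fun z => f (z + w)) x = frozenStep C h v n f (x + w) := by
  simp only [frozenStep, add_right_comm x _ w]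

lemma abs_frozenStep_sub_self_le (hC : 0 < C) (hh : 0 < h)
    (hn : ∫⁻ y, weight y ∂n ≤ ENNReal.ofReal C) (hv : ‖v‖ ≤ C) {A : ℝ} {f : Space d → ℝ}
    (hf : IsBL A f) (x : Space d) : |frozenStep C h v n f x - f x| ≤ h * (3 * C * A) := by
  have hA := hf.nonneg
  have hδ : 0 < 2 * C * h := by positivity
  have h1 : |f (x + (2 * h) • v) - f x| ≤ A * (2 * h * C) := by
    refine (hf.lip _ _).trans ?_
    rw [add_sub_cancel_left, norm_smul, Real.norm_of_nonneg (by positivity)]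
    gcongr
  have h2 := norm_integral_le_of_weight (F := fun y => jumpCut (2 * C * h) y * (f (x + y) - f x))
    hn (B := 2 * A) (by positivity) hC.le (Eventually.of_forall fun y =>
      hf.abs_jumpCut_mul_le hδ x y)
  have e : frozenStep C h v n f x - f x = (f (x + (2 * h) • v) - f x) / 2
      + h * ∫ y, jumpCut (2 * C * h) y * (f (x + y) - f x) ∂n := by
    rw [frozenStep]; ring
  rw [e]
  refine (abs_add_le _ _).trans ?_
  rw [abs_div, abs_mul, abs_of_pos hh, abs_two]
  rw [Real.norm_eq_abs] at h2
  have := mul_le_mul_of_nonneg_left h2 hh.le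
  linarith

lemma abs_frozenStep_sub_le {v' : Space d} {n' : Measure (Space d)} (hh : 0 < h)
    {A D : ℝ} {f : Space d → ℝ} (hf : IsBL A f) (x : Space d) (hv : ‖v - v'‖ ≤ C * D)
    (hn : |∫ y, jumpCut (2 * C * h) y * (f (x + y) - f x) ∂n
      - ∫ y, jumpCut (2 * C * h) y * (f (x + y) - f x) ∂n'| ≤ C * (2 * A) * D) :
    |frozenStep C h v n f x - frozenStep C h v' n' f x| ≤ h * (3 * C * A * D) := by
  have hA := hf.nonneg
  have h1 : |f (x + (2 * h) • v) - f (x + (2 * h) • v')| ≤ A * (2 * h * (C * D)) := by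
    refine (hf.lip _ _).trans ?_
    rw [add_sub_add_left_eq_sub, ← smul_sub, norm_smul, Real.norm_of_nonneg (by positivity)]
    gcongr
  have e : frozenStep C h v n f x - frozenStep C h v' n' f x
      = (f (x + (2 * h) • v) - f (x + (2 * h) • v')) / 2
      + h * (∫ y, jumpCut (2 * C * h) y * (f (x + y) - f x) ∂n
      - ∫ y, jumpCut (2 * C * h) y * (f (x + y) - f x) ∂n') := by
    rw [frozenStep, frozenStep]; ring
  rw [e]
  refine (abs_add_le _ _).trans ?_
  rw [abs_div, abs_mul, abs_of_pos hh, abs_two]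
  have := mul_le_mul_of_nonneg_left hn hh.le
  linarith

end Frozen

/-- The right-hand side `(A_μ f, μ)` of the weak equation. -/
noncomputable def rate (b : Space d → FiniteMeasure (Space d) → Space d)
    (ν : Space d → FiniteMeasure (Space d) → Measure (Space d))
    (μ : FiniteMeasure (Space d)) (f : Space d → ℝ) : ℝ :=
  ∫ x, generator b ν μ f x ∂(μ : Measure (Space d))

section Bounds

variable {S : Set (FiniteMeasure (Space d))} {b : Space d → FiniteMeasure (Space d) → Space d}
  {ν : Space d → FiniteMeasure (Space d) → Measure (Space d)} {C : ℝ}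
  (H : UniformBounds S b ν C)
include H

lemma UniformBounds.pos : 0 < C := zero_lt_one.trans_le H.one_le

lemma UniformBounds.abs_frozenStep_sub_le_norm {h : ℝ} (hh : 0 < h) {μ : FiniteMeasure (Space d)}
    (hμ : μ ∈ S) {A : ℝ} {f : Space d → ℝ} (hf : IsBL A f) (u u' x : Space d) :
    |frozenStep C h (b u μ) (ν u μ) f x - frozenStep C h (b u' μ) (ν u' μ) f x|
      ≤ h * (3 * C * A * ‖u - u'‖) := by
  have hfc := hf.continuous
  have hC := H.pos
  have hA := hf.nonneg
  exact abs_frozenStep_sub_le hh hf x (H.drift_lip μ hμ u u')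
    (H.kernel_lip μ hμ u u' (2 * A) _ (by positivity)
      ((jumpCut_continuous _).mul (by fun_prop)) fun y => hf.abs_jumpCut_mul_le (by positivity) x y)

lemma UniformBounds.abs_frozenStep_sub_le_dualDist {h : ℝ} (hh : 0 < h)
    {μ η : FiniteMeasure (Space d)} (hμ : μ ∈ S) (hη : η ∈ S) {A : ℝ} {f : Space d → ℝ}
    (hf : IsBL A f) (u x : Space d) :
    |frozenStep C h (b u μ) (ν u μ) f x - frozenStep C h (b u η) (ν u η) f x|
      ≤ h * (3 * C * A * dualDist μ η) := by
  have hfc := hf.continuous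
  have hC := H.pos
  have hA := hf.nonneg
  exact abs_frozenStep_sub_le hh hf x (H.drift_dual μ hμ η hη u)
    (H.kernel_dual μ hμ η hη u (2 * A) _ (by positivity)
      ((jumpCut_continuous _).mul (by fun_prop)) fun y => hf.abs_jumpCut_mul_le (by positivity) x y)

/-! ### Estimates for the generator -/

lemma UniformBounds.abs_generator_le {μ : FiniteMeasure (Space d)} (hμ : μ ∈ S) {A : ℝ}
    {f : Space d → ℝ} (hf : IsBL A f) (x : Space d) : |generator b ν μ f x| ≤ 3 * C * A := by
  have hA := hf.nonneg
  have hC := H.pos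
  have h1 : |fderiv ℝ f x (b x μ)| ≤ A * C :=
    ((fderiv ℝ f x).le_opNorm _).trans
      (mul_le_mul (hf.norm_fderiv_le x) (H.drift μ hμ x) (norm_nonneg _) hA)
  have h2 := norm_integral_le_of_weight (F := fun y => f (x + y) - f x) (H.kernel μ hμ x)
    (B := 2 * A) (by positivity) hC.le (Eventually.of_forall fun y => hf.abs_jump_le x y)
  rw [Real.norm_eq_abs] at h2
  refine (abs_add_le _ _).trans ?_
  linarith

lemma UniformBounds.integrable_jump {μ : FiniteMeasure (Space d)} (hμ : μ ∈ S) {A : ℝ}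
    {f : Space d → ℝ} (hf : IsBL A f) (x x' : Space d) :
    Integrable (fun y => f (x + y) - f x) (ν x' μ) := by
  have hfc := hf.continuous
  have hA := hf.nonneg
  exact integrable_of_weight (H.kernel μ hμ x') (B := 2 * A) (by positivity)
    (by fun_prop) fun y => hf.abs_jump_le x y

lemma UniformBounds.generator_isBL {μ : FiniteMeasure (Space d)} (hμ : μ ∈ S) {A Λ : ℝ}
    {f : Space d → ℝ} (hf : IsBL A f) (hd : Differentiable ℝ f) (hΛ : 0 ≤ Λ) (hf' : HasD2 Λ f) :
    IsBL (5 * C * (A + Λ)) (generator b ν μ f) := by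
  have hA := hf.nonneg
  have hC := H.pos
  have hfc := hf.continuous
  refine ⟨fun x => (H.abs_generator_le hμ hf x).trans (by nlinarith), fun x x' => ?_⟩
  have h1 : |fderiv ℝ f x (b x μ) - fderiv ℝ f x' (b x' μ)|
      ≤ Λ * ‖x - x'‖ * C + A * (C * ‖x - x'‖) := by
    have e : fderiv ℝ f x (b x μ) - fderiv ℝ f x' (b x' μ)
        = (fderiv ℝ f x - fderiv ℝ f x') (b x μ) + fderiv ℝ f x' (b x μ - b x' μ) := by
      simp
    rw [e]
    refine (abs_add_le _ _).trans (add_le_add ?_ ?_)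
    · exact (ContinuousLinearMap.le_opNorm _ _).trans (mul_le_mul
        (hf'.norm_fderiv_sub_le hΛ hd x x') (H.drift μ hμ x) (norm_nonneg _) (by positivity))
    · exact (ContinuousLinearMap.le_opNorm _ _).trans (mul_le_mul
        (hf.norm_fderiv_le x') (H.drift_lip μ hμ x x') (norm_nonneg _) hA)
  have hφ := hf.diff hf' hΛ (x - x')
  have h2 : |∫ y, (f (x + y) - f x) ∂(ν x μ) - ∫ y, (f (x' + y) - f x') ∂(ν x μ)|
      ≤ 2 * ((A + Λ) * ‖x - x'‖) * C := by
    rw [← integral_sub (H.integrable_jump hμ hf x x) (H.integrable_jump hμ hf x' x)]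
    refine norm_integral_le_of_weight (F := fun y => f (x + y) - f x - (f (x' + y) - f x'))
      (H.kernel μ hμ x) (mul_nonneg zero_le_two hφ.nonneg) hC.le
      (Eventually.of_forall fun y => ?_)
    have := hφ.abs_jump_le x' y
    rw [show x' + y + (x - x') = x + y by abel, show x' + (x - x') = x by abel] at this
    rw [Real.norm_eq_abs]
    refine le_trans (le_of_eq ?_) this
    congr 1; ring
  have h3 := H.kernel_lip μ hμ x x' (2 * A) (fun y => f (x' + y) - f x') (by positivity)
    (by fun_prop) (hf.abs_jump_le x')
  have e : generator b ν μ f x - generator b ν μ f x'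
      = (fderiv ℝ f x (b x μ) - fderiv ℝ f x' (b x' μ))
      + (∫ y, (f (x + y) - f x) ∂(ν x μ) - ∫ y, (f (x' + y) - f x') ∂(ν x μ))
      + (∫ y, (f (x' + y) - f x') ∂(ν x μ) - ∫ y, (f (x' + y) - f x') ∂(ν x' μ)) := by
    rw [generator, generator]; ring
  rw [e]
  refine (abs_add_le _ _).trans ((add_le_add_left (abs_add_le _ _) _).trans ?_)
  have : 0 ≤ Λ * C * ‖x - x'‖ := by positivity
  nlinarith

lemma UniformBounds.abs_generator_sub_le {μ η : FiniteMeasure (Space d)} (hμ : μ ∈ S) (hη : η ∈ S)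
    {A : ℝ} {f : Space d → ℝ} (hf : IsBL A f) (x : Space d) :
    |generator b ν μ f x - generator b ν η f x| ≤ 3 * C * A * dualDist μ η := by
  have hA := hf.nonneg
  have hfc := hf.continuous
  have h1 : |fderiv ℝ f x (b x μ - b x η)| ≤ A * (C * dualDist μ η) :=
    (ContinuousLinearMap.le_opNorm _ _).trans (mul_le_mul
      (hf.norm_fderiv_le x) (H.drift_dual μ hμ η hη x) (norm_nonneg _) hA)
  have h2 := H.kernel_dual μ hμ η hη x (2 * A) (fun y => f (x + y) - f x) (by positivity)
    (by fun_prop) (hf.abs_jump_le x)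
  have e : generator b ν μ f x - generator b ν η f x = fderiv ℝ f x (b x μ - b x η)
      + (∫ y, (f (x + y) - f x) ∂(ν x μ) - ∫ y, (f (x + y) - f x) ∂(ν x η)) := by
    rw [generator, generator, map_sub]; ring
  rw [e]
  refine (abs_add_le _ _).trans ?_
  linarith

lemma UniformBounds.abs_rate_le {μ : FiniteMeasure (Space d)} (hμ : μ ∈ S) {A : ℝ}
    {f : Space d → ℝ} (hf : IsBL A f) : |rate b ν μ f| ≤ 3 * C ^ 2 * A := by
  have hA := hf.nonneg
  have hC := H.pos
  refine (abs_integral_le_mul_mass (H.abs_generator_le hμ hf) μ).trans ?_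
  have := mul_le_mul_of_nonneg_left (H.mass_le μ hμ) (by positivity : 0 ≤ 3 * C * A)
  linarith

/-- The right-hand side of the weak equation is Lipschitz continuous in the measure. -/
lemma UniformBounds.exists_rate_lip : ∃ L : ℝ, 0 ≤ L ∧ ∀ μ ∈ S, ∀ η ∈ S, ∀ (A Λ : ℝ)
    (f : Space d → ℝ), IsBL A f → Differentiable ℝ f → 0 ≤ Λ → HasD2 Λ f →
      |rate b ν μ f - rate b ν η f| ≤ L * (A + Λ) * dualDist μ η := by
  obtain ⟨K, hK, hdual⟩ := exists_dualDist_bound d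
  have hC := H.pos
  refine ⟨3 * C ^ 2 + K * (5 * C), by positivity, fun μ hμ η hη A Λ f hf hd hΛ hf' => ?_⟩
  have hA := hf.nonneg
  have hD := dualDist_nonneg μ η
  have gμ := H.generator_isBL hμ hf hd hΛ hf'
  have gη := H.generator_isBL hη hf hd hΛ hf'
  have h1 := hdual _ _ gη μ η
  have h2 : |∫ x, (generator b ν μ f x - generator b ν η f x) ∂(μ : Measure (Space d))|
      ≤ 3 * C * A * dualDist μ η * C :=
    (abs_integral_le_mul_mass (H.abs_generator_sub_le hμ hη hf) μ).trans
      (mul_le_mul_of_nonneg_left (H.mass_le μ hμ) (by positivity))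
  rw [integral_sub (gμ.integrable _) (gη.integrable _)] at h2
  have e : rate b ν μ f - rate b ν η f
      = (∫ x, generator b ν μ f x ∂(μ : Measure (Space d))
          - ∫ x, generator b ν η f x ∂(μ : Measure (Space d)))
      + (∫ x, generator b ν η f x ∂(μ : Measure (Space d))
          - ∫ x, generator b ν η f x ∂(η : Measure (Space d))) := by
    rw [rate, rate]; ring
  rw [e]
  refine (abs_add_le _ _).trans ?_
  have : 0 ≤ C ^ 2 * Λ * dualDist μ η := by positivity
  nlinarith

/-- Consistency: for smooth functions the step is `1 + h A_μ` up to an error of order `o(h)`. -/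
lemma UniformBounds.exists_consistency {ε : ℝ} (hε : 0 < ε) : ∃ h₀ : ℝ, 0 < h₀ ∧ ∀ h : ℝ, 0 < h →
    h ≤ h₀ → ∀ μ ∈ S, ∀ (A Λ : ℝ) (f : Space d → ℝ), IsBL A f → Differentiable ℝ f → 0 ≤ Λ →
      HasD2 Λ f → ∀ x, |frozenStep C h (b x μ) (ν x μ) f x - f x - h * generator b ν μ f x|
        ≤ h * (ε * (A + Λ)) := by
  have hC := H.pos
  obtain ⟨δ, hδ, hs⟩ := H.small_jumps ε hε
  refine ⟨min (δ / (2 * C)) (ε / (2 * C ^ 2)), by positivity,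
    fun h hh hh0 μ hμ A Λ f hf hd hΛ hf' x => ?_⟩
  have hA := hf.nonneg
  have hfc := hf.continuous
  have hδh : 2 * C * h ≤ δ := by
    have := hh0.trans (min_le_left _ _)
    rw [le_div_iff₀ (by positivity)] at this
    linarith
  have hεh : 2 * C ^ 2 * h ≤ ε := by
    have := hh0.trans (min_le_right _ _)
    rw [le_div_iff₀ (by positivity)] at this
    linarith
  have hδ' : 0 < 2 * C * h := by positivity
  -- Taylor expansion for the drift
  have h1 : |(f (x + (2 * h) • b x μ) - f x) / 2 - h * fderiv ℝ f x (b x μ)|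
      ≤ h * (ε * Λ) := by
    have ht := hf'.taylor hΛ hd x ((2 * h) • b x μ)
    have e : (f (x + (2 * h) • b x μ) - f x) / 2 - h * fderiv ℝ f x (b x μ)
        = (f (x + (2 * h) • b x μ) - f x - fderiv ℝ f x ((2 * h) • b x μ)) / 2 := by
      rw [map_smul, smul_eq_mul]; ring
    rw [e, abs_div, abs_two]
    rw [norm_smul, Real.norm_of_nonneg (by positivity)] at ht
    have hb := H.drift μ hμ x
    have hbb : ‖b x μ‖ * ‖b x μ‖ ≤ C * C := mul_le_mul hb hb (norm_nonneg _) hC.le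
    calc |f (x + (2 * h) • b x μ) - f x - fderiv ℝ f x ((2 * h) • b x μ)| / 2
        ≤ Λ * (2 * h * ‖b x μ‖) * (2 * h * ‖b x μ‖) / 2 := by gcongr
      _ = 2 * Λ * h * h * (‖b x μ‖ * ‖b x μ‖) := by ring
      _ ≤ 2 * Λ * h * h * (C * C) := by gcongr
      _ = h * Λ * (2 * C ^ 2 * h) := by ring
      _ ≤ h * Λ * ε := by gcongr
      _ = h * (ε * Λ) := by ring
  -- the truncated small jumps
  have h2 : |∫ y, jumpCut (2 * C * h) y * (f (x + y) - f x) ∂(ν x μ)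
      - ∫ y, (f (x + y) - f x) ∂(ν x μ)| ≤ ε * A := by
    have i1 : Integrable (fun y => jumpCut (2 * C * h) y * (f (x + y) - f x)) (ν x μ) :=
      integrable_of_weight (H.kernel μ hμ x) (B := 2 * A) (by positivity)
        ((jumpCut_continuous _).mul (by fun_prop)).aestronglyMeasurable
        fun y => hf.abs_jumpCut_mul_le hδ' x y
    rw [← integral_sub i1 (H.integrable_jump hμ hf x x)]
    have hle : ∀ y, ‖jumpCut (2 * C * h) y * (f (x + y) - f x) - (f (x + y) - f x)‖ₑ
        ≤ (Metric.ball (0 : Space d) δ).indicator (fun y => ENNReal.ofReal A * ‖y‖ₑ) y := by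
      intro y
      have e : jumpCut (2 * C * h) y * (f (x + y) - f x) - (f (x + y) - f x)
          = (jumpCut (2 * C * h) y - 1) * (f (x + y) - f x) := by ring
      by_cases hy : y ∈ Metric.ball (0 : Space d) δ
      · rw [indicator_of_mem hy, ← ofReal_norm, ← ofReal_norm, ← ENNReal.ofReal_mul hA, e]
        refine ENNReal.ofReal_le_ofReal ?_
        rw [norm_mul, Real.norm_eq_abs, Real.norm_eq_abs]
        have j0 := jumpCut_nonneg hδ' y
        have j1 := jumpCut_le_one (2 * C * h) y
        have hl := hf.lip (x + y) x
        rw [add_sub_cancel_left] at hl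
        refine (mul_le_of_le_one_left (abs_nonneg _) ?_).trans hl
        rw [abs_le]; constructor <;> linarith
      · rw [mem_ball_zero_iff, not_lt] at hy
        have : jumpCut (2 * C * h) y = 1 :=
          min_eq_left ((one_le_div hδ').2 (hδh.trans hy))
        rw [e, this]
        simp
    have := (enorm_integral_le_lintegral_enorm _).trans (lintegral_mono (μ := ν x μ) hle)
    rw [lintegral_indicator Metric.isOpen_ball.measurableSet,
      lintegral_const_mul' _ _ ENNReal.ofReal_ne_top] at this
    have := this.trans (mul_le_mul_right (hs μ hμ x) _)
    rw [← ENNReal.ofReal_mul hA, ← ofReal_norm,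
      ENNReal.ofReal_le_ofReal_iff (by positivity), Real.norm_eq_abs] at this
    linarith
  have e : frozenStep C h (b x μ) (ν x μ) f x - f x - h * generator b ν μ f x
      = ((f (x + (2 * h) • b x μ) - f x) / 2 - h * fderiv ℝ f x (b x μ))
      + h * (∫ y, jumpCut (2 * C * h) y * (f (x + y) - f x) ∂(ν x μ)
        - ∫ y, (f (x + y) - f x) ∂(ν x μ)) := by
    rw [frozenStep, generator]; ring
  rw [e]
  refine (abs_add_le _ _).trans ?_
  rw [abs_mul, abs_of_pos hh]
  have := mul_le_mul_of_nonneg_left h2 hh.le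
  linarith

end Bounds

/-! ### The Euler step and its mollification -/

/-- One Euler step of length `h` for the coefficients frozen at the measure `μ`. -/
noncomputable def eulerStep (C h : ℝ) (b : Space d → FiniteMeasure (Space d) → Space d)
    (ν : Space d → FiniteMeasure (Space d) → Measure (Space d)) (μ : FiniteMeasure (Space d))
    (f : Space d → ℝ) (x : Space d) : ℝ :=
  frozenStep C h (b x μ) (ν x μ) f x

/-- The Euler step with coefficients averaged over a neighbourhood of the starting point. Only the
dependence of the coefficients on the position is mollified, not the function `f`: this is what
makes second differences propagate without deteriorating the Lipschitz constant. -/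
noncomputable def mollStep (C h : ℝ) (ρ : Space d → ℝ)
    (b : Space d → FiniteMeasure (Space d) → Space d)
    (ν : Space d → FiniteMeasure (Space d) → Measure (Space d)) (μ : FiniteMeasure (Space d))
    (f : Space d → ℝ) (x : Space d) : ℝ :=
  ∫ u, ρ (x - u) * frozenStep C h (b u μ) (ν u μ) f x

lemma frozenStep_diff {C h : ℝ} {v : Space d} {n : Measure (Space d)} (hC : 0 < C) (hh : 0 < h)
    (hCh : 2 * C * h ≤ 1) (hn : ∫⁻ y, weight y ∂n ≤ ENNReal.ofReal C) {M : ℝ} {f : Space d → ℝ}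
    (hf : Continuous f) (hM : ∀ x, |f x| ≤ M) (x w : Space d) :
    frozenStep C h v n (fun z => f (z + w) - f z) x
      = frozenStep C h v n f (x + w) - frozenStep C h v n f x := by
  rw [frozenStep_sub hC hh hCh hn (by fun_prop) (fun z => hM (z + w)) hf hM, frozenStep_translate]

section Step

variable {S : Set (FiniteMeasure (Space d))} {b : Space d → FiniteMeasure (Space d) → Space d}
  {ν : Space d → FiniteMeasure (Space d) → Measure (Space d)} {C : ℝ}
  (H : UniformBounds S b ν C) {h : ℝ} (hh : 0 < h) (hCh : 2 * C * h ≤ 1)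
  {μ : FiniteMeasure (Space d)} (hμ : μ ∈ S)
include H hh hμ

lemma UniformBounds.continuous_frozenStep {A : ℝ} {f : Space d → ℝ} (hf : IsBL A f)
    (x : Space d) : Continuous fun u => frozenStep C h (b u μ) (ν u μ) f x := by
  have hA := hf.nonneg
  have hC := H.pos
  refine (LipschitzWith.of_dist_le' (K := h * (3 * C * A)) fun u u' => ?_).continuous
  rw [Real.dist_eq, dist_eq_norm]
  exact (H.abs_frozenStep_sub_le_norm hh hμ hf u u' x).trans (le_of_eq (by ring))

include hCh

lemma UniformBounds.abs_frozenStep_sub_frozenStep_le {A : ℝ} {f : Space d → ℝ} (hf : IsBL A f)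
    (u u' x x' : Space d) (huu : ‖u - u'‖ ≤ ‖x - x'‖) :
    |frozenStep C h (b u μ) (ν u μ) f x - frozenStep C h (b u' μ) (ν u' μ) f x'|
      ≤ A * (1 + 3 * C * h) * ‖x - x'‖ := by
  have hA := hf.nonneg
  have hC := H.pos
  have hfc := hf.continuous
  have e := frozenStep_diff (v := b u μ) hC hh hCh (H.kernel μ hμ u) hfc hf.bound x' (x - x')
  rw [show x' + (x - x') = x by abel] at e
  have h1 : |frozenStep C h (b u μ) (ν u μ) f x - frozenStep C h (b u μ) (ν u μ) f x'|
      ≤ A * ‖x - x'‖ := by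
    rw [← e]
    exact abs_frozenStep_le hC hh hCh (H.kernel μ hμ u) (by fun_prop)
      (fun z => by simpa using hf.lip (z + (x - x')) z) x'
  have h2 := H.abs_frozenStep_sub_le_norm hh hμ hf u u' x'
  have h3 : h * (3 * C * A * ‖u - u'‖) ≤ h * (3 * C * A * ‖x - x'‖) := by gcongr
  have := abs_sub_le (frozenStep C h (b u μ) (ν u μ) f x) (frozenStep C h (b u μ) (ν u μ) f x')
    (frozenStep C h (b u' μ) (ν u' μ) f x')
  linarith

lemma UniformBounds.eulerStep_isBL {A : ℝ} {f : Space d → ℝ} (hf : IsBL A f) :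
    IsBL (A * (1 + 3 * C * h)) (eulerStep C h b ν μ f) := by
  have hA := hf.nonneg
  have hC := H.pos
  refine ⟨fun x => ?_, fun x x' => H.abs_frozenStep_sub_frozenStep_le hh hCh hμ hf x x' x x' le_rfl⟩
  refine (abs_frozenStep_le hC hh hCh (H.kernel μ hμ x) hf.continuous hf.bound x).trans ?_
  have : 0 ≤ A * (3 * C * h) := by positivity
  linarith

variable {ε K : ℝ} {ρ : Space d → ℝ} (hρ : IsMollifier ε K ρ)
include hρ

lemma UniformBounds.mollStep_isBL {A : ℝ} {f : Space d → ℝ} (hf : IsBL A f) :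
    IsBL (A * (1 + 3 * C * h)) (mollStep C h ρ b ν μ f) := by
  have hA := hf.nonneg
  have hC := H.pos
  have hc : ∀ x, Continuous fun z => frozenStep C h (b (x - z) μ) (ν (x - z) μ) f x := fun x =>
    (H.continuous_frozenStep hh hμ hf x).comp (by fun_prop : Continuous fun z => x - z)
  refine ⟨fun x => ?_, fun x x' => ?_⟩
  · rw [mollStep, integral_sub_mul_eq ρ (fun u => frozenStep C h (b u μ) (ν u μ) f x)]
    refine hρ.abs_integral_le fun z _ => ?_
    refine (abs_frozenStep_le hC hh hCh (H.kernel μ hμ _) hf.continuous hf.bound x).trans ?_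
    have : 0 ≤ A * (3 * C * h) := by positivity
    linarith
  · rw [mollStep, mollStep, integral_sub_mul_eq ρ (fun u => frozenStep C h (b u μ) (ν u μ) f x),
      integral_sub_mul_eq ρ (fun u => frozenStep C h (b u μ) (ν u μ) f x'),
      ← integral_sub (hρ.integrable_mul (hc x)) (hρ.integrable_mul (hc x'))]
    simp_rw [← mul_sub]
    exact hρ.abs_integral_le fun z _ =>
      H.abs_frozenStep_sub_frozenStep_le hh hCh hμ hf _ _ _ _ (by simp)

omit hCh in
lemma UniformBounds.abs_mollStep_sub_eulerStep_le {A : ℝ} {f : Space d → ℝ} (hf : IsBL A f)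
    (x : Space d) : |mollStep C h ρ b ν μ f x - eulerStep C h b ν μ f x| ≤ h * (3 * C * A * ε) := by
  have hA := hf.nonneg
  have hC := H.pos
  have hc : Continuous fun z => frozenStep C h (b (x - z) μ) (ν (x - z) μ) f x :=
    (H.continuous_frozenStep hh hμ hf x).comp (by fun_prop : Continuous fun z => x - z)
  have e : mollStep C h ρ b ν μ f x - eulerStep C h b ν μ f x
      = ∫ z, ρ z * (frozenStep C h (b (x - z) μ) (ν (x - z) μ) f x
        - frozenStep C h (b x μ) (ν x μ) f x) := by
    simp_rw [mul_sub]
    rw [integral_sub (hρ.integrable_mul hc) (hρ.integrable.mul_const _), integral_mul_const,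
      hρ.integral_eq_one, one_mul, mollStep,
      integral_sub_mul_eq ρ (fun u => frozenStep C h (b u μ) (ν u μ) f x), eulerStep]
  rw [e]
  refine hρ.abs_integral_le fun z hz => (H.abs_frozenStep_sub_le_norm hh hμ hf _ _ x).trans ?_
  have : ‖x - z - x‖ ≤ ε := by simpa using hz
  gcongr

/-- The second differences grow at most exponentially under mollified steps. In the discrete
Leibniz rule the increments of `ρ` have integral zero, so that they only meet the increment of
the step, which is of order `h`. -/
lemma UniformBounds.mollStep_hasD2 {A Λ : ℝ} {f : Space d → ℝ} (hf : IsBL A f) (hΛ : 0 ≤ Λ)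
    (hf' : HasD2 Λ f) :
    HasD2 (Λ + h * (9 * C * K * (A + Λ))) (mollStep C h ρ b ν μ f) := by
  intro x v w
  have hA := hf.nonneg
  have hC := H.pos
  have hfc := hf.continuous
  have hc := fun x => H.continuous_frozenStep hh hμ hf x
  set q : Space d → Space d → ℝ := fun u z => frozenStep C h (b u μ) (ν u μ) f z with hq
  have hqd : ∀ u z w, frozenStep C h (b u μ) (ν u μ) (fun z => f (z + w) - f z) z
      = q u (z + w) - q u z := fun u z w =>
    frozenStep_diff hC hh hCh (H.kernel μ hμ u) hfc hf.bound z w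
  have hi : ∀ z, Integrable fun u => ρ (z - u) * q u z := fun z => hρ.integrable_sub_mul (hc z) z
  have hρi : ∀ z, Integrable fun u => ρ (z - u) := fun z => hρ.integrable.comp_sub_left z
  have hρ1 : ∀ z, ∫ u, ρ (z - u) = 1 := fun z => by
    rw [integral_sub_left_eq_self (fun u => ρ u), hρ.integral_eq_one]
  -- the increments of the step
  have hr : ∀ u v, |q u (x + v) - f (x + v) - (q u x - f x)| ≤ h * (3 * C * ((A + Λ) * ‖v‖)) := by
    intro u v
    have := abs_frozenStep_sub_self_le hC hh (H.kernel μ hμ u) (H.drift μ hμ u)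
      (hf.diff hf' hΛ v) x
    rw [hqd] at this
    refine le_trans (le_of_eq ?_) this
    congr 1; ring
  have hr0 : ∀ u, |q u x - f x| ≤ h * (3 * C * A) := fun u =>
    abs_frozenStep_sub_self_le hC hh (H.kernel μ hμ u) (H.drift μ hμ u) hf x
  have hqq : ∀ u, |q u (x + v + w) - q u (x + v) - q u (x + w) + q u x| ≤ Λ * ‖v‖ * ‖w‖ := by
    intro u
    have := frozenStep_diff (v := b u μ) hC hh hCh (H.kernel μ hμ u)
      (f := fun z => f (z + v) - f z) (by fun_prop) (hf.diff hf' hΛ v).bound x w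
    rw [hqd, hqd, add_right_comm x w v] at this
    have h2 := abs_frozenStep_le (v := b u μ) hC hh hCh (H.kernel μ hμ u)
      (f := fun z => f (z + w + v) - f (z + w) - (f (z + v) - f z)) (by fun_prop)
      (M := Λ * ‖v‖ * ‖w‖) (fun z => by
        refine le_trans (le_of_eq ?_) (hf' z v w)
        rw [add_right_comm z w v]; congr 1; ring) x
    rw [this] at h2
    refine le_trans (le_of_eq ?_) h2
    congr 1; ring
  set T : Space d → ℝ := fun u =>
    ρ (x + v + w - u) * (q u (x + v + w) - q u (x + v) - q u (x + w) + q u x)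
    + (ρ (x + v + w - u) - ρ (x + v - u)) * (q u (x + v) - f (x + v) - (q u x - f x))
    + (ρ (x + v + w - u) - ρ (x + w - u)) * (q u (x + w) - f (x + w) - (q u x - f x))
    + (ρ (x + v + w - u) - ρ (x + v - u) - ρ (x + w - u) + ρ (x - u)) * (q u x - f x) with hT
  have e : mollStep C h ρ b ν μ f (x + v + w) - mollStep C h ρ b ν μ f (x + v)
      - mollStep C h ρ b ν μ f (x + w) + mollStep C h ρ b ν μ f x = ∫ u, T u := by
    have s1 := integral_four (hi (x + v + w)) (hi (x + v)) (hi (x + w)) (hi x)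
    have s2 := integral_four ((hρi (x + v + w)).mul_const (f (x + v) + f (x + w) - f x))
      ((hρi (x + v)).mul_const (f (x + v))) ((hρi (x + w)).mul_const (f (x + w)))
      ((hρi x).mul_const (f x))
    have i4 : Integrable fun u => ρ (x + v + w - u) * q u (x + v + w) - ρ (x + v - u) * q u (x + v)
        - ρ (x + w - u) * q u (x + w) + ρ (x - u) * q u x :=
      (((hi _).sub (hi _)).sub (hi _)).add (hi _)
    have i5 : Integrable fun u => ρ (x + v + w - u) * (f (x + v) + f (x + w) - f x)
        - ρ (x + v - u) * f (x + v) - ρ (x + w - u) * f (x + w) + ρ (x - u) * f x :=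
      ((((hρi _).mul_const _).sub ((hρi _).mul_const _)).sub ((hρi _).mul_const _)).add
        ((hρi _).mul_const _)
    simp only [integral_mul_const, hρ1, one_mul] at s2
    have s3 : ∫ u, T u = (∫ u, (ρ (x + v + w - u) * q u (x + v + w) - ρ (x + v - u) * q u (x + v)
        - ρ (x + w - u) * q u (x + w) + ρ (x - u) * q u x))
        - ∫ u, (ρ (x + v + w - u) * (f (x + v) + f (x + w) - f x)
        - ρ (x + v - u) * f (x + v) - ρ (x + w - u) * f (x + w) + ρ (x - u) * f x) := by
      rw [← integral_sub i4 i5]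
      congr 1
      funext u
      simp only [hT]
      ring
    simp only [mollStep]
    rw [s3, ← s1, ← s2]
    simp only [hq]
    ring
  have hsw : ∀ z u w : Space d, z - u + w = z + w - u := fun z u w => by abel
  have j1 : ∀ z w, Integrable fun u => |ρ (z + w - u) - ρ (z - u)| := fun z w =>
    ((hρi (z + w)).sub (hρi z)).abs
  have k1 : ∀ z w, ∫ u, |ρ (z + w - u) - ρ (z - u)| ≤ K * ‖w‖ := fun z w => by
    have := integral_sub_left_eq_self (fun u => |ρ (u + w) - ρ u|) volume z
    simp only [hsw] at this
    rw [this]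
    exact hρ.integral_diff_le w
  have j2 : Integrable fun u =>
      |ρ (x + v + w - u) - ρ (x + v - u) - ρ (x + w - u) + ρ (x - u)| :=
    ((((hρi _).sub (hρi _)).sub (hρi _)).add (hρi _)).abs
  have k2 : ∫ u, |ρ (x + v + w - u) - ρ (x + v - u) - ρ (x + w - u) + ρ (x - u)|
      ≤ K * ‖v‖ * ‖w‖ := by
    have := integral_sub_left_eq_self
      (fun u => |ρ (u + v + w) - ρ (u + v) - ρ (u + w) + ρ u|) volume x
    simp only [hsw] at this
    rw [this]
    exact hρ.integral_diff₂_le v w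
  set B₁ := Λ * ‖v‖ * ‖w‖
  set B₂ := h * (3 * C * ((A + Λ) * ‖v‖))
  set B₃ := h * (3 * C * ((A + Λ) * ‖w‖))
  set B₄ := h * (3 * C * A)
  have hle : ∀ u, ‖T u‖ ≤ ρ (x + v + w - u) * B₁ + |ρ (x + v + w - u) - ρ (x + v - u)| * B₂
      + |ρ (x + w + v - u) - ρ (x + w - u)| * B₃
      + |ρ (x + v + w - u) - ρ (x + v - u) - ρ (x + w - u) + ρ (x - u)| * B₄ := fun u => by
    rw [Real.norm_eq_abs, add_right_comm x w v]
    refine (abs_add_le _ _).trans (add_le_add ((abs_add_le _ _).trans (add_le_add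
      ((abs_add_le _ _).trans (add_le_add ?_ ?_)) ?_)) ?_) <;> rw [abs_mul]
    · rw [abs_of_nonneg (hρ.nonneg _)]
      exact mul_le_mul_of_nonneg_left (hqq u) (hρ.nonneg _)
    · exact mul_le_mul_of_nonneg_left (hr u v) (abs_nonneg _)
    · exact mul_le_mul_of_nonneg_left (hr u w) (abs_nonneg _)
    · exact mul_le_mul_of_nonneg_left (hr0 u) (abs_nonneg _)
  have m1 := (hρi (x + v + w)).mul_const B₁
  have m2 := (j1 (x + v) w).mul_const B₂
  have m3 := (j1 (x + w) v).mul_const B₃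
  have m4 := j2.mul_const B₄
  have m12 : Integrable fun u => ρ (x + v + w - u) * B₁
    + |ρ (x + v + w - u) - ρ (x + v - u)| * B₂ := m1.add m2
  have m123 : Integrable fun u => ρ (x + v + w - u) * B₁
    + |ρ (x + v + w - u) - ρ (x + v - u)| * B₂
    + |ρ (x + w + v - u) - ρ (x + w - u)| * B₃ := m12.add m3
  have main := norm_integral_le_of_norm_le (m123.add m4) (Eventually.of_forall hle)
  simp only [Pi.add_apply] at main
  rw [integral_add m123 m4, integral_add m12 m3, integral_add m1 m2, integral_mul_const,
    integral_mul_const, integral_mul_const, integral_mul_const, hρ1, Real.norm_eq_abs] at main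
  rw [e]
  refine main.trans ?_
  have t2 := mul_le_mul_of_nonneg_right (k1 (x + v) w) (by positivity : 0 ≤ B₂)
  have t3 := mul_le_mul_of_nonneg_right (k1 (x + w) v) (by positivity : 0 ≤ B₃)
  have t4 := mul_le_mul_of_nonneg_right k2 (by positivity : 0 ≤ B₄)
  have hK : 0 ≤ K * ‖v‖ * ‖w‖ := (integral_nonneg fun _ => abs_nonneg _).trans k2
  have t5 : 0 ≤ K * ‖v‖ * ‖w‖ * (h * (3 * C * Λ)) := by positivity
  simp only [B₁, B₂, B₃, B₄] at *
  nlinarith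

end Step

/-! ### Stability of approximate solutions -/

/-- The curve `m` satisfies the weak equation on `[0, T]` up to an error, in the form of a
first-order expansion in time for smooth test functions. Solutions satisfy this with `ε = 0`, and
Euler schemes with an `ε` that tends to zero with the step. -/
structure AlmostSolves (S : Set (FiniteMeasure (Space d)))
    (b : Space d → FiniteMeasure (Space d) → Space d)
    (ν : Space d → FiniteMeasure (Space d) → Measure (Space d)) (T c ε : ℝ)
    (m : ℝ → FiniteMeasure (Space d)) : Prop where
  mem : ∀ t ∈ Icc 0 T, m t ∈ S
  estimate : ∀ s t, 0 ≤ s → s ≤ t → t ≤ T → ∀ (A Λ : ℝ) (f : Space d → ℝ), IsC1Infty f →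
    IsBL A f → 0 ≤ Λ → HasD2 Λ f →
      |∫ x, f x ∂(m t : Measure (Space d)) - ∫ x, f x ∂(m s : Measure (Space d))
        - (t - s) * rate b ν (m s) f| ≤ (c * (t - s) ^ 2 + ε) * (A + Λ)

section Stability

variable {S : Set (FiniteMeasure (Space d))} {b : Space d → FiniteMeasure (Space d) → Space d}
  {ν : Space d → FiniteMeasure (Space d) → Measure (Space d)} {C : ℝ}
  (H : UniformBounds S b ν C)
include H

lemma UniformBounds.tendsto_integral_eulerStep {h : ℝ} (hh : 0 < h) (hCh : 2 * C * h ≤ 1)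
    {μ : FiniteMeasure (Space d)} (hμ : μ ∈ S) {B : ℝ} {g : ℕ → Space d → ℝ} {f : Space d → ℝ}
    (hg : ∀ n, IsBL B (g n)) (hlim : ∀ x, Tendsto (fun n => g n x) atTop (𝓝 (f x))) :
    Tendsto (fun n => ∫ x, eulerStep C h b ν μ (g n) x ∂(μ : Measure (Space d))) atTop
      (𝓝 (∫ x, eulerStep C h b ν μ f x ∂(μ : Measure (Space d)))) := by
  have hC := H.pos
  have hB := (hg 0).nonneg
  have hE : ∀ n, IsBL (B * (1 + 3 * C * h)) (eulerStep C h b ν μ (g n)) := fun n =>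
    H.eulerStep_isBL hh hCh hμ (hg n)
  refine tendsto_integral_of_dominated_convergence (fun _ => B * (1 + 3 * C * h))
    (fun n => (hE n).continuous.aestronglyMeasurable) (integrable_const _)
    (fun n => Eventually.of_forall fun x => by simpa using (hE n).bound x)
    (Eventually.of_forall fun x => ?_)
  have hδ : 0 < 2 * C * h := by positivity
  have : Tendsto (fun n => ∫ y, jumpCut (2 * C * h) y * (g n (x + y) - g n x) ∂(ν x μ))
      atTop (𝓝 (∫ y, jumpCut (2 * C * h) y * (f (x + y) - f x) ∂(ν x μ))) := by
    refine tendsto_integral_of_dominated_convergence (fun y => 2 * B * min 1 ‖y‖)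
      (fun n => ?_) ?_ (fun n => Eventually.of_forall fun y =>
        (hg n).abs_jumpCut_mul_le hδ x y)
      (Eventually.of_forall fun y => ((hlim (x + y)).sub (hlim x)).const_mul _)
    · have := (hg n).continuous
      exact ((jumpCut_continuous _).mul (by fun_prop)).aestronglyMeasurable
    · refine integrable_of_weight (H.kernel _ hμ x) (B := 2 * B) (by positivity)
        (by fun_prop) fun y => ?_
      rw [Real.norm_of_nonneg (by positivity)]
  exact ((hlim x).add (((hlim _).sub (hlim x)).div_const 2)).add (this.const_mul h)

/-- Approximate solutions nearly follow the Euler steps, also for test functions that do not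
vanish at infinity. -/
lemma UniformBounds.exists_eulerStep_error : ∃ K : ℝ, 0 ≤ K ∧ ∀ ε' : ℝ, 0 < ε' → ∃ h₀ : ℝ, 0 < h₀ ∧
    ∀ (T c ε : ℝ) (m : ℝ → FiniteMeasure (Space d)), 0 ≤ c → 0 ≤ ε → AlmostSolves S b ν T c ε m →
    ∀ h s : ℝ, 0 < h → h ≤ h₀ → 2 * C * h ≤ 1 → 0 ≤ s → s + h ≤ T →
    ∀ (A Λ : ℝ) (f : Space d → ℝ), IsBL A f → 0 ≤ Λ → HasD2 Λ f →
      |∫ x, f x ∂(m (s + h) : Measure (Space d))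
        - ∫ x, eulerStep C h b ν (m s) f x ∂(m s : Measure (Space d))|
        ≤ K * (c * h ^ 2 + ε + h * ε') * (A + Λ) := by
  obtain ⟨K, hK, happ⟩ := exists_approx d
  have hC := H.pos
  refine ⟨2 * K, by linarith, fun ε' hε' => ?_⟩
  obtain ⟨h₀, hh₀, hcons⟩ := H.exists_consistency (ε := ε' / C) (by positivity)
  refine ⟨h₀, hh₀, fun T c ε m hc hε hm h s hh hhh hCh hs hsT A Λ f hf hΛ hf' => ?_⟩
  have hA := hf.nonneg
  obtain ⟨g, hg, hgA, hgΛ, hlim⟩ := happ A f hf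
  have hms : m s ∈ S := hm.mem s ⟨hs, by linarith⟩
  -- convergence along the approximation
  have l1 : Tendsto (fun n => ∫ x, g n x ∂(m (s + h) : Measure (Space d))) atTop
      (𝓝 (∫ x, f x ∂(m (s + h) : Measure (Space d)))) :=
    tendsto_integral_of_dominated_convergence (fun _ => K * A)
      (fun n => (hgA n).continuous.aestronglyMeasurable) (integrable_const _)
      (fun n => Eventually.of_forall fun x => by simpa using (hgA n).bound x)
      (Eventually.of_forall hlim)
  have hE : ∀ n, IsBL (K * A * (1 + 3 * C * h)) (eulerStep C h b ν (m s) (g n)) := fun n =>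
    H.eulerStep_isBL hh hCh hms (hgA n)
  have l2 := H.tendsto_integral_eulerStep hh hCh hms hgA hlim
  refine le_of_tendsto (l1.sub l2).abs (Eventually.of_forall fun n => ?_)
  have hd := (hg n).contDiff.differentiable (by norm_num)
  have hΛ' : 0 ≤ K * (A + Λ) := by positivity
  have e1 := hm.estimate s (s + h) hs (by linarith) hsT _ _ (g n) (hg n) (hgA n) hΛ'
    (hgΛ Λ hΛ hf' n)
  rw [add_sub_cancel_left] at e1
  have gen := H.generator_isBL hms (hgA n) hd hΛ' (hgΛ Λ hΛ hf' n)
  have hAs : K * A + K * (A + Λ) ≤ 2 * K * (A + Λ) := by nlinarith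
  have e2 : |∫ x, (eulerStep C h b ν (m s) (g n) x - g n x - h * generator b ν (m s) (g n) x)
      ∂(m s : Measure (Space d))| ≤ h * (ε' / C * (K * A + K * (A + Λ))) * C :=
    (abs_integral_le_mul_mass (fun x => hcons h hh hhh _ hms _ _ (g n) (hgA n) hd hΛ'
      (hgΛ Λ hΛ hf' n) x) _).trans (mul_le_mul_of_nonneg_left (H.mass_le _ hms) (by positivity))
  have i1 : Integrable (fun x => eulerStep C h b ν (m s) (g n) x - g n x)
      (m s : Measure (Space d)) := ((hE n).integrable _).sub ((hgA n).integrable _)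
  rw [integral_sub i1 ((gen.integrable _).const_mul h),
    integral_sub ((hE n).integrable _) ((hgA n).integrable _), integral_const_mul] at e2
  have e3 : h * (ε' / C * (K * A + K * (A + Λ))) * C = h * ε' * (K * A + K * (A + Λ)) := by
    field_simp
  rw [e3] at e2
  have e4 := mul_le_mul_of_nonneg_left hAs (by positivity : 0 ≤ c * h ^ 2 + ε + h * ε')
  have := abs_sub (∫ x, g n x ∂(m (s + h) : Measure (Space d))
    - ∫ x, g n x ∂(m s : Measure (Space d)) - h * rate b ν (m s) (g n))
    (∫ x, eulerStep C h b ν (m s) (g n) x ∂(m s : Measure (Space d))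
    - ∫ x, g n x ∂(m s : Measure (Space d)) - h * rate b ν (m s) (g n))
  rw [sub_sub_sub_cancel_right, sub_sub_sub_cancel_right] at this
  refine this.trans ?_
  have e5 : |∫ x, eulerStep C h b ν (m s) (g n) x ∂(m s : Measure (Space d))
    - ∫ x, g n x ∂(m s : Measure (Space d)) - h * rate b ν (m s) (g n)|
      ≤ h * ε' * (K * A + K * (A + Λ)) := e2
  linarith

/-- The duality argument: pulling a test function back along the mollified steps for the first
sequence compares two sequences that nearly follow their own Euler steps. -/
lemma UniformBounds.abs_integral_sub_le_of_steps {h : ℝ} (hh : 0 < h) (hCh : 2 * C * h ≤ 1)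
    {ε K : ℝ} {ρ : Space d → ℝ} (hρ : IsMollifier ε K ρ) (hK : 0 ≤ K) {K₀ E : ℝ}
    (hE : 0 ≤ E) {M P : ℕ → FiniteMeasure (Space d)}
    (hdual : ∀ (A : ℝ) (f : Space d → ℝ), IsBL A f →
      |∫ x, f x ∂(M 0 : Measure (Space d)) - ∫ x, f x ∂(P 0 : Measure (Space d))|
        ≤ K₀ * A * dualDist (M 0) (P 0)) {N : ℕ} (hMS : ∀ j < N, M j ∈ S) (hPS : ∀ j < N, P j ∈ S)
    (hM : ∀ j < N, ∀ (A Λ : ℝ) (f : Space d → ℝ), IsBL A f → 0 ≤ Λ → HasD2 Λ f →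
      |∫ x, f x ∂(M (j + 1) : Measure (Space d))
        - ∫ x, eulerStep C h b ν (M j) f x ∂(M j : Measure (Space d))| ≤ E * (A + Λ))
    (hP : ∀ j < N, ∀ (A Λ : ℝ) (f : Space d → ℝ), IsBL A f → 0 ≤ Λ → HasD2 Λ f →
      |∫ x, f x ∂(P (j + 1) : Measure (Space d))
        - ∫ x, eulerStep C h b ν (P j) f x ∂(P j : Measure (Space d))| ≤ E * (A + Λ)) :
    ∀ n ≤ N, ∀ (A Λ : ℝ) (f : Space d → ℝ), IsBL A f → 0 ≤ Λ → HasD2 Λ f →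
      |∫ x, f x ∂(M n : Measure (Space d)) - ∫ x, f x ∂(P n : Measure (Space d))|
        ≤ A * (1 + 3 * C * h) ^ n * (K₀ * dualDist (M 0) (P 0)
          + ∑ j ∈ Finset.range n, h * (3 * C ^ 2 * dualDist (M j) (P j) + 6 * C ^ 2 * ε))
          + n * (2 * E) * ((A + Λ) * (1 + h * (3 * C + 9 * C * K)) ^ n) := by
  have hC := H.pos
  have hε : 0 ≤ ε := by
    by_contra hneg
    have : ∀ z, ρ z = 0 := fun z => by
      by_contra hz
      exact hneg ((norm_nonneg z).trans (hρ.norm_le z hz))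
    have h1 := hρ.integral_eq_one
    simp [this] at h1
  intro n
  induction n with
  | zero =>
    intro _ A Λ f hf hΛ hf'
    simpa [mul_comm, mul_left_comm, mul_assoc] using hdual A f hf
  | succ n ih =>
    intro hn A Λ f hf hΛ hf'
    have hA := hf.nonneg
    have hμ := hMS n hn
    have hη := hPS n hn
    set a := 1 + 3 * C * h with ha
    set β := 1 + h * (3 * C + 9 * C * K) with hβ
    have ha1 : 1 ≤ a := by rw [ha]; have : 0 ≤ 3 * C * h := by positivity
                           linarith
    have hβ1 : 1 ≤ β := by rw [hβ]; have : 0 ≤ h * (3 * C + 9 * C * K) := by positivity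
                           linarith
    set D := dualDist (M n) (P n) with hD
    have hD0 : 0 ≤ D := dualDist_nonneg _ _
    set g := mollStep C h ρ b ν (M n) f with hg
    have hgA : IsBL (A * a) g := H.mollStep_isBL hh hCh hμ hρ hf
    have hgΛ : HasD2 (Λ + h * (9 * C * K * (A + Λ))) g := H.mollStep_hasD2 hh hCh hμ hρ hf hΛ hf'
    have hΛ' : 0 ≤ Λ + h * (9 * C * K * (A + Λ)) := by positivity
    have hih := ih (by omega) _ _ g hgA hΛ' hgΛ
    have q1 := hM n hn A Λ f hf hΛ hf'
    have q2 := hP n hn A Λ f hf hΛ hf'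
    have eM := (H.eulerStep_isBL hh hCh hμ hf)
    have eP := (H.eulerStep_isBL hh hCh hη hf)
    have r1 : |∫ x, (g x - eulerStep C h b ν (M n) f x) ∂(M n : Measure (Space d))|
        ≤ h * (3 * C * A * ε) * C :=
      (abs_integral_le_mul_mass (H.abs_mollStep_sub_eulerStep_le hh hμ hρ hf) _).trans
        (mul_le_mul_of_nonneg_left (H.mass_le _ hμ) (by positivity))
    have r2 : |∫ x, (g x - eulerStep C h b ν (P n) f x) ∂(P n : Measure (Space d))|
        ≤ (h * (3 * C * A * ε) + h * (3 * C * A * D)) * C := by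
      refine (abs_integral_le_mul_mass (fun x => ?_) _).trans
        (mul_le_mul_of_nonneg_left (H.mass_le _ hη) (by positivity))
      exact (abs_sub_le _ (eulerStep C h b ν (M n) f x) _).trans (add_le_add
        (H.abs_mollStep_sub_eulerStep_le hh hμ hρ hf x)
        (H.abs_frozenStep_sub_le_dualDist hh hμ hη hf x x))
    rw [integral_sub (hgA.integrable _) (eM.integrable _)] at r1
    rw [integral_sub (hgA.integrable _) (eP.integrable _)] at r2
    rw [Finset.sum_range_succ]
    set σ := ∑ j ∈ Finset.range n, h * (3 * C ^ 2 * dualDist (M j) (P j) + 6 * C ^ 2 * ε)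
    have p1 : A * a * a ^ n = A * a ^ (n + 1) := by ring
    rw [p1] at hih
    have hβn : 1 ≤ β ^ n := one_le_pow₀ hβ1
    have hβn' : 1 ≤ β ^ (n + 1) := one_le_pow₀ hβ1
    have han : 1 ≤ a ^ (n + 1) := one_le_pow₀ ha1
    have p2 : (A * a + (Λ + h * (9 * C * K * (A + Λ)))) * β ^ n ≤ (A + Λ) * β ^ (n + 1) := by
      have : A * a + (Λ + h * (9 * C * K * (A + Λ))) ≤ (A + Λ) * β := by
        have : 0 ≤ Λ * (h * (3 * C)) := by positivity
        rw [ha, hβ]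
        linarith
      calc _ ≤ (A + Λ) * β * β ^ n := mul_le_mul_of_nonneg_right this (zero_le_one.trans hβn)
        _ = _ := by ring
    have p3 := mul_le_mul_of_nonneg_left p2 (by positivity : 0 ≤ (n : ℝ) * (2 * E))
    have p4 : 2 * E * (A + Λ) ≤ 2 * E * ((A + Λ) * β ^ (n + 1)) := by
      have : A + Λ ≤ (A + Λ) * β ^ (n + 1) := le_mul_of_one_le_right (by positivity) hβn'
      exact mul_le_mul_of_nonneg_left this (by positivity)
    have p5 : A * (h * (3 * C ^ 2 * D + 6 * C ^ 2 * ε))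
        ≤ A * a ^ (n + 1) * (h * (3 * C ^ 2 * D + 6 * C ^ 2 * ε)) := by
      refine mul_le_mul_of_nonneg_right ?_ (by positivity)
      exact le_mul_of_one_le_right hA han
    have tri : |∫ x, f x ∂(M (n + 1) : Measure (Space d))
        - ∫ x, f x ∂(P (n + 1) : Measure (Space d))|
        ≤ |∫ x, g x ∂(M n : Measure (Space d)) - ∫ x, g x ∂(P n : Measure (Space d))|
          + 2 * E * (A + Λ) + A * (h * (3 * C ^ 2 * D + 6 * C ^ 2 * ε)) := by
      have b1 := abs_le.1 q1
      have b2 := abs_le.1 q2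
      have b3 := abs_le.1 r1
      have b4 := abs_le.1 r2
      have b5 := abs_le.1 (le_refl
        |∫ x, g x ∂(M n : Measure (Space d)) - ∫ x, g x ∂(P n : Measure (Space d))|)
      rw [abs_le]
      constructor <;> linarith [b1.1, b1.2, b2.1, b2.2, b3.1, b3.2, b4.1, b4.2, b5.1, b5.2]
    push_cast
    linarith

omit H in
/-- The discrete Gronwall inequality. -/
lemma le_of_discrete_gronwall {D : ℕ → ℝ} {X y : ℝ} (hy : 0 ≤ y) {N : ℕ}
    (hD : ∀ n ≤ N, D n ≤ X + y * ∑ j ∈ Finset.range n, D j) :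
    ∀ n ≤ N, D n ≤ X * (1 + y) ^ n := by
  have key : ∀ n ≤ N, X + y * ∑ j ∈ Finset.range n, D j ≤ X * (1 + y) ^ n := by
    intro n
    induction n with
    | zero => intro _; simp
    | succ n ih =>
      intro hn
      have h1 := ih (by omega)
      have h2 := mul_le_mul_of_nonneg_left (hD n (by omega)) hy
      rw [Finset.sum_range_succ, pow_succ]
      nlinarith
  exact fun n hn => (hD n hn).trans (key n hn)

omit H in
lemma one_add_pow_le_exp {x r : ℝ} (hx : 0 ≤ x) {n : ℕ} (hn : n * x ≤ r) :
    (1 + x) ^ n ≤ Real.exp r := by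
  calc (1 + x) ^ n ≤ Real.exp x ^ n := by
        gcongr
        linarith [Real.add_one_le_exp x]
    _ = Real.exp (n * x) := (Real.exp_nat_mul x n).symm
    _ ≤ Real.exp r := Real.exp_le_exp.2 hn

set_option maxHeartbeats 1000000 in
/-- Approximate solutions depend Lipschitz continuously on the initial data, up to an error that
tends to zero together with the defect `ε`. -/
theorem UniformBounds.stability {r : ℝ} (hr : 0 ≤ r) : ∃ L : ℝ, 0 ≤ L ∧ ∀ t ∈ Icc 0 r, ∀ c : ℝ,
    0 ≤ c → ∀ η : ℝ, 0 < η → ∃ ε : ℝ, 0 < ε ∧ ∀ m p : ℝ → FiniteMeasure (Space d),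
      AlmostSolves S b ν t c ε m → AlmostSolves S b ν t c ε p →
        dualDist (m t) (p t) ≤ L * dualDist (m 0) (p 0) + η := by
  obtain ⟨K₀, hK₀, hdual⟩ := exists_dualDist_bound d
  obtain ⟨K₁, hK₁, hstep⟩ := H.exists_eulerStep_error
  have hC := H.pos
  set a := Real.exp (3 * C * r) with ha
  set γ := 3 * C ^ 2 * a with hγ
  have ha0 : 1 ≤ a := Real.one_le_exp (by positivity)
  set G := Real.exp (γ * r) with hG
  have hG1 : 1 ≤ G := Real.one_le_exp (by positivity)
  refine ⟨G * (a * K₀), by positivity, fun t ht c hc η hη => ?_⟩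
  rcases ht.1.eq_or_lt with rfl | ht0
  · refine ⟨1, one_pos, fun m p _ _ => ?_⟩
    have h1 : 1 ≤ G * (a * K₀) := one_le_mul_of_one_le_of_one_le hG1
      (one_le_mul_of_one_le_of_one_le ha0 hK₀)
    have := le_mul_of_one_le_left (dualDist_nonneg (m 0) (p 0)) h1
    linarith
  -- first the mollification scale, then the time step, then the defect
  obtain ⟨ε₁, hε₁, hε₁η⟩ : ∃ ε₁ : ℝ, 0 < ε₁ ∧
      G * ((a * (r * (6 * C ^ 2)) + 2 * C) * ε₁) ≤ η / 2 := by
    refine ⟨η / (2 * (G * (a * (r * (6 * C ^ 2)) + 2 * C))), by positivity, le_of_eq ?_⟩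
    field_simp
  obtain ⟨K, hK, ρ, hρ⟩ := exists_isMollifier d hε₁
  set β := Real.exp (r * (3 * C + 9 * C * K)) with hβ
  have hβ0 : 0 < β := Real.exp_pos _
  set Q := G * (2 * K₁ * (1 + K) * β) + 1 with hQ
  have hQ0 : 0 < Q := by positivity
  obtain ⟨h₀, hh₀, hstep⟩ := hstep (η / (6 * Q * t)) (by positivity)
  obtain ⟨n, hn⟩ := exists_nat_gt (max (t / h₀) (max (2 * C * t) (6 * Q * c * t ^ 2 / η)))
  have hn1 : t / h₀ < n := (le_max_left _ _).trans_lt hn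
  have hn2 : 2 * C * t < n := ((le_max_left _ _).trans (le_max_right _ _)).trans_lt hn
  have hn3 : 6 * Q * c * t ^ 2 / η < n := ((le_max_right _ _).trans (le_max_right _ _)).trans_lt hn
  have hn0 : (0 : ℝ) < n := lt_trans (by positivity) hn1
  set h := t / n with hh
  have hh0 : 0 < h := by positivity
  have hnh : n * h = t := by rw [hh]; field_simp
  have hhh₀ : h ≤ h₀ := by
    rw [div_lt_iff₀ hh₀] at hn1
    rw [hh, div_le_iff₀ hn0]; linarith
  have hCh : 2 * C * h ≤ 1 := by
    rw [hh, ← mul_div_assoc, div_le_one hn0]; exact hn2.le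
  refine ⟨η / (6 * Q * n), by positivity, fun m p hm hp => ?_⟩
  set ε := η / (6 * Q * n) with hε
  set E := K₁ * (c * h ^ 2 + ε + h * (η / (6 * Q * t))) with hE
  have hE0 : 0 ≤ E := by positivity
  have hnE : n * E ≤ K₁ * (η / (2 * Q)) := by
    have e1 : n * (c * h ^ 2) ≤ η / (6 * Q) := by
      rw [hh, div_pow, le_div_iff₀ (by positivity)]
      rw [div_lt_iff₀ hη] at hn3
      have : (n : ℝ) * (c * (t ^ 2 / n ^ 2)) * (6 * Q) = 6 * Q * c * t ^ 2 / n := by field_simp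
      rw [this, div_le_iff₀ hn0]; linarith
    have e2 : n * ε = η / (6 * Q) := by rw [hε]; field_simp
    have e3 : n * (h * (η / (6 * Q * t))) = η / (6 * Q) := by
      rw [← mul_assoc, hnh]; field_simp
    have e4 : η / (2 * Q) = 3 * (η / (6 * Q)) := by field_simp; norm_num
    calc n * E = K₁ * (n * (c * h ^ 2) + n * ε + n * (h * (η / (6 * Q * t)))) := by rw [hE]; ring
      _ ≤ K₁ * (η / (2 * Q)) := by
          rw [e2, e3, e4]; gcongr; linarith
  have hjt : ∀ j ≤ n, (j : ℝ) * h ∈ Icc 0 t := fun j hj => by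
    refine ⟨by positivity, ?_⟩
    rw [← hnh]
    gcongr
  have hst : ∀ m : ℝ → FiniteMeasure (Space d), AlmostSolves S b ν t c ε m → ∀ j < n,
      ∀ (A Λ : ℝ) (f : Space d → ℝ), IsBL A f → 0 ≤ Λ → HasD2 Λ f →
      |∫ x, f x ∂(m ((j + 1 : ℕ) * h) : Measure (Space d))
        - ∫ x, eulerStep C h b ν (m (j * h)) f x ∂(m (j * h) : Measure (Space d))|
        ≤ E * (A + Λ) := fun m hm j hj A Λ f hf hΛ hf' => by
    have e : ((j + 1 : ℕ) : ℝ) * h = j * h + h := by push_cast; ring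
    have := (hjt (j + 1) hj).2
    rw [e] at this ⊢
    exact hstep t c ε m hc (by positivity) hm h _ hh0 hhh₀ hCh (hjt j hj.le).1 this A Λ f hf hΛ hf'
  have main := H.abs_integral_sub_le_of_steps hh0 hCh hρ hK (K₀ := K₀) hE0
    (M := fun j => m (j * h)) (P := fun j => p (j * h)) (fun A f hf => hdual A f hf _ _)
    (N := n) (fun j hj => hm.mem _ (hjt j hj.le)) (fun j hj => hp.mem _ (hjt j hj.le))
    (hst m hm) (hst p hp)
  simp only [Nat.cast_zero, zero_mul] at main
  set D : ℕ → ℝ := fun j => dualDist (m (j * h)) (p (j * h)) with hD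
  set D₀ := dualDist (m 0) (p 0) with hD₀
  have hD₀0 : 0 ≤ D₀ := dualDist_nonneg _ _
  have hDn : ∀ j, 0 ≤ D j := fun j => dualDist_nonneg _ _
  set X := a * (K₀ * D₀) + (a * (r * (6 * C ^ 2)) + 2 * C) * ε₁
    + 2 * K₁ * (η / (2 * Q)) * (1 + K) * β with hX
  have gron := le_of_discrete_gronwall (D := D) (X := X) (y := γ * h) (by positivity) (N := n)
    fun k hk => by
      have hkn : (k : ℝ) ≤ n := by exact_mod_cast hk
      have hkh : (k : ℝ) * h ≤ r := (hjt k hk).2.trans ht.2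
      have hsg : 0 ≤ ∑ j ∈ Finset.range k, D j := Finset.sum_nonneg fun j _ => hDn j
      have ak : (1 + 3 * C * h) ^ k ≤ a := one_add_pow_le_exp (by positivity) (by
        calc (k : ℝ) * (3 * C * h) = 3 * C * (k * h) := by ring
          _ ≤ 3 * C * r := by gcongr)
      have βk : (1 + h * (3 * C + 9 * C * K)) ^ k ≤ β := one_add_pow_le_exp (by positivity) (by
        calc (k : ℝ) * (h * (3 * C + 9 * C * K)) = k * h * (3 * C + 9 * C * K) := by ring
          _ ≤ r * (3 * C + 9 * C * K) := by gcongr)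
      have hsum : ∑ j ∈ Finset.range k, h * (3 * C ^ 2 * D j + 6 * C ^ 2 * ε₁)
          ≤ 3 * C ^ 2 * h * ∑ j ∈ Finset.range k, D j + r * (6 * C ^ 2) * ε₁ := by
        rw [← Finset.mul_sum, Finset.sum_add_distrib, ← Finset.mul_sum, Finset.sum_const,
          Finset.card_range, nsmul_eq_mul]
        have := mul_le_mul_of_nonneg_right hkh (by positivity : 0 ≤ 6 * C ^ 2 * ε₁)
        linarith
      have hs0 : 0 ≤ ∑ j ∈ Finset.range k, h * (3 * C ^ 2 * D j + 6 * C ^ 2 * ε₁) :=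
        Finset.sum_nonneg fun j _ => by have := hDn j; positivity
      refine dualDist_le (by positivity) fun f hf hf1 => ?_
      have hsm := main k hk 1 (K * 1) (smoothing ρ f) (hρ.smoothing_isBL hf1)
        (by positivity) (hρ.smoothing_hasD2_of_isBL hf1)
      have hclose : ∀ μ ∈ S, |∫ x, (smoothing ρ f x - f x) ∂(μ : Measure (Space d))| ≤ ε₁ * C := by
        intro μ hμ
        refine (abs_integral_le_mul_mass (fun x => hρ.abs_smoothing_sub_le hf1.continuous x
          fun z hz => ?_) μ).trans (mul_le_mul_of_nonneg_left (H.mass_le μ hμ) hε₁.le)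
        have := hf1.lip (x - z) x
        simp only [sub_sub_cancel_left, norm_neg, one_mul] at this
        exact this.trans hz
      have c1 := hclose _ (hm.mem _ (hjt k hk))
      have c2 := hclose _ (hp.mem _ (hjt k hk))
      rw [integral_sub ((hρ.smoothing_isBL hf1).integrable _) (hf1.integrable _)] at c1 c2
      have f1 : 1 * (1 + 3 * C * h) ^ k * (K₀ * D₀
          + ∑ j ∈ Finset.range k, h * (3 * C ^ 2 * D j + 6 * C ^ 2 * ε₁))
          ≤ a * (K₀ * D₀ + (3 * C ^ 2 * h * ∑ j ∈ Finset.range k, D j + r * (6 * C ^ 2) * ε₁)) := by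
        rw [one_mul]
        gcongr
      have f2 : (k : ℝ) * (2 * E) * ((1 + K * 1) * (1 + h * (3 * C + 9 * C * K)) ^ k)
          ≤ 2 * (K₁ * (η / (2 * Q))) * ((1 + K) * β) := by
        have : (k : ℝ) * (2 * E) ≤ 2 * (K₁ * (η / (2 * Q))) := by
          have := mul_le_mul_of_nonneg_right hkn hE0
          linarith
        rw [mul_one]
        gcongr
      have b1 := abs_le.1 c1
      have b2 := abs_le.1 c2
      have b3 := abs_le.1 (hsm.trans (add_le_add f1 f2))
      have fin : a * (K₀ * D₀ + (3 * C ^ 2 * h * ∑ j ∈ Finset.range k, D j + r * (6 * C ^ 2) * ε₁))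
          + 2 * (K₁ * (η / (2 * Q))) * ((1 + K) * β) + 2 * (ε₁ * C)
          = X + γ * h * ∑ j ∈ Finset.range k, D j := by
        rw [hX, hγ]; ring
      rw [← fin, abs_le]
      constructor <;> linarith only [b1.1, b1.2, b2.1, b2.2, b3.1, b3.2]
  have hfin := gron n le_rfl
  simp only [hD, hnh] at hfin
  have hX0 : 0 ≤ X := by positivity
  have hpow : (1 + γ * h) ^ n ≤ G := one_add_pow_le_exp (by positivity) (by
    calc (n : ℝ) * (γ * h) = γ * (n * h) := by ring
      _ ≤ γ * r := by rw [hnh]; exact mul_le_mul_of_nonneg_left ht.2 (by positivity))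
  refine hfin.trans ((mul_le_mul_of_nonneg_left hpow hX0).trans ?_)
  have hlast : G * (2 * K₁ * (η / (2 * Q)) * (1 + K) * β) ≤ η / 2 := by
    have : G * (2 * K₁ * (η / (2 * Q)) * (1 + K) * β) = (Q - 1) * (η / (2 * Q)) := by
      rw [hQ]; ring
    rw [this]
    have e : η / 2 = Q * (η / (2 * Q)) := by field_simp
    rw [e]
    have : 0 ≤ η / (2 * Q) := by positivity
    linarith only [this]
  have e : X * G = G * (a * K₀) * D₀ + G * ((a * (r * (6 * C ^ 2)) + 2 * C) * ε₁)
      + G * (2 * K₁ * (η / (2 * Q)) * (1 + K) * β) := by rw [hX]; ring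
  rw [e]
  linarith only [hε₁η, hlast]

end Stability

open scoped CompactlySupported

/-! ### Measures from functionals on bounded Lipschitz functions -/

/-- A positive linear functional on bounded Lipschitz functions that has no mass at infinity. -/
structure IsTightFunctional (I : (Space d → ℝ) → ℝ) : Prop where
  add : ∀ (A B : ℝ) (f g : Space d → ℝ), IsBL A f → IsBL B g → I (fun x => f x + g x) = I f + I g
  smul : ∀ (c A : ℝ) (f : Space d → ℝ), IsBL A f → I (fun x => c * f x) = c * I f
  nonneg : ∀ (A : ℝ) (f : Space d → ℝ), IsBL A f → (∀ x, 0 ≤ f x) → 0 ≤ I f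
  tight : Tendsto (fun n => I (cutoff n)) atTop (𝓝 (I fun _ => 1))

section Functional

variable {I : (Space d → ℝ) → ℝ} (hI : IsTightFunctional I)
include hI

lemma IsTightFunctional.sub {A B : ℝ} {f g : Space d → ℝ} (hf : IsBL A f) (hg : IsBL B g) :
    I (fun x => f x - g x) = I f - I g := by
  have := hI.add _ _ f (fun x => (-1) * g x) hf (hg.const_mul (-1))
  rw [hI.smul _ _ g hg] at this
  simpa [sub_eq_add_neg] using this

lemma IsTightFunctional.abs_le {A B : ℝ} {f g : Space d → ℝ} (hf : IsBL A f) (hg : IsBL B g)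
    (h : ∀ x, |f x| ≤ g x) : |I f| ≤ I g := by
  have h1 := hI.nonneg _ _ (hg.sub hf) fun x => by linarith [(_root_.abs_le.1 (h x)).2]
  have h2 := hI.nonneg _ _ (hg.add hf) fun x => by linarith [(_root_.abs_le.1 (h x)).1]
  rw [hI.sub hg hf] at h1
  rw [hI.add _ _ _ _ hg hf] at h2
  rw [_root_.abs_le]
  constructor <;> linarith

lemma IsTightFunctional.const (c : ℝ) : I (fun _ => c) = c * I fun _ => 1 := by
  simpa using hI.smul c _ _ (isBL_const (d := d) 1)

/-- The functional extends by mollification to all compactly supported continuous functions. -/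
lemma IsTightFunctional.exists_extension : ∃ J : C_c(Space d, ℝ) →ₚ[ℝ] ℝ,
    ∀ (f : C_c(Space d, ℝ)) (A : ℝ), IsBL A f → J f = I f := by
  choose k hk ρ hρ using fun n : ℕ => exists_isMollifier d (ε := 1 / ((n : ℝ) + 1)) (by positivity)
  have hBL : ∀ (n : ℕ) (f : C_c(Space d, ℝ)),
      IsBL (c1Norm (smoothing (ρ n) f)) (smoothing (ρ n) f) := fun n f =>
    (isC1Infty_of_hasCompactSupport ((hρ n).smoothing_contDiff f.continuous)
      ((hρ n).smoothing_hasCompactSupport f.hasCompactSupport)).isBL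
  have hI1 : 0 ≤ I fun _ => 1 := hI.nonneg _ _ (isBL_const 1) fun _ => zero_le_one
  have hunif : ∀ (f : C_c(Space d, ℝ)) (η : ℝ), 0 < η → ∃ N, ∀ n ≥ N, ∀ x,
      |smoothing (ρ n) f x - f x| ≤ η := fun f η hη => by
    obtain ⟨δ, hδ, h⟩ := Metric.uniformContinuous_iff.1
      (f.hasCompactSupport.uniformContinuous_of_continuous f.continuous) η hη
    obtain ⟨N, hN⟩ := exists_nat_one_div_lt hδ
    refine ⟨N, fun n hn x => (hρ n).abs_smoothing_sub_le f.continuous x fun z hz => ?_⟩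
    have hz' : ‖z‖ < δ := (hz.trans (Nat.one_div_le_one_div hn)).trans_lt hN
    have := h (a := x - z) (b := x) (by simpa [dist_eq_norm] using hz')
    rw [Real.dist_eq] at this
    exact this.le
  have hconv : ∀ f : C_c(Space d, ℝ), ∃ a, Tendsto (fun n => I (smoothing (ρ n) f)) atTop (𝓝 a) :=
    fun f => by
      refine cauchySeq_tendsto_of_complete (Metric.cauchySeq_iff.2 fun η hη => ?_)
      obtain ⟨N, hN⟩ := hunif f (η / (4 * (I (fun _ => 1) + 1))) (by positivity)
      refine ⟨N, fun m hm n hn => ?_⟩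
      rw [Real.dist_eq, ← hI.sub (hBL m f) (hBL n f)]
      have := hI.abs_le ((hBL m f).sub (hBL n f)) (isBL_const (η / (2 * (I (fun _ => 1) + 1))))
        fun x => by
          have h1 := abs_sub_le (smoothing (ρ m) f x) (f x) (smoothing (ρ n) f x)
          have h2 := hN m hm x
          have h3 := hN n hn x
          rw [abs_sub_comm] at h3
          have h4 : η / (2 * (I (fun _ => 1) + 1)) = 2 * (η / (4 * (I (fun _ => 1) + 1))) := by
            field_simp; norm_num
          linarith
      refine this.trans_lt ?_
      rw [hI.const, div_mul_eq_mul_div, div_lt_iff₀ (by positivity)]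
      nlinarith
  choose J hJ using hconv
  have hint : ∀ (n : ℕ) (f : C_c(Space d, ℝ)) (x : Space d),
      Integrable fun u => ρ n (x - u) * f u := fun n f x =>
    (hρ n).integrable_sub_mul f.continuous x
  let J₀ : C_c(Space d, ℝ) →ₗ[ℝ] ℝ :=
    { toFun := J
      map_add' := fun f g => by
        refine tendsto_nhds_unique (hJ (f + g)) (((hJ f).add (hJ g)).congr fun n => ?_)
        rw [← hI.add _ _ _ _ (hBL n f) (hBL n g)]
        congr 1
        funext x
        simp only [smoothing, CompactlySupportedContinuousMap.coe_add, Pi.add_apply, mul_add]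
        rw [integral_add (hint n f x) (hint n g x)]
      map_smul' := fun c f => by
        refine tendsto_nhds_unique (hJ (c • f)) (((hJ f).const_mul c).congr fun n => ?_)
        rw [← hI.smul _ _ _ (hBL n f)]
        congr 1
        funext x
        simp only [smoothing, CompactlySupportedContinuousMap.coe_smul, Pi.smul_apply, smul_eq_mul,
          mul_left_comm _ c]
        rw [integral_const_mul] }
  refine ⟨PositiveLinearMap.mk₀ J₀ fun f hf => ?_, fun f A hf => ?_⟩
  · refine ge_of_tendsto' (hJ f) fun n => hI.nonneg _ _ (hBL n f) fun x => ?_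
    exact integral_nonneg fun u => mul_nonneg ((hρ n).nonneg _) (hf u)
  · refine tendsto_nhds_unique (hJ f) (tendsto_iff_norm_sub_tendsto_zero.2 ?_)
    refine Metric.tendsto_atTop.2 fun η hη => ?_
    obtain ⟨N, hN⟩ := hunif f (η / (2 * (I (fun _ => 1) + 1))) (by positivity)
    refine ⟨N, fun n hn => ?_⟩
    rw [dist_zero_right, norm_norm, Real.norm_eq_abs, ← hI.sub (hBL n f) hf]
    refine (hI.abs_le ((hBL n f).sub hf) (isBL_const _) (hN n hn)).trans_lt ?_
    rw [hI.const, div_mul_eq_mul_div, div_lt_iff₀ (by positivity)]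
    nlinarith

/-- The Riesz–Markov–Kakutani theorem for tight functionals on bounded Lipschitz functions. -/
lemma IsTightFunctional.exists_measure : ∃ μ : FiniteMeasure (Space d), ∀ (A : ℝ)
    (f : Space d → ℝ), IsBL A f → ∫ x, f x ∂(μ : Measure (Space d)) = I f := by
  obtain ⟨J, hJ⟩ := hI.exists_extension
  obtain ⟨K, hK, hcut⟩ := exists_cutoff_bounds d
  have h1 := isBL_const (d := d) 1
  set X : Measure (Space d) := RealRMK.rieszMeasure J with hX
  have hXint : ∀ (A : ℝ) (f : Space d → ℝ), IsBL A f → HasCompactSupport f →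
      ∫ x, f x ∂X = I f := fun A f hf hc => by
    have := RealRMK.integral_rieszMeasure J ⟨⟨f, hf.continuous⟩, hc⟩
    exact this.trans (hJ ⟨⟨f, hf.continuous⟩, hc⟩ A hf)
  have hfin : IsFiniteMeasure X := by
    refine ⟨?_⟩
    have hf := lintegral_liminf_le (μ := X) (u := atTop)
      (f := fun (n : ℕ) (x : Space d) => ENNReal.ofReal (cutoff n x))
      fun n => ((hcut n).1.continuous.measurable).ennreal_ofReal
    have e : ∀ x : Space d, liminf (fun n => ENNReal.ofReal (cutoff n x)) atTop = 1 := fun x => by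
      rw [(ENNReal.tendsto_ofReal (tendsto_cutoff x)).liminf_eq, ENNReal.ofReal_one]
    simp only [e, lintegral_one] at hf
    have hle : ∀ n, ∫⁻ x, ENNReal.ofReal (cutoff n x) ∂X ≤ ENNReal.ofReal (I fun _ => 1) := by
      intro n
      rw [← ofReal_integral_eq_lintegral_ofReal
        ((hcut n).1.continuous.integrable_of_hasCompactSupport (cutoff_hasCompactSupport n))
        (Eventually.of_forall (cutoff_nonneg n)), hXint _ _ (hcut n).1 (cutoff_hasCompactSupport n)]
      refine ENNReal.ofReal_le_ofReal ((le_abs_self _).trans (hI.abs_le (hcut n).1 h1 fun x => ?_))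
      rw [abs_of_nonneg (cutoff_nonneg n x)]
      exact cutoff_le_one n x
    exact (hf.trans (liminf_le_of_frequently_le' (Frequently.of_forall hle))).trans_lt
      ENNReal.ofReal_lt_top
  refine ⟨⟨X, hfin⟩, fun A f hf => ?_⟩
  have hA := hf.nonneg
  have l1 : Tendsto (fun n => ∫ x, cutoff n x * f x ∂X) atTop (𝓝 (∫ x, f x ∂X)) := by
    refine tendsto_integral_of_dominated_convergence (fun _ => A)
      (fun n => ((hcut n).1.mul hf).continuous.aestronglyMeasurable) (integrable_const _)
      (fun n => Eventually.of_forall fun x => ?_) (Eventually.of_forall fun x => ?_)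
    · rw [Real.norm_eq_abs, abs_mul, abs_of_nonneg (cutoff_nonneg n x)]
      exact (mul_le_of_le_one_left (abs_nonneg _) (cutoff_le_one n x)).trans (hf.bound x)
    · simpa using (tendsto_cutoff x).mul_const (f x)
  have l2 : Tendsto (fun n => ∫ x, cutoff n x * f x ∂X) atTop (𝓝 (I f)) := by
    have hb : Tendsto (fun n : ℕ => A * (I (fun _ => 1) - I (cutoff n))) atTop (𝓝 0) := by
      simpa using (hI.tight.const_sub (I fun _ => 1)).const_mul A
    refine tendsto_iff_norm_sub_tendsto_zero.2 (squeeze_zero (fun _ => norm_nonneg _)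
      (fun n => ?_) hb)
    have hc := (hcut n).1
    rw [hXint _ _ (hc.mul hf) (cutoff_hasCompactSupport n).mul_right,
      ← hI.sub (hc.mul hf) hf, ← hI.sub h1 hc, ← hI.smul _ _ _ (h1.sub hc), Real.norm_eq_abs]
    refine hI.abs_le ((hc.mul hf).sub hf) ((h1.sub hc).const_mul A) fun x => ?_
    have e : cutoff n x * f x - f x = -((1 - cutoff n x) * f x) := by ring
    have := cutoff_le_one n x
    rw [e, abs_neg, abs_mul, abs_of_nonneg (by linarith : 0 ≤ 1 - cutoff n x), mul_comm]
    exact mul_le_mul_of_nonneg_right (hf.bound x) (by linarith)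
  exact tendsto_nhds_unique l1 l2

end Functional

lemma mass_eq_of_integral_one {μ η : FiniteMeasure (Space d)}
    (h : ∫ _, (1 : ℝ) ∂(μ : Measure (Space d)) = ∫ _, (1 : ℝ) ∂(η : Measure (Space d))) :
    μ.mass = η.mass := by
  simp only [integral_const, smul_eq_mul, mul_one] at h
  exact NNReal.coe_injective h

/-- Completeness of the dual distance. The uniformity over test functions prevents the escape of
mass to infinity: `X n` differs little from a fixed `X N` on all the cutoff functions at once. -/
lemma exists_cauchy_limit {X : ℕ → FiniteMeasure (Space d)}
    (hX : ∀ η : ℝ, 0 < η → ∃ N, ∀ m ≥ N, ∀ n ≥ N, dualDist (X m) (X n) ≤ η) :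
    ∃ μ : FiniteMeasure (Space d),
      (∀ (A : ℝ) (f : Space d → ℝ), IsBL A f →
        Tendsto (fun n => ∫ x, f x ∂(X n : Measure (Space d))) atTop
        (𝓝 (∫ x, f x ∂(μ : Measure (Space d))))) ∧
      Tendsto (fun n => dualDist (X n) μ) atTop (𝓝 0) := by
  obtain ⟨K, hK, hdual⟩ := exists_dualDist_bound d
  obtain ⟨K', hK', hcut⟩ := exists_cutoff_bounds d
  -- the integrals form Cauchy sequences, uniformly for bounded Lipschitz functions
  have hunif : ∀ A η : ℝ, 0 < η → ∃ N, ∀ m ≥ N, ∀ n ≥ N, ∀ f : Space d → ℝ, IsBL A f →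
      |∫ x, f x ∂(X m : Measure (Space d)) - ∫ x, f x ∂(X n : Measure (Space d))| ≤ η := by
    intro A η hη
    obtain ⟨N, hN⟩ := hX (η / (K * (|A| + 1))) (by positivity)
    refine ⟨N, fun m hm n hn f hf => ((hdual A f hf _ _).trans ?_)⟩
    have hA := hf.nonneg
    have h1 := hN m hm n hn
    rw [le_div_iff₀ (by positivity)] at h1
    have h2 := dualDist_nonneg (X m) (X n)
    rw [abs_of_nonneg hA] at h1
    nlinarith
  have hconv : ∀ f : Space d → ℝ, (∃ A, IsBL A f) → ∃ a,
      Tendsto (fun n => ∫ x, f x ∂(X n : Measure (Space d))) atTop (𝓝 a) := by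
    rintro f ⟨A, hf⟩
    refine cauchySeq_tendsto_of_complete (Metric.cauchySeq_iff.2 fun η hη => ?_)
    obtain ⟨N, hN⟩ := hunif A (η / 2) (by positivity)
    exact ⟨N, fun m hm n hn => (hN m hm n hn f hf).trans_lt (half_lt_self hη)⟩
  classical
  set I : (Space d → ℝ) → ℝ := fun f => if h : ∃ A, IsBL A f then (hconv f h).choose else 0
  have hIlim : ∀ (A : ℝ) (f : Space d → ℝ), IsBL A f →
      Tendsto (fun n => ∫ x, f x ∂(X n : Measure (Space d))) atTop (𝓝 (I f)) := fun A f hf => by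
    have h : ∃ A, IsBL A f := ⟨A, hf⟩
    simp only [I, dif_pos h]
    exact (hconv f h).choose_spec
  have hunifI : ∀ A η : ℝ, 0 < η → ∃ N, ∀ m ≥ N, ∀ f : Space d → ℝ, IsBL A f →
      |∫ x, f x ∂(X m : Measure (Space d)) - I f| ≤ η := by
    intro A η hη
    obtain ⟨N, hN⟩ := hunif A η hη
    refine ⟨N, fun m hm f hf => le_of_tendsto ((hIlim A f hf).const_sub _).abs ?_⟩
    filter_upwards [eventually_ge_atTop N] with n hn
    exact hN m hm n hn f hf
  have hIt : IsTightFunctional I := by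
    refine ⟨fun A B f g hf hg => ?_, fun c A f hf => ?_, fun A f hf hpos => ?_, ?_⟩
    · refine tendsto_nhds_unique (hIlim _ _ (hf.add hg)) (((hIlim A f hf).add
        (hIlim B g hg)).congr fun n => ?_)
      rw [integral_add (hf.integrable _) (hg.integrable _)]
    · refine tendsto_nhds_unique (hIlim _ _ (hf.const_mul c)) (((hIlim A f hf).const_mul c).congr
        fun n => ?_)
      rw [integral_const_mul]
    · exact ge_of_tendsto' (hIlim A f hf) fun n => integral_nonneg hpos
    · refine Metric.tendsto_atTop.2 fun η hη => ?_
      obtain ⟨N₁, hN₁⟩ := hunifI K' (η / 4) (by positivity)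
      obtain ⟨N₂, hN₂⟩ := hunifI |1| (η / 4) (by positivity)
      set N := max N₁ N₂
      obtain ⟨N₃, hN₃⟩ := Metric.tendsto_atTop.1 (tendsto_integral_cutoff (X N)) (η / 4)
        (by positivity)
      refine ⟨N₃, fun n hn => ?_⟩
      have b1 := abs_le.1 (hN₁ N (le_max_left _ _) _ (hcut n).1)
      have b2 := abs_le.1 (hN₂ N (le_max_right _ _) _ (isBL_const 1))
      have b3 := hN₃ n hn
      rw [Real.dist_eq, abs_lt] at *
      constructor <;> linarith [b1.1, b1.2, b2.1, b2.2, b3.1, b3.2]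
  obtain ⟨μ, hμ⟩ := hIt.exists_measure
  refine ⟨μ, fun A f hf => by rw [hμ A f hf]; exact hIlim A f hf, ?_⟩
  refine Metric.tendsto_atTop.2 fun η hη => ?_
  obtain ⟨N, hN⟩ := hunifI 1 (η / 2) (by positivity)
  refine ⟨N, fun n hn => ?_⟩
  rw [Real.dist_eq, sub_zero, abs_of_nonneg (dualDist_nonneg _ _)]
  refine lt_of_le_of_lt (dualDist_le (by positivity) fun f _ hf1 => ?_) (half_lt_self hη)
  rw [hμ 1 f hf1]
  exact hN n hn f hf1

/-! ### Euler schemes -/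

/-- The sequence `E` is an Euler scheme with step `h`. -/
def IsEuler (S : Set (FiniteMeasure (Space d)))
    (b : Space d → FiniteMeasure (Space d) → Space d)
    (ν : Space d → FiniteMeasure (Space d) → Measure (Space d)) (C h : ℝ)
    (E : ℕ → FiniteMeasure (Space d)) : Prop :=
  ∀ k, E k ∈ S ∧ ∀ (A : ℝ) (f : Space d → ℝ), IsBL A f → ∫ x, f x ∂(E (k + 1) : Measure (Space d))
    = ∫ x, eulerStep C h b ν (E k) f x ∂(E k : Measure (Space d))

section Euler

variable {S : Set (FiniteMeasure (Space d))} {b : Space d → FiniteMeasure (Space d) → Space d}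
  {ν : Space d → FiniteMeasure (Space d) → Measure (Space d)} {C : ℝ}
  (H : UniformBounds S b ν C)
include H

/-- The adjoint of the Euler step acts on measures and preserves the mass. -/
lemma UniformBounds.exists_eulerNext {h : ℝ} (hh : 0 < h) (hCh : 2 * C * h ≤ 1)
    {μ : FiniteMeasure (Space d)} (hμ : μ ∈ S) : ∃ η : FiniteMeasure (Space d), η.mass = μ.mass ∧
      ∀ (A : ℝ) (f : Space d → ℝ), IsBL A f → ∫ x, f x ∂(η : Measure (Space d))
        = ∫ x, eulerStep C h b ν μ f x ∂(μ : Measure (Space d)) := by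
  have hC := H.pos
  obtain ⟨K, hK, hcut⟩ := exists_cutoff_bounds d
  have hE := fun (A : ℝ) (f : Space d → ℝ) (hf : IsBL A f) => H.eulerStep_isBL hh hCh hμ hf
  have hI : IsTightFunctional fun f : Space d → ℝ =>
      ∫ x, eulerStep C h b ν μ f x ∂(μ : Measure (Space d)) := by
    refine ⟨fun A B f g hf hg => ?_, fun c A f hf => ?_, fun A f hf hpos => ?_, ?_⟩
    · rw [← integral_add ((hE A f hf).integrable _) ((hE B g hg).integrable _)]
      congr 1
      funext x
      exact frozenStep_add hC hh hCh (H.kernel μ hμ x) hf.continuous hf.bound hg.continuous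
        hg.bound x
    · rw [← integral_const_mul]
      congr 1
      funext x
      exact frozenStep_const_mul c f x
    · exact integral_nonneg fun x => frozenStep_nonneg hC hh hCh (H.kernel μ hμ x) hf.continuous
        hf.bound hpos x
    · refine H.tendsto_integral_eulerStep hh hCh hμ (fun n => (hcut n).1) tendsto_cutoff
  obtain ⟨η, hη⟩ := hI.exists_measure
  refine ⟨η, mass_eq_of_integral_one ?_, hη⟩
  rw [hη _ _ (isBL_const 1)]
  congr 1
  funext x
  simp [eulerStep, frozenStep]

lemma UniformBounds.exists_isEuler (hS : ∀ μ ∈ S, ∀ η, η.mass = μ.mass → η ∈ S) {h : ℝ}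
    (hh : 0 < h) (hCh : 2 * C * h ≤ 1) {μ : FiniteMeasure (Space d)} (hμ : μ ∈ S) :
    ∃ E : ℕ → FiniteMeasure (Space d), E 0 = μ ∧ (∀ k, (E k).mass = μ.mass) ∧
      IsEuler S b ν C h E := by
  choose next hmass hnext using fun η : S => H.exists_eulerNext hh hCh η.2
  let E : ℕ → S := fun k => (fun η => ⟨next η, hS η η.2 _ (hmass η)⟩ : S → S)^[k] ⟨μ, hμ⟩
  have hE : ∀ k, (E (k + 1) : FiniteMeasure (Space d)) = next (E k) := fun k => by
    simp only [E, Function.iterate_succ_apply']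
  refine ⟨fun k => E k, rfl, fun k => ?_, fun k => ⟨(E k).2, fun A f hf => ?_⟩⟩
  · induction k with
    | zero => rfl
    | succ k ih =>
      show (E (k + 1) : FiniteMeasure (Space d)).mass = _
      rw [hE, hmass, ih]
  · show ∫ x, f x ∂((E (k + 1) : FiniteMeasure (Space d)) : Measure (Space d)) = _
    rw [hE]
    exact hnext (E k) A f hf

lemma UniformBounds.abs_integral_euler_sub_le {h : ℝ} (hh : 0 < h) (hCh : 2 * C * h ≤ 1)
    {E : ℕ → FiniteMeasure (Space d)} (hE : IsEuler S b ν C h E) (k l : ℕ) {A : ℝ}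
    {f : Space d → ℝ} (hf : IsBL A f) :
    |∫ x, f x ∂(E (k + l) : Measure (Space d)) - ∫ x, f x ∂(E k : Measure (Space d))|
      ≤ l * h * (3 * C ^ 2 * A) := by
  have hC := H.pos
  have hA := hf.nonneg
  induction l with
  | zero => simp
  | succ l ih =>
    have hμ := (hE (k + l)).1
    have h1 : |∫ x, (eulerStep C h b ν (E (k + l)) f x - f x) ∂(E (k + l) : Measure (Space d))|
        ≤ h * (3 * C * A) * C :=
      (abs_integral_le_mul_mass (fun x => abs_frozenStep_sub_self_le hC hh (H.kernel _ hμ x)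
        (H.drift _ hμ x) hf x) _).trans
          (mul_le_mul_of_nonneg_left (H.mass_le _ hμ) (by positivity))
    rw [integral_sub ((H.eulerStep_isBL hh hCh hμ hf).integrable _) (hf.integrable _),
      ← (hE (k + l)).2 A f hf] at h1
    rw [← add_assoc]
    refine (abs_sub_le _ (∫ x, f x ∂(E (k + l) : Measure (Space d))) _).trans ?_
    push_cast
    linarith

lemma UniformBounds.exists_almostSolves_euler : ∃ c : ℝ, 0 ≤ c ∧ ∀ T ε : ℝ, 0 ≤ T → 0 < ε →
    ∃ h₀ : ℝ, 0 < h₀ ∧ ∀ h : ℝ, 0 < h → h ≤ h₀ → 2 * C * h ≤ 1 →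
      ∀ E : ℕ → FiniteMeasure (Space d), IsEuler S b ν C h E →
        AlmostSolves S b ν T c ε fun t => E ⌊t / h⌋₊ := by
  have hC := H.pos
  obtain ⟨L, hL, hrate⟩ := H.exists_rate_lip
  refine ⟨6 * L * C ^ 2, by positivity, fun T ε hT hε => ?_⟩
  obtain ⟨h₁, hh₁, hcons⟩ := H.exists_consistency (ε := ε / (3 * (T + 1) * C)) (by positivity)
  set ε' := ε / (3 * (T + 1) * C) with hε'
  refine ⟨min h₁ (min 1 (min (ε / (3 * (6 * L * C ^ 2 + 1))) (ε / (3 * (3 * C ^ 2))))),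
    by positivity, fun h hh hh0 hCh E hE => ⟨fun t _ => (hE _).1,
      fun s t hs hst htT A Λ f hf hfA hΛ hfΛ => ?_⟩⟩
  have hA := hfA.nonneg
  have g1 : h ≤ h₁ := hh0.trans (min_le_left _ _)
  have g2 : h ≤ 1 := hh0.trans ((min_le_right _ _).trans (min_le_left _ _))
  have g3 : h ≤ ε / (3 * (6 * L * C ^ 2 + 1)) :=
    hh0.trans ((min_le_right _ _).trans ((min_le_right _ _).trans (min_le_left _ _)))
  have g4 : h ≤ ε / (3 * (3 * C ^ 2)) :=
    hh0.trans ((min_le_right _ _).trans ((min_le_right _ _).trans (min_le_right _ _)))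
  rw [le_div_iff₀ (by positivity)] at g3 g4
  have hd := hf.contDiff.differentiable (by norm_num)
  have key : ∀ k l : ℕ, |∫ x, f x ∂(E (k + l) : Measure (Space d))
      - ∫ x, f x ∂(E k : Measure (Space d)) - l * h * rate b ν (E k) f|
        ≤ l * h * (ε' * C + 3 * L * C ^ 2 * (l * h)) * (A + Λ) := by
    intro k l
    induction l with
    | zero => simp
    | succ l ih =>
      have hμ := (hE (k + l)).1
      have gen := H.generator_isBL hμ hfA hd hΛ hfΛ
      have eE := H.eulerStep_isBL hh hCh hμ hfA
      have h1 : |∫ x, (eulerStep C h b ν (E (k + l)) f x - f x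
          - h * generator b ν (E (k + l)) f x) ∂(E (k + l) : Measure (Space d))|
          ≤ h * (ε' * (A + Λ)) * C :=
        (abs_integral_le_mul_mass (fun x => hcons h hh g1 _ hμ A Λ f hfA hd hΛ hfΛ x) _).trans
          (mul_le_mul_of_nonneg_left (H.mass_le _ hμ) (by positivity))
      have i1 : Integrable (fun x => eulerStep C h b ν (E (k + l)) f x - f x)
        (E (k + l) : Measure (Space d)) := (eE.integrable _).sub (hfA.integrable _)
      rw [integral_sub i1 ((gen.integrable _).const_mul h),
        integral_sub (eE.integrable _) (hfA.integrable _), integral_const_mul,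
        ← (hE (k + l)).2 A f hfA] at h1
      have h2 : |rate b ν (E (k + l)) f - rate b ν (E k) f|
          ≤ L * (A + Λ) * (l * (h * (3 * C ^ 2))) :=
        (hrate _ hμ _ (hE k).1 A Λ f hfA hd hΛ hfΛ).trans
          (mul_le_mul_of_nonneg_left (dualDist_le (by positivity) fun g _ hg => by
            have := H.abs_integral_euler_sub_le hh hCh hE k l hg
            linarith) (by positivity))
      have h2' := mul_le_mul_of_nonneg_left h2 hh.le
      rw [← abs_of_pos hh, ← abs_mul, abs_of_pos hh] at h2'
      have b1 := abs_le.1 ih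
      have b2 := abs_le.1 h1
      have b3 := abs_le.1 h2'
      have fin : l * h * (ε' * C + 3 * L * C ^ 2 * (l * h)) * (A + Λ) + h * (ε' * (A + Λ)) * C
          + h * (L * (A + Λ) * (l * (h * (3 * C ^ 2))))
          ≤ (l + 1 : ℕ) * h * (ε' * C + 3 * L * C ^ 2 * ((l + 1 : ℕ) * h)) * (A + Λ) := by
        have : 0 ≤ L * C ^ 2 * (A + Λ) * h * h * (l + 1) := by positivity
        push_cast
        nlinarith
      simp only [rate] at *
      refine le_trans ?_ fin
      rw [← add_assoc, abs_le]
      push_cast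
      constructor <;> linarith only [b1.1, b1.2, b2.1, b2.2, b3.1, b3.2]
  -- comparison of the times `s`, `t` with the grid
  obtain ⟨l, hl⟩ : ∃ l, ⌊t / h⌋₊ = ⌊s / h⌋₊ + l :=
    Nat.exists_eq_add_of_le (Nat.floor_le_floor (by gcongr))
  have f1 := Nat.floor_le (by positivity : 0 ≤ s / h)
  have f2 := Nat.lt_floor_add_one (s / h)
  have f3 := Nat.floor_le (div_nonneg (hs.trans hst) hh.le)
  have f4 := Nat.lt_floor_add_one (t / h)
  rw [hl] at f3 f4
  rw [le_div_iff₀ hh] at f1 f3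
  rw [div_lt_iff₀ hh] at f2 f4
  push_cast at f3 f4
  have hk := key ⌊s / h⌋₊ l
  have hr := H.abs_rate_le (hE ⌊s / h⌋₊).1 hfA
  simp only [hl]
  set y : ℝ := l * h with hy
  have hy0 : 0 ≤ y := by positivity
  have hyu : y ≤ t - s + h := by rw [hy]; linarith
  have hyl : t - s - h ≤ y := by rw [hy]; linarith
  set σ := rate b ν (E ⌊s / h⌋₊) f
  have hyσ : |(y - (t - s)) * σ| ≤ h * (3 * C ^ 2 * A) := by
    rw [abs_mul]
    exact mul_le_mul (by rw [abs_le]; constructor <;> linarith) hr (abs_nonneg _) hh.le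
  have hy2 : y ^ 2 ≤ 2 * (t - s) ^ 2 + 2 * h ^ 2 := by
    have : y ^ 2 ≤ (t - s + h) ^ 2 := by gcongr
    nlinarith [sq_nonneg (t - s - h)]
  have hyT : y ≤ T + 1 := by linarith
  have tot : y * (ε' * C + 3 * L * C ^ 2 * y) * (A + Λ) + h * (3 * C ^ 2 * A)
      ≤ (6 * L * C ^ 2 * (t - s) ^ 2 + ε) * (A + Λ) := by
    have t1 : y * (ε' * C) ≤ ε / 3 := by
      have : ε / 3 = (T + 1) * (ε' * C) := by rw [hε']; field_simp
      rw [this]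
      gcongr
    have t2 : 3 * L * C ^ 2 * y ^ 2 ≤ 6 * L * C ^ 2 * (t - s) ^ 2 + ε / 3 := by
      have e1 := mul_le_mul_of_nonneg_left hy2 (by positivity : 0 ≤ 3 * L * C ^ 2)
      have e2 : h ^ 2 ≤ h := by nlinarith
      have e3 := mul_le_mul_of_nonneg_left e2 (by positivity : 0 ≤ 6 * L * C ^ 2)
      linarith
    have t3 : h * (3 * C ^ 2 * A) ≤ ε / 3 * (A + Λ) := by
      have : h * (3 * C ^ 2) ≤ ε / 3 := by linarith
      have e1 := mul_le_mul_of_nonneg_right this hA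
      have e2 : 0 ≤ ε / 3 * Λ := by positivity
      linarith
    have t4 := mul_le_mul_of_nonneg_right (add_le_add t1 t2) (by positivity : 0 ≤ A + Λ)
    linarith
  refine le_trans ?_ tot
  have b1 := abs_le.1 hk
  have b2 := abs_le.1 hyσ
  rw [abs_le]
  constructor <;> linarith only [b1.1, b1.2, b2.1, b2.2]

/-- Existence: the Euler schemes converge, by stability, to a curve that has the first-order
expansion with no defect. -/
theorem UniformBounds.exists_limit (hS : ∀ μ ∈ S, ∀ η, η.mass = μ.mass → η ∈ S)
    {μ : FiniteMeasure (Space d)} (hμ : μ ∈ S) : ∃ (c : ℝ) (m : ℝ → FiniteMeasure (Space d)),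
      0 ≤ c ∧ m 0 = μ ∧ (∀ t, 0 ≤ t → (m t).mass = μ.mass) ∧
        (∀ T, 0 ≤ T → AlmostSolves S b ν T c 0 m) ∧
        ∀ s t, 0 ≤ s → s ≤ t → dualDist (m t) (m s) ≤ (t - s) * (3 * C ^ 2) := by
  have hC := H.pos
  obtain ⟨c, hc, heuler⟩ := H.exists_almostSolves_euler
  obtain ⟨L, hL, hrate⟩ := H.exists_rate_lip
  set h : ℕ → ℝ := fun n => 1 / (2 * C) * (1 / ((n : ℝ) + 1)) with hh
  have hh0 : ∀ n, 0 < h n := fun n => by positivity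
  have hCh : ∀ n, 2 * C * h n ≤ 1 := fun n => by
    have : 2 * C * h n = 1 / ((n : ℝ) + 1) := by rw [hh]; field_simp
    rw [this]
    exact (div_le_one (by positivity)).2 (by simp)
  have hhlim : Tendsto h atTop (𝓝 0) := by
    have := tendsto_one_div_add_atTop_nhds_zero_nat.const_mul (1 / (2 * C))
    rwa [mul_zero] at this
  choose E hE0 hEm hE using fun n => H.exists_isEuler hS (hh0 n) (hCh n) hμ
  set X : ℕ → ℝ → FiniteMeasure (Space d) := fun n t => E n ⌊t / h n⌋₊ with hX
  have hX0 : ∀ n, X n 0 = μ := fun n => by simp [hX, hE0]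
  have hXa : ∀ T ε : ℝ, 0 ≤ T → 0 < ε → ∃ N, ∀ n ≥ N, AlmostSolves S b ν T c ε (X n) := by
    intro T ε hT hε
    obtain ⟨h₀, hh₀, hal⟩ := heuler T ε hT hε
    obtain ⟨N, hN⟩ := eventually_atTop.1 (hhlim.eventually_le_const hh₀)
    exact ⟨N, fun n hn => hal (h n) (hh0 n) (hN n hn) (hCh n) (E n) (hE n)⟩
  have hcau : ∀ t, 0 ≤ t → ∀ η : ℝ, 0 < η → ∃ N, ∀ m ≥ N, ∀ n ≥ N,
      dualDist (X m t) (X n t) ≤ η := by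
    intro t ht η hη
    obtain ⟨L, -, hstab⟩ := H.stability ht
    obtain ⟨ε, hε, hst⟩ := hstab t ⟨ht, le_rfl⟩ c hc η hη
    obtain ⟨N, hN⟩ := hXa t ε ht hε
    refine ⟨N, fun m hm n hn => ?_⟩
    have := hst (X m) (X n) (hN m hm) (hN n hn)
    rwa [hX0, hX0, dualDist_self, mul_zero, zero_add] at this
  choose m hmf hmd using fun t : Ici (0 : ℝ) => exists_cauchy_limit (hcau t t.2)
  have hmass : ∀ t, (m t).mass = μ.mass := fun t => by
    refine mass_eq_of_integral_one (tendsto_nhds_unique (hmf t _ _ (isBL_const 1))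
      (tendsto_const_nhds.congr fun n => ?_))
    have : (X n t).mass = μ.mass := hEm n _
    have := congrArg NNReal.toReal this
    simp only [integral_const, smul_eq_mul, mul_one]
    exact this.symm
  set M : ℝ → FiniteMeasure (Space d) := fun t => m ⟨max t 0, mem_Ici.2 (le_max_right _ _)⟩ with hM
  have hMt : ∀ t (ht : 0 ≤ t), M t = m ⟨t, ht⟩ := fun t ht => by simp only [hM, max_eq_left ht]
  refine ⟨c, M, hc, ?_, fun t ht => by rw [hMt t ht, hmass],
    fun T hT => ⟨fun t ht => ?_, ?_⟩, fun s t hs hst => ?_⟩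
  · rw [hMt 0 le_rfl]
    refine (eq_of_dualDist_eq_zero (tendsto_nhds_unique ?_ (hmd ⟨0, mem_Ici.2 le_rfl⟩))).symm
    exact tendsto_const_nhds.congr fun n => by rw [hX0]
  · exact hS μ hμ _ (by rw [hMt t ht.1, hmass])
  · intro s t hs hst htT A Λ f hf hfA hΛ hfΛ
    have hd := hf.contDiff.differentiable (by norm_num)
    have ht := hs.trans hst
    rw [hMt s hs, hMt t ht]
    have hms : m ⟨s, hs⟩ ∈ S := hS μ hμ _ (hmass _)
    have hr : Tendsto (fun n => rate b ν (X n s) f) atTop (𝓝 (rate b ν (m ⟨s, hs⟩) f)) := by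
      refine tendsto_iff_norm_sub_tendsto_zero.2 (squeeze_zero (fun _ => norm_nonneg _)
        (fun n => hrate _ ((hE n _).1) _ hms A Λ f hfA hd hΛ hfΛ) ?_)
      simpa using (hmd ⟨s, hs⟩).const_mul (L * (A + Λ))
    have hl := (((hmf ⟨t, ht⟩ A f hfA).sub (hmf ⟨s, hs⟩ A f hfA)).sub (hr.const_mul (t - s))).abs
    have hA := hfA.nonneg
    refine le_of_forall_pos_le_add fun η hη => le_of_tendsto hl ?_
    obtain ⟨N, hN⟩ := hXa T (η / (A + Λ + 1)) hT (by positivity)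
    filter_upwards [eventually_ge_atTop N] with n hn
    refine ((hN n hn).estimate s t hs hst htT A Λ f hf hfA hΛ hfΛ).trans ?_
    have : η / (A + Λ + 1) * (A + Λ) ≤ η := by
      rw [div_mul_eq_mul_div, div_le_iff₀ (by positivity)]
      nlinarith
    linarith
  · rw [hMt s hs, hMt t (hs.trans hst)]
    refine dualDist_le (mul_nonneg (sub_nonneg.2 hst) (by positivity)) fun f _ hf => ?_
    have hl : Tendsto (fun n => (t - s + h n) * (3 * C ^ 2)) atTop (𝓝 ((t - s) * (3 * C ^ 2))) := by
      simpa using (hhlim.const_add (t - s)).mul_const (3 * C ^ 2)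
    refine le_of_tendsto_of_tendsto'
      ((hmf ⟨t, hs.trans hst⟩ 1 f hf).sub (hmf ⟨s, hs⟩ 1 f hf)).abs hl fun n => ?_
    have hn := hh0 n
    obtain ⟨l, hl⟩ : ∃ l, ⌊t / h n⌋₊ = ⌊s / h n⌋₊ + l :=
      Nat.exists_eq_add_of_le (Nat.floor_le_floor (by gcongr))
    have f2 := Nat.lt_floor_add_one (s / h n)
    have f3 := Nat.floor_le (div_nonneg (hs.trans hst) hn.le)
    rw [hl, le_div_iff₀ hn] at f3
    rw [div_lt_iff₀ hn] at f2
    push_cast at f3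
    have := H.abs_integral_euler_sub_le hn (hCh n) (hE n) ⌊s / h n⌋₊ l hf
    simp only [hX, hl]
    refine this.trans ?_
    rw [mul_one]
    gcongr
    linarith

end Euler

/-! ### From first-order expansions to solutions -/

section Solutions

variable {S : Set (FiniteMeasure (Space d))} {b : Space d → FiniteMeasure (Space d) → Space d}
  {ν : Space d → FiniteMeasure (Space d) → Measure (Space d)} {C : ℝ}
  (H : UniformBounds S b ν C)
include H

lemma UniformBounds.generator_sub {μ : FiniteMeasure (Space d)} (hμ : μ ∈ S) {f g : Space d → ℝ}
    (hf : IsC1Infty f) (hg : IsC1Infty g) (x : Space d) :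
    generator b ν μ (fun x => f x - g x) x = generator b ν μ f x - generator b ν μ g x := by
  have h1 : fderiv ℝ (fun x => f x - g x) x = fderiv ℝ f x - fderiv ℝ g x :=
    fderiv_fun_sub (hf.contDiff.differentiable (by norm_num) x)
      (hg.contDiff.differentiable (by norm_num) x)
  have h2 := integral_sub (H.integrable_jump hμ hf.isBL x x) (H.integrable_jump hμ hg.isBL x x)
  simp only [generator, h1, _root_.sub_apply]
  rw [add_sub_add_comm, ← h2]
  congr 2
  funext y
  ring

/-- For `f` merely of class `C¹_∞` the function `A_μ f` is still continuous, being a uniform limit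
of the functions `A_μ g` with smooth `g`. -/
lemma UniformBounds.integrable_generator {μ : FiniteMeasure (Space d)} (hμ : μ ∈ S)
    {f : Space d → ℝ} (hf : IsC1Infty f) (η : FiniteMeasure (Space d)) :
    Integrable (generator b ν μ f) (η : Measure (Space d)) := by
  have hC := H.pos
  refine integrable_of_abs_le _ ?_
    (H.abs_generator_le hμ hf.isBL)
  choose g hg hgs hfg using fun n : ℕ =>
    hf.exists_smooth_approx (η := 1 / ((n : ℝ) + 1)) (by positivity)
  have hlim : TendstoUniformly (fun n => generator b ν μ (g n)) (generator b ν μ f) atTop := by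
    refine Metric.tendstoUniformly_iff.2 fun ε hε => ?_
    have := tendsto_one_div_add_atTop_nhds_zero_nat (𝕜 := ℝ).const_mul (3 * C)
    rw [mul_zero] at this
    filter_upwards [this.eventually_lt_const hε] with n hn x
    rw [Real.dist_eq, ← H.generator_sub hμ hf (hg n)]
    exact (H.abs_generator_le hμ (hfg n) x).trans_lt hn
  refine hlim.continuous (Eventually.of_forall fun n => ?_).frequently
  obtain ⟨A, Λ, hΛ, hA, hL⟩ := hgs n
  exact (H.generator_isBL hμ hA ((hg n).contDiff.differentiable (by norm_num)) hΛ hL).continuous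

lemma UniformBounds.abs_rate_sub_le {μ : FiniteMeasure (Space d)} (hμ : μ ∈ S) {f g : Space d → ℝ}
    (hf : IsC1Infty f) (hg : IsC1Infty g) {A : ℝ} (hfg : IsBL A fun x => f x - g x) :
    |rate b ν μ f - rate b ν μ g| ≤ 3 * C ^ 2 * A := by
  have : rate b ν μ f - rate b ν μ g = rate b ν μ fun x => f x - g x := by
    simp only [rate, H.generator_sub hμ hf hg]
    exact (integral_sub (H.integrable_generator hμ hf μ) (H.integrable_generator hμ hg μ)).symm
  rw [this]
  exact H.abs_rate_le hμ hfg

/-- A curve that is Lipschitz continuous in time and has the first-order expansion with smooth test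
functions solves the weak equation, with all test functions of class `C¹_∞`. -/
lemma UniformBounds.hasDerivWithinAt_of_almostSolves {c B : ℝ} (hc : 0 ≤ c) (hB : 0 ≤ B)
    {m : ℝ → FiniteMeasure (Space d)} (hm : ∀ T, 0 ≤ T → AlmostSolves S b ν T c 0 m)
    (hlip : ∀ s t, 0 ≤ s → s ≤ t → dualDist (m t) (m s) ≤ (t - s) * B)
    {f : Space d → ℝ} (hf : IsC1Infty f) {t : ℝ} (ht : 0 ≤ t) :
    HasDerivWithinAt (fun s => ∫ x, f x ∂(m s : Measure (Space d))) (rate b ν (m t) f)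
      (Ici 0) t := by
  obtain ⟨K, hK, hdual⟩ := exists_dualDist_bound d
  obtain ⟨L, hL, hrate⟩ := H.exists_rate_lip
  have hC := H.pos
  have hS : ∀ s, 0 ≤ s → m s ∈ S := fun s hs => (hm s hs).mem s ⟨hs, le_rfl⟩
  rw [hasDerivWithinAt_iff_isLittleO, Asymptotics.isLittleO_iff]
  intro ε hε
  -- replacing `f` by a smooth `g` costs at most `ε / 2` times `|s - t|`, since both sides of the
  -- equation are controlled by the `C¹`-norm of `f - g`
  set η := ε / (2 * (K * B + 3 * C ^ 2)) with hη
  obtain ⟨g, hg, ⟨A, Λ, hΛ, hA, hgΛ⟩, hfg⟩ :=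
    hf.exists_smooth_approx (η := η) (by positivity)
  have hA0 := hA.nonneg
  have hη0 := hfg.nonneg
  have hd := hg.contDiff.differentiable (by norm_num)
  set Q := (c + L * B) * (A + Λ) with hQ
  have hQ0 : 0 ≤ Q := by positivity
  have hball : ∀ᶠ s in 𝓝[Ici 0] t, |s - t| < ε / (2 * (Q + 1)) := by
    have hQ1 : 0 < ε / (2 * (Q + 1)) := by positivity
    filter_upwards [mem_nhdsWithin_of_mem_nhds (Metric.ball_mem_nhds t hQ1)] with s hs
    rwa [Metric.mem_ball, Real.dist_eq] at hs
  filter_upwards [self_mem_nhdsWithin, hball] with s hs hst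
  rw [mem_Ici] at hs
  rw [Real.norm_eq_abs, Real.norm_eq_abs, smul_eq_mul]
  have hdist : ∀ u v, 0 ≤ u → u ≤ v →
      |∫ x, (f x - g x) ∂(m v : Measure (Space d)) - ∫ x, (f x - g x) ∂(m u : Measure (Space d))|
        ≤ K * η * ((v - u) * B) := fun u v hu huv =>
    (hdual _ _ hfg _ _).trans (mul_le_mul_of_nonneg_left (hlip u v hu huv) (by positivity))
  have hsub : ∀ u, ∫ x, (f x - g x) ∂(m u : Measure (Space d))
      = ∫ x, f x ∂(m u : Measure (Space d)) - ∫ x, g x ∂(m u : Measure (Space d)) := fun u =>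
    integral_sub (hf.isBL.integrable _) (hA.integrable _)
  simp only [hsub] at hdist
  have r1 := H.abs_rate_sub_le (hS t ht) hf hg hfg
  have r2 : |(s - t) * (rate b ν (m t) f - rate b ν (m t) g)| ≤ |s - t| * (3 * C ^ 2 * η) := by
    rw [abs_mul]
    gcongr
  have hfin : Q * |s - t| ^ 2 + K * η * (|s - t| * B) + |s - t| * (3 * C ^ 2 * η)
      ≤ ε * |s - t| := by
    have e1 : η * (K * B + 3 * C ^ 2) = ε / 2 := by rw [hη]; field_simp
    have e2 : |s - t| * (Q + 1) ≤ ε / 2 := by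
      rw [lt_div_iff₀ (by positivity)] at hst
      linarith
    have e3 : |s - t| * Q ≤ ε / 2 := by
      nlinarith [abs_nonneg (s - t)]
    nlinarith [abs_nonneg (s - t)]
  have main : |∫ x, g x ∂(m s : Measure (Space d)) - ∫ x, g x ∂(m t : Measure (Space d))
      - (s - t) * rate b ν (m t) g| ≤ Q * |s - t| ^ 2 ∧
      |∫ x, f x ∂(m s : Measure (Space d)) - ∫ x, g x ∂(m s : Measure (Space d))
        - (∫ x, f x ∂(m t : Measure (Space d)) - ∫ x, g x ∂(m t : Measure (Space d)))|
        ≤ K * η * (|s - t| * B) := by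
    rcases le_total t s with h | h
    · rw [abs_of_nonneg (sub_nonneg.2 h)]
      refine ⟨?_, hdist t s ht h⟩
      refine ((hm s hs).estimate t s ht h le_rfl A Λ g hg hA hΛ hgΛ).trans ?_
      have : 0 ≤ L * B * (s - t) ^ 2 * (A + Λ) := by positivity
      rw [hQ]
      linarith
    -- for `s < t` the expansion is centred at `s`, and the right-hand side is moved from `s` to `t`
    · rw [abs_sub_comm s t, abs_of_nonneg (sub_nonneg.2 h)]
      constructor
      · have h1 := (hm t ht).estimate s t hs h le_rfl A Λ g hg hA hΛ hgΛ
        have h2 : |(t - s) * (rate b ν (m t) g - rate b ν (m s) g)|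
            ≤ (t - s) * (L * (A + Λ) * ((t - s) * B)) := by
          rw [abs_mul, abs_of_nonneg (sub_nonneg.2 h)]
          refine mul_le_mul_of_nonneg_left ?_ (sub_nonneg.2 h)
          exact (hrate _ (hS t ht) _ (hS s hs) A Λ g hA hd hΛ hgΛ).trans
            (mul_le_mul_of_nonneg_left (hlip s t hs h) (by positivity))
        have b1 := abs_le.1 h1
        have b2 := abs_le.1 h2
        rw [hQ, abs_le]
        constructor <;> linarith
      · rw [abs_sub_comm]
        exact hdist s t hs h
  have b1 := abs_le.1 main.1
  have b2 := abs_le.1 main.2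
  have b3 := abs_le.1 r2
  refine le_trans ?_ hfin
  rw [abs_le]
  constructor <;> linarith

/-! ### Solutions satisfy the first-order expansion -/

lemma UniformBounds.dualDist_solution_le {r : ℝ} {μ : FiniteMeasure (Space d)}
    {m : ℝ → FiniteMeasure (Space d)} (hm : IsWeakSolution S b ν (Icc 0 r) μ m) {s t : ℝ}
    (hs : s ∈ Icc 0 r) (ht : t ∈ Icc 0 r) : dualDist (m t) (m s) ≤ 3 * C ^ 2 * |t - s| := by
  have hC := H.pos
  refine dualDist_le (by positivity) fun f hf hfA => ?_
  have := (convex_Icc 0 r).norm_image_sub_le_of_norm_hasDerivWithin_le (hm.hasDeriv f hf)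
    (C := 3 * C ^ 2) (fun u hu => by
      rw [← mul_one (3 * C ^ 2)]
      exact H.abs_rate_le (hm.mem u hu) hfA) hs ht
  simpa only [Real.norm_eq_abs] using this

lemma UniformBounds.exists_almostSolves_solution : ∃ c : ℝ, 0 ≤ c ∧
    ∀ (r : ℝ) (μ : FiniteMeasure (Space d)) (m : ℝ → FiniteMeasure (Space d)),
      IsWeakSolution S b ν (Icc 0 r) μ m → AlmostSolves S b ν r c 0 m := by
  obtain ⟨L, hL, hrate⟩ := H.exists_rate_lip
  have hC := H.pos
  refine ⟨L * (3 * C ^ 2), by positivity, fun r μ m hm => ⟨hm.mem, ?_⟩⟩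
  intro s t hs hst htr A Λ f hf hfA hΛ hfΛ
  have hA := hfA.nonneg
  have hsub : Icc s t ⊆ Icc 0 r := Icc_subset_Icc hs htr
  have hder : ∀ u ∈ Icc s t, HasDerivWithinAt
      (fun u => ∫ x, f x ∂(m u : Measure (Space d)) - u * rate b ν (m s) f)
      (rate b ν (m u) f - 1 * rate b ν (m s) f) (Icc s t) u := fun u hu =>
    ((hm.hasDeriv f hf u (hsub hu)).mono hsub).sub
      ((hasDerivWithinAt_id u _).mul_const _)
  have hbd : ∀ u ∈ Icc s t, ‖rate b ν (m u) f - 1 * rate b ν (m s) f‖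
      ≤ L * (A + Λ) * (3 * C ^ 2 * (t - s)) := fun u hu => by
    rw [one_mul, Real.norm_eq_abs]
    refine (hrate _ (hm.mem u (hsub hu)) _ (hm.mem s ⟨hs, hst.trans htr⟩) A Λ f hfA
      (hf.contDiff.differentiable (by norm_num)) hΛ hfΛ).trans
        (mul_le_mul_of_nonneg_left ?_ (by positivity))
    refine (H.dualDist_solution_le hm ⟨hs, hst.trans htr⟩ (hsub hu)).trans ?_
    rw [abs_of_nonneg (sub_nonneg.2 hu.1)]
    have := hu.2
    gcongr
  have := (convex_Icc s t).norm_image_sub_le_of_norm_hasDerivWithin_le hder hbd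
    ⟨le_rfl, hst⟩ ⟨hst, le_rfl⟩
  rw [Real.norm_eq_abs, Real.norm_eq_abs, abs_of_nonneg (sub_nonneg.2 hst)] at this
  calc _ = |∫ x, f x ∂(m t : Measure (Space d)) - t * rate b ν (m s) f
        - (∫ x, f x ∂(m s : Measure (Space d)) - s * rate b ν (m s) f)| := by congr 1; ring
    _ ≤ _ := this
    _ = _ := by ring

omit H in
lemma IsWeakSolution.restrict {J J' : Set ℝ} {S' : Set (FiniteMeasure (Space d))}
    {μ : FiniteMeasure (Space d)} {m : ℝ → FiniteMeasure (Space d)}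
    (hm : IsWeakSolution S b ν J μ m) (hJ : J' ⊆ J) (hS' : ∀ t ∈ J', m t ∈ S') :
    IsWeakSolution S' b ν J' μ m :=
  ⟨hS', hm.init, fun f hf t ht => (hm.hasDeriv f hf t (hJ ht)).mono hJ⟩

/-- Solutions depend Lipschitz continuously on the initial data. -/
lemma UniformBounds.dualDist_solutions_le {r : ℝ} (hr : 0 ≤ r) : ∃ L : ℝ, 0 ≤ L ∧
    ∀ (μ η : FiniteMeasure (Space d)) (m p : ℝ → FiniteMeasure (Space d)),
      IsWeakSolution S b ν (Icc 0 r) μ m → IsWeakSolution S b ν (Icc 0 r) η p →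
        ∀ t ∈ Icc 0 r, dualDist (m t) (p t) ≤ L * dualDist μ η := by
  obtain ⟨L, hL, hstab⟩ := H.stability hr
  obtain ⟨c, hc, hsol⟩ := H.exists_almostSolves_solution
  refine ⟨L, hL, fun μ η m p hm hp t ht => le_of_forall_pos_le_add fun ε hε => ?_⟩
  obtain ⟨δ, hδ, hst⟩ := hstab t ht c hc ε hε
  have hJ : Icc 0 t ⊆ Icc 0 r := Icc_subset_Icc le_rfl ht.2
  have weaken : ∀ q : ℝ → FiniteMeasure (Space d), AlmostSolves S b ν t c 0 q →
      AlmostSolves S b ν t c δ q := fun q hq => by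
    refine ⟨hq.mem, fun s u hs hsu hut A Λ f hf hfA hΛ hfΛ =>
      (hq.estimate s u hs hsu hut A Λ f hf hfA hΛ hfΛ).trans ?_⟩
    have := hfA.nonneg
    gcongr
  have := hst m p
    (weaken m (hsol t μ m (hm.restrict hJ fun u hu => hm.mem u (hJ hu))))
    (weaken p (hsol t η p (hp.restrict hJ fun u hu => hp.mem u (hJ hu))))
  rwa [hm.init, hp.init] at this

lemma UniformBounds.eq_of_isWeakSolution {r : ℝ} {μ : FiniteMeasure (Space d)}
    {m p : ℝ → FiniteMeasure (Space d)} (hm : IsWeakSolution S b ν (Icc 0 r) μ m)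
    (hp : IsWeakSolution S b ν (Icc 0 r) μ p) {t : ℝ} (ht : t ∈ Icc 0 r) : m t = p t := by
  obtain ⟨L, -, h⟩ := H.dualDist_solutions_le (ht.1.trans ht.2)
  have := h μ μ m p hm hp t ht
  rw [dualDist_self, mul_zero] at this
  exact eq_of_dualDist_eq_zero (le_antisymm this (dualDist_nonneg _ _))

lemma UniformBounds.exists_isWeakSolution (hS : ∀ μ ∈ S, ∀ η, η.mass = μ.mass → η ∈ S)
    {μ : FiniteMeasure (Space d)} (hμ : μ ∈ S) : ∃ m : ℝ → FiniteMeasure (Space d),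
      IsWeakSolution S b ν (Ici 0) μ m ∧ ∀ t, 0 ≤ t → (m t).mass = μ.mass := by
  obtain ⟨c, m, hc, h0, hmass, hm, hlip⟩ := H.exists_limit hS hμ
  exact ⟨m, ⟨fun t ht => (hm t ht).mem t ⟨ht, le_rfl⟩, h0, fun f hf t ht =>
    H.hasDerivWithinAt_of_almostSolves hc (by positivity) hm hlip hf ht⟩, hmass⟩

end Solutions

/-! ### Solutions have bounded mass -/

lemma isC1Infty_tsum_cutoff (k : ℕ → ℕ) :
    IsC1Infty (fun x : Space d => ∑' n, (1 / 2 : ℝ) ^ n * cutoff (k n) x) ∧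
      ∀ x : Space d, Summable fun n => (1 / 2 : ℝ) ^ n * cutoff (k n) x := by
  obtain ⟨K, hK, hcut⟩ := exists_cutoff_bounds d
  have hu : Summable fun n : ℕ => K * (1 / 2 : ℝ) ^ n := summable_geometric_two.mul_left K
  have hsm : ∀ n, IsC1Infty fun x : Space d => (1 / 2 : ℝ) ^ n * cutoff (k n) x := fun n =>
    (cutoff_isC1Infty _).const_mul _
  have hbl : ∀ n, IsBL (K * (1 / 2 : ℝ) ^ n) fun x : Space d =>
      (1 / 2 : ℝ) ^ n * cutoff (k n) x := fun n => by
    have := (hcut (k n)).1.const_mul ((1 / 2 : ℝ) ^ n)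
    rwa [abs_of_pos (by positivity), mul_comm] at this
  have hsum : ∀ x : Space d, Summable fun n => (1 / 2 : ℝ) ^ n * cutoff (k n) x := fun x =>
    hu.of_norm_bounded fun n => (hbl n).bound x
  have hfd : fderiv ℝ (fun x : Space d => ∑' n, (1 / 2 : ℝ) ^ n * cutoff (k n) x)
      = fun x => ∑' n, fderiv ℝ (fun x : Space d => (1 / 2 : ℝ) ^ n * cutoff (k n) x) x :=
    fderiv_tsum hu (fun n => (hsm n).contDiff.differentiable (by norm_num))
      (fun n => (hbl n).norm_fderiv_le) (hsum 0)
  refine ⟨⟨?_, ?_, ?_⟩, hsum⟩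
  · refine contDiff_one_iff_fderiv.2 ⟨fun x => (hasFDerivAt_tsum hu
      (fun n x => ((hsm n).contDiff.differentiable (by norm_num) x).hasFDerivAt)
        (fun n => (hbl n).norm_fderiv_le) (hsum 0) x).differentiableAt, ?_⟩
    rw [hfd]
    exact continuous_tsum (fun n => (hsm n).contDiff.continuous_fderiv (by norm_num)) hu
      fun n x => (hbl n).norm_fderiv_le x
  · have := tendsto_tsum_of_dominated_convergence hu (fun n => (hsm n).vanish)
      (Eventually.of_forall fun x n => (hbl n).bound x)
    simpa using this
  · rw [hfd]
    have := tendsto_tsum_of_dominated_convergence hu (fun n => (hsm n).vanish_deriv)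
      (Eventually.of_forall fun x n => (hbl n).norm_fderiv_le x)
    simpa using this

/-- A curve of measures that is continuous in time against all test functions of class `C¹_∞` has
bounded mass on compact time intervals. Otherwise a suitable weighted sum of cutoff functions would
have unbounded integrals. -/
lemma exists_mass_le {r : ℝ} {m : ℝ → FiniteMeasure (Space d)}
    (hm : ∀ f : Space d → ℝ, IsC1Infty f →
      ContinuousOn (fun t => ∫ x, f x ∂(m t : Measure (Space d))) (Icc 0 r)) :
    ∃ R : ℝ≥0, ∀ t ∈ Icc 0 r, (m t).mass ≤ R := by
  by_contra! hcon
  choose t ht hmass using fun n : ℕ => hcon (4 ^ n)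
  have hk : ∀ n, ∃ k : ℕ, (4 : ℝ) ^ n < ∫ x, cutoff k x ∂(m (t n) : Measure (Space d)) := by
    intro n
    refine ((tendsto_integral_cutoff (m (t n))).eventually_const_lt ?_).exists
    simp only [integral_const, smul_eq_mul, mul_one]
    exact_mod_cast NNReal.coe_lt_coe.2 (hmass n)
  choose k hk using hk
  obtain ⟨hf, hsum⟩ := isC1Infty_tsum_cutoff (d := d) k
  obtain ⟨B, hB⟩ := (isCompact_Icc.image_of_continuousOn (hm _ hf)).isBounded.exists_norm_le
  obtain ⟨n, hn⟩ := pow_unbounded_of_one_lt B (one_lt_two (α := ℝ))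
  refine absurd (hB _ ⟨t n, ht n, rfl⟩) (not_le.2 (hn.trans_le ?_))
  refine le_trans ?_ (Real.le_norm_self _)
  calc (2 : ℝ) ^ n = (1 / 2) ^ n * 4 ^ n := by rw [← mul_pow]; norm_num
    _ ≤ (1 / 2) ^ n * ∫ x, cutoff (k n) x ∂(m (t n) : Measure (Space d)) := by
      gcongr
      exact (hk n).le
    _ = ∫ x, (1 / 2) ^ n * cutoff (k n) x ∂(m (t n) : Measure (Space d)) :=
      (integral_const_mul _ _).symm
    _ ≤ _ := by
      refine integral_mono (((cutoff_isC1Infty _).isBL.integrable _).const_mul _)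
        (hf.isBL.integrable _) fun x => ?_
      exact (hsum x).le_tsum n fun j _ => mul_nonneg (by positivity) (cutoff_nonneg _ _)

/-! ### Well-posedness -/

/-- The class `S` enters only through the fact that membership is a condition on the total mass, so
that Euler schemes and their limits stay in `S`. -/
theorem Assumptions.wellPosed {S : Set (FiniteMeasure (Space d))}
    {b : Space d → FiniteMeasure (Space d) → Space d}
    {ν : Space d → FiniteMeasure (Space d) → Measure (Space d)}
    {gν : Space d → FiniteMeasure (Space d) → SignedVectorMeasure d}
    (h : Assumptions S b ν gν) (hS : ∀ μ ∈ S, ∀ η, η.mass = μ.mass → η ∈ S) :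
    WellPosed S b ν := by
  have hex : ∀ μ, ∃ m : ℝ → FiniteMeasure (Space d), μ ∈ S →
      IsWeakSolution S b ν (Ici 0) μ m ∧ ∀ t, 0 ≤ t → (m t).mass = μ.mass := fun μ => by
    by_cases hμ : μ ∈ S
    · obtain ⟨C, H⟩ := h.exists_uniformBounds μ.mass
      obtain ⟨m, hm, hmass⟩ := H.exists_isWeakSolution
        (fun η hη ζ hζ => ⟨hS η hη.1 ζ hζ, hζ.le.trans hη.2⟩) ⟨hμ, le_rfl⟩
      exact ⟨m, fun _ => ⟨hm.restrict subset_rfl fun t ht => (hm.mem t ht).1, hmass⟩⟩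
    · exact ⟨fun _ => μ, fun h => absurd h hμ⟩
  choose T hT using hex
  -- on bounded time intervals a solution takes its values in a set with uniform bounds
  have hbdd : ∀ (R : ℝ≥0) (r : ℝ) (μ : FiniteMeasure (Space d)), μ ∈ S → μ.mass ≤ R →
      IsWeakSolution (massLE S R) b ν (Icc 0 r) μ (T μ) := fun R r μ hμ hR =>
    (hT μ hμ).1.restrict Icc_subset_Ici_self fun t ht =>
      ⟨(hT μ hμ).1.mem t ht.1, ((hT μ hμ).2 t ht.1).le.trans hR⟩
  have huniq : ∀ μ ∈ S, ∀ r : ℝ, 0 ≤ r → ∀ m : ℝ → FiniteMeasure (Space d),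
      IsWeakSolution S b ν (Icc 0 r) μ m → ∀ t ∈ Icc 0 r, m t = T μ t := by
    intro μ hμ r hr m hm t ht
    obtain ⟨R, hR⟩ := exists_mass_le (r := r) (m := m) fun f hf t ht =>
      (hm.hasDeriv f hf t ht).continuousWithinAt
    have hμR : μ.mass ≤ R := by
      have := hR 0 ⟨le_rfl, hr⟩
      rwa [hm.init] at this
    obtain ⟨C, H⟩ := h.exists_uniformBounds R
    exact H.eq_of_isWeakSolution (hm.restrict subset_rfl fun t ht => ⟨hm.mem t ht, hR t ht⟩)
      (hbdd R r μ hμ hμR) ht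
  refine ⟨fun t μ => T μ t, fun μ hμ => (hT μ hμ).1, huniq, fun μ hμ => (hT μ hμ).2,
    fun μ hμ => (hT μ hμ).1.init, fun μ hμ s t hs ht => ?_, fun R r => ?_, fun R => ?_⟩
  · have hsol := (hT μ hμ).1
    refine huniq (T μ t) (hsol.mem t ht) s hs (fun u => T μ (u + t))
      ⟨fun u hu => hsol.mem _ (add_nonneg hu.1 ht), by simp, fun f hf u hu => ?_⟩ s ⟨hs, le_rfl⟩
    have := (hsol.hasDeriv f hf (u + t) (add_nonneg hu.1 ht)).scomp u
      (((hasDerivWithinAt_id u (Icc 0 s)).add_const t)) fun v hv => add_nonneg hv.1 ht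
    rwa [one_smul] at this
  · rcases lt_or_ge r 0 with hr | hr
    · exact ⟨0, fun μ _ η _ _ _ t ht => absurd (ht.1.trans ht.2) (not_le.2 hr)⟩
    · obtain ⟨C, H⟩ := h.exists_uniformBounds R
      obtain ⟨L, -, hL⟩ := H.dualDist_solutions_le hr
      exact ⟨L, fun μ hμ η hη hμR hηR t ht =>
        hL μ η _ _ (hbdd R r μ hμ hμR) (hbdd R r η hη hηR) t ht⟩
  · obtain ⟨C, H⟩ := h.exists_uniformBounds R
    exact ⟨3 * C ^ 2, fun μ hμ hμR s t hs ht => H.dualDist_solution_le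
      (hbdd R (max s t) μ hμ hμR) ⟨ht, le_max_right _ _⟩ ⟨hs, le_max_left _ _⟩⟩

end OrderOne

theorem mainTheorem4 (d : ℕ)
    (b : OrderOne.Space d → FiniteMeasure (OrderOne.Space d) → OrderOne.Space d)
    (ν : OrderOne.Space d → FiniteMeasure (OrderOne.Space d) → Measure (OrderOne.Space d))
    (gν : OrderOne.Space d → FiniteMeasure (OrderOne.Space d) →
      OrderOne.SignedVectorMeasure d) :
    (OrderOne.Assumptions (OrderOne.probabilities d) b ν gν →
      OrderOne.WellPosed (OrderOne.probabilities d) b ν) ∧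
    (OrderOne.Assumptions Set.univ b ν gν →
      OrderOne.WellPosed Set.univ b ν) :=
  ⟨fun h => h.wellPosed fun _ hμ _ hη => hη.trans hμ, fun h => h.wellPosed fun _ _ _ _ => trivial⟩
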